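/- Consider the bounded knapsack problem with $n$ items, where item $i$ has an integer weight $w_i\ge 1$, an integer profit $p_i\ge 1$ and an integer multiplicity $m_i\ge 0$, and with capacity $W\in\mathbb{Z}_{\ge 0}$. Regard item $i$ as $m_i$ distinct copies. A solution is a set of copies of total weight at most $W$, and it is optimal if its total profit is the largest possible. Order the copies by decreasing efficiency $p_i/w_i$, with ties between items broken by the index $i$ and the copies of one item consecutive, and let the greedy (maximal prefix) solution $\widetilde{\mathcal I}$ be the longest prefix of this order whose total weight is at most $W$. There are a deterministic word-RAM algorithm and absolute constants $C,c,\kappa\in\mathbb{N}$ such that the following holds for every such instance and every integer $w_{\max}\ge 1$ with $w_i\le w_{\max}$ for all $i$. Given $n$, $W$ and the (not necessarily sorted) triples $(w_i,p_i,m_i)$, the algorithm halts after at most $$C\,(n+w_{\max})\,\bigl(1+\lfloor\log_2(n+w_{\max})\rfloor\bigr)^{c}$$ steps and outputs, as a list without repetitions, a set $\mathcal I_\Delta$ of at most $$C\,w_{\max}\,\bigl(1+\lfloor\log_2 w_{\max}\rfloor\bigr)^{c}$$ copies such that $$\widetilde{\mathcal I}\,\triangle\,\mathcal I^*\subseteq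 \mathcal I_\Delta\quad\text{for some optimal solution }\mathcal I^*.$$ Here the word RAM performs addition, truncated subtraction, multiplication, integer division, remainder, comparison and array access at unit cost on words, and all the words that occur in the computation hold natural numbers smaller than $N^{\kappa}$, where $N=2+n+W+\sum_i(w_i+p_i+m_i)$. -/

import Mathlib

/-! ## Bounded knapsack -/

/-- An instance of bounded knapsack: `n` items, item `i` having weight `w i`, profit `p i` and
multiplicity `m i`, and a capacity `W`. -/
structure BoundedKnapsack where
  n : ℕ
  W : ℕ
  w : Fin n → ℕ
  p : Fin n → ℕ
  m : Fin n → ℕ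
  w_pos : ∀ i, 0 < w i
  p_pos : ∀ i, 0 < p i

namespace BoundedKnapsack

/-- The copies of the items: `⟨i, c⟩` with `c < m i` is copy number `c` of item `i`. They are the
items of the equivalent 0-1 knapsack problem. -/
abbrev Copy (I : BoundedKnapsack) : Type := (i : Fin I.n) × Fin (I.m i)

/-- The total weight of a set of copies. -/
def weight (I : BoundedKnapsack) (S : Finset I.Copy) : ℕ := ∑ x ∈ S, I.w x.1

/-- The total profit of a set of copies. -/
def profit (I : BoundedKnapsack) (S : Finset I.Copy) : ℕ := ∑ x ∈ S, I.p x.1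

/-- An optimal solution: a set of copies that fits and has the largest profit among those. -/
def IsOptimal (I : BoundedKnapsack) (S : Finset I.Copy) : Prop :=
  I.weight S ≤ I.W ∧ ∀ T : Finset I.Copy, I.weight T ≤ I.W → I.profit T ≤ I.profit S

/-- Item `i` comes strictly before item `j` in the order of decreasing efficiency `p / w`
(compared by cross-multiplication; the weights are positive), ties being broken by the index.
On an instance that is already sorted by efficiency this is the given order. -/
def Precedes (I : BoundedKnapsack) (i j : Fin I.n) : Prop :=
  I.p j * I.w i < I.p i * I.w j ∨ (I.p j * I.w i = I.p i * I.w j ∧ i < j)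

/-- Copy `x` comes before copy `y` or is equal to it: the items are in the order of decreasing
efficiency, and the copies of one item are consecutive. -/
def CopyLE (I : BoundedKnapsack) (x y : I.Copy) : Prop :=
  I.Precedes x.1 y.1 ∨ (x.1 = y.1 ∧ (x.2 : ℕ) ≤ (y.2 : ℕ))

instance (I : BoundedKnapsack) (x y : I.Copy) : Decidable (I.CopyLE x y) := by
  unfold CopyLE Precedes; infer_instance

/-- The maximal prefix solution: a copy is taken exactly when it and all the copies before it fit
together. As the weights are positive, this is the longest prefix, in the order `CopyLE`, of total
weight at most `W`. -/
def greedy (I : BoundedKnapsack) : Finset I.Copy :=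
  Finset.univ.filter fun x => I.weight (Finset.univ.filter fun y => I.CopyLE y x) ≤ I.W

/-- A number that exceeds every number in the input. -/
def magnitude (I : BoundedKnapsack) : ℕ :=
  I.n + I.W + ∑ i, (I.w i + I.p i + I.m i) + 2

end BoundedKnapsack

/-! ## A word RAM

Programs of a structured language over finitely many registers and arrays (those that the program
text mentions), with unit-cost instructions. All values are natural numbers below a bound `B`, the
number of values that a machine word can hold; an instruction whose result would be `B` or more
has no execution. -/

namespace WordRAM

/-- The contents of the registers and of the arrays. -/
structure State where
  reg : ℕ → ℕ
  arr : ℕ → ℕ → ℕ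

/-- The binary machine operations. -/
inductive Op
  | add
  | sub
  | mul
  | div
  | mod
  | lt
  | eq

/-- Subtraction is truncated at 0, `x / 0 = 0` and `x % 0 = x`; comparisons return 1 or 0. -/
def Op.eval : Op → ℕ → ℕ → ℕ
  | .add, x, y => x + y
  | .sub, x, y => x - y
  | .mul, x, y => x * y
  | .div, x, y => x / y
  | .mod, x, y => x % y
  | .lt, x, y => if x < y then 1 else 0
  | .eq, x, y => if x = y then 1 else 0

/-- Expressions: constants, registers, array cells, operations. -/
inductive Expr
  | lit (c : ℕ)
  | reg (x : ℕ)
  | get (a : ℕ) (e : Expr)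
  | op (o : Op) (e₁ e₂ : Expr)

/-- The value of an expression; `none` if some value that occurs does not fit into a word. -/
def Expr.eval (B : ℕ) (s : State) : Expr → Option ℕ
  | .lit c => if c < B then some c else none
  | .reg x => some (s.reg x)
  | .get a e => (e.eval B s).map (s.arr a)
  | .op o e₁ e₂ =>
    match e₁.eval B s, e₂.eval B s with
    | some x, some y => if o.eval x y < B then some (o.eval x y) else none
    | _, _ => none

/-- The time to evaluate an expression: one step for each constant, register access, array access
and operation in it. -/
def Expr.cost : Expr → ℕ
  | .lit _ => 1
  | .reg _ => 1
  | .get _ e => e.cost + 1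
  | .op _ e₁ e₂ => e₁.cost + e₂.cost + 1

/-- Programs: `set x e` assigns to a register, `put a e₁ e₂` stores the value of `e₂` in cell `e₁`
of array `a`, `branch` tests whether `e` is nonzero, `loop` repeats while `e` is nonzero. -/
inductive Program
  | skip
  | set (x : ℕ) (e : Expr)
  | put (a : ℕ) (e₁ e₂ : Expr)
  | seq (P Q : Program)
  | branch (e : Expr) (P Q : Program)
  | loop (e : Expr) (P : Program)

/-- `Exec B P s t s'`: with words of values below `B`, program `P` started in state `s` halts
after `t` steps in state `s'`. -/
inductive Exec (B : ℕ) : Program → State → ℕ → State → Prop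
  | skip (s : State) : Exec B .skip s 1 s
  | set {s : State} {x : ℕ} {e : Expr} {v : ℕ} (he : e.eval B s = some v) :
      Exec B (.set x e) s (e.cost + 1) { s with reg := Function.update s.reg x v }
  | put {s : State} {a : ℕ} {e₁ e₂ : Expr} {j v : ℕ}
      (he₁ : e₁.eval B s = some j) (he₂ : e₂.eval B s = some v) :
      Exec B (.put a e₁ e₂) s (e₁.cost + e₂.cost + 1)
        { s with arr := Function.update s.arr a (Function.update (s.arr a) j v) }
  | seq {P Q : Program} {s s' s'' : State} {t t' : ℕ}
      (hP : Exec B P s t s') (hQ : Exec B Q s' t' s'') : Exec B (.seq P Q) s (t + t') s''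
  | branch_true {e : Expr} {P Q : Program} {s s' : State} {v t : ℕ}
      (he : e.eval B s = some v) (hv : v ≠ 0) (hP : Exec B P s t s') :
      Exec B (.branch e P Q) s (e.cost + 1 + t) s'
  | branch_false {e : Expr} {P Q : Program} {s s' : State} {t : ℕ}
      (he : e.eval B s = some 0) (hQ : Exec B Q s t s') :
      Exec B (.branch e P Q) s (e.cost + 1 + t) s'
  | loop_true {e : Expr} {P : Program} {s s' s'' : State} {v t t' : ℕ}
      (he : e.eval B s = some v) (hv : v ≠ 0) (hP : Exec B P s t s')
      (hL : Exec B (.loop e P) s' t' s'') :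
      Exec B (.loop e P) s (e.cost + 1 + t + t') s''
  | loop_false {e : Expr} {P : Program} {s : State} (he : e.eval B s = some 0) :
      Exec B (.loop e P) s (e.cost + 1) s

/-- The initial state on input `I`: register 0 holds `n`, register 1 holds `W`, the arrays 0, 1
and 2 hold the weights, the profits and the multiplicities; everything else is 0. -/
def initState (I : BoundedKnapsack) : State where
  reg := fun x => if x = 0 then I.n else if x = 1 then I.W else 0
  arr := fun a j =>
    if h : j < I.n then
      if a = 0 then I.w ⟨j, h⟩ else if a = 1 then I.p ⟨j, h⟩ else if a = 2 then I.m ⟨j, h⟩ else 0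
    else 0

/-- The final state `s` presents the list `L` of copies: register 0 holds its length, and for each
position `t`, cell `t` of array 0 holds the item number and cell `t` of array 1 the copy number
of its entry. -/
def Outputs {I : BoundedKnapsack} (s : State) (L : List I.Copy) : Prop :=
  s.reg 0 = L.length ∧
    ∀ (t : ℕ) (ht : t < L.length), s.arr 0 t = (L[t].1 : ℕ) ∧ s.arr 1 t = (L[t].2 : ℕ)

end WordRAM

/-!
Items outside a small candidate set can be treated greedily because of an exchange argument. Among
the optimal solutions, take one that is *unimprovable*: no nonempty set of its copies can be
replaced by a set of equal weight of copies that all come earlier in the order of efficiency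
(`BoundedKnapsack.exists_isOptimal_unimprovable`). Such a solution differs from the greedy solution
by at most `U` copies on each side, where `U` is the largest weight. It also takes, among the copies
of one weight, the earliest ones; so the copies of a given weight that it removes from the greedy
solution are the last ones there, and those that it adds are the first ones outside.

For most weights far fewer than `U` copies can change. By Scherk's theorem
(`card_add_card_le_card_add_succ`), many distinct residues that are each available often enough
contain a short zero-sum sequence. Suppose that, on one side of the greedy solution, the weights in
a class `[c, 2 * c)` that have at least `T` copies close to the end of the greedy solution are so
many that their number times `T` is at least `16 * U`. If more than `T` copies of one weight of this
class that lie further away were changed, some of them could be exchanged, at equal weight, for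
unchanged copies of those weights close to the end, which contradicts unimprovability. Hence a weight that reaches `T` copies only after that point changes in at most
`2 * T` copies (`BoundedKnapsack.Layout.changed_le_of_blocks`).

The algorithm computes `U`, sorts the items by efficiency with merge sort, computes the greedy
solution, and scans the items outwards from the end of the greedy solution, first on one side and
then on the other. For each weight it keeps a limit for the number of copies, lowered to `2 * T`
whenever the threshold `T`, a power of two, is blocked in the sense above, and it outputs the copies
within the limits. For each class and each threshold the weights that were not blocked number at
most `17 * U / T`, and there are logarithmically many classes and thresholds, so the number of
copies in the output is `O(U * log U ^ 2)` (`Scan.sum_emit_le`).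

On the word RAM, `WordRAM.wp` computes a sufficient condition for the success of a loop-free
program, and `WordRAM.Runs.loop` is the rule for a loop whose number of iterations is known. The
numbers of copies and the limits per weight are tables indexed by twice the weight plus the side.
Words of more than `16 * N ^ 2` values suffice, where `N` is the magnitude of the instance.
-/

/-! ### Reasoning about word RAM programs -/

namespace WordRAM

/-- The state `s` with register `x` set to `v`. -/
def State.setReg (s : State) (x v : ℕ) : State :=
  { s with reg := Function.update s.reg x v }

/-- The state `s` with cell `j` of array `a` set to `v`. -/
def State.setArr (s : State) (a j v : ℕ) : State :=
  { s with arr := Function.update s.arr a (Function.update (s.arr a) j v) }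

@[simp] theorem State.reg_setReg (s : State) (x v y : ℕ) :
    (s.setReg x v).reg y = if y = x then v else s.reg y := by
  simp [State.setReg, Function.update_apply]

@[simp] theorem State.setReg_setReg (s : State) (x v v' : ℕ) :
    (s.setReg x v).setReg x v' = s.setReg x v' := by
  simp [State.setReg]

@[simp] theorem State.arr_setReg (s : State) (x v : ℕ) : (s.setReg x v).arr = s.arr := rfl

@[simp] theorem State.reg_setArr (s : State) (a j v : ℕ) : (s.setArr a j v).reg = s.reg := rfl

@[simp] theorem State.arr_setArr (s : State) (a j v a' : ℕ) :
    (s.setArr a j v).arr a' = if a' = a then Function.update (s.arr a) j v else s.arr a' := by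
  simp [State.setArr, Function.update_apply]

/-- The value of an expression over unbounded natural numbers. -/
def Expr.val (s : State) : Expr → ℕ
  | .lit c => c
  | .reg x => s.reg x
  | .get a e => s.arr a (e.val s)
  | .op o e₁ e₂ => o.eval (e₁.val s) (e₂.val s)

/-- No literal, sum or product in the expression overflows. In a state whose contents are words
this suffices for the evaluation to succeed, as the other operations do not exceed their
arguments or 1. -/
def Expr.Fits (B : ℕ) (s : State) : Expr → Prop
  | .lit c => c < B
  | .reg _ => True
  | .get _ e => e.Fits B s
  | .op .add e₁ e₂ => e₁.Fits B s ∧ e₂.Fits B s ∧ e₁.val s + e₂.val s < B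
  | .op .mul e₁ e₂ => e₁.Fits B s ∧ e₂.Fits B s ∧ e₁.val s * e₂.val s < B
  | .op _ e₁ e₂ => e₁.Fits B s ∧ e₂.Fits B s

/-- All contents of registers and arrays are words. -/
def State.Words (B : ℕ) (s : State) : Prop :=
  (∀ x, s.reg x < B) ∧ ∀ a j, s.arr a j < B

theorem Expr.val_lt {B : ℕ} (hB : 1 < B) {s : State} (hs : s.Words B) :
    ∀ {e : Expr}, e.Fits B s → e.val s < B
  | .lit _, h => h
  | .reg x, _ => hs.1 x
  | .get a e, _ => hs.2 a _
  | .op .add _ _, h => h.2.2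
  | .op .mul _ _, h => h.2.2
  | .op .sub _ _, h => (Nat.sub_le _ _).trans_lt (Expr.val_lt hB hs h.1)
  | .op .div _ _, h => (Nat.div_le_self _ _).trans_lt (Expr.val_lt hB hs h.1)
  | .op .mod _ _, h => (Nat.mod_le _ _).trans_lt (Expr.val_lt hB hs h.1)
  | .op .lt _ _, _ => by simp only [Expr.val, Op.eval]; split_ifs <;> omega
  | .op .eq _ _, _ => by simp only [Expr.val, Op.eval]; split_ifs <;> omega

theorem Expr.eval_eq {B : ℕ} (hB : 1 < B) {s : State} (hs : s.Words B) {e : Expr}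
    (h : e.Fits B s) : e.eval B s = some (e.val s) := by
  induction e with
  | lit c =>
    have h' : c < B := h
    simp [Expr.eval, Expr.val, h']
  | reg x => rfl
  | get a e ih => simp [Expr.eval, Expr.val, ih h]
  | op o e₁ e₂ ih₁ ih₂ =>
    have hv := Expr.val_lt hB hs h
    have h12 : e₁.Fits B s ∧ e₂.Fits B s := by
      cases o <;> exact ⟨h.1, by first | exact h.2 | exact h.2.1⟩
    simp only [Expr.eval, ih₁ h12.1, ih₂ h12.2]
    simp only [Expr.val] at hv
    simp [Expr.val, hv]

/-- Started in the state `s`, whose contents are words, the program `P` halts after at most `T`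
steps, in a state that satisfies `Q` and whose contents are again words. -/
def Runs (B : ℕ) (P : Program) (s : State) (T : ℕ) (Q : State → Prop) : Prop :=
  s.Words B → ∃ t s', Exec B P s t s' ∧ t ≤ T ∧ s'.Words B ∧ Q s'

theorem Runs.weaken {B : ℕ} {P : Program} {s : State} {T T' : ℕ} {Q Q' : State → Prop}
    (h : Runs B P s T Q) (hT : T ≤ T') (hQ : ∀ s, Q s → Q' s) : Runs B P s T' Q' := by
  intro hs
  obtain ⟨t, s', h1, h2, h3, h4⟩ := h hs
  exact ⟨t, s', h1, h2.trans hT, h3, hQ _ h4⟩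

theorem Runs.seq {B : ℕ} {P P' : Program} {s : State} {T T' : ℕ} {Q : State → Prop}
    (h : Runs B P s T fun s' => Runs B P' s' T' Q) : Runs B (.seq P P') s (T + T') Q := by
  intro hs
  obtain ⟨t, s', h1, h2, h3, h4⟩ := h hs
  obtain ⟨t', s'', h1', h2', h3', h4'⟩ := h4 h3
  exact ⟨t + t', s'', .seq h1 h1', by omega, h3', h4'⟩

theorem State.Words.setReg {B : ℕ} {s : State} (hs : s.Words B) {x v : ℕ} (hv : v < B) :
    (s.setReg x v).Words B := by
  refine ⟨fun y => ?_, hs.2⟩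
  rw [State.reg_setReg]; split_ifs
  · exact hv
  · exact hs.1 y

theorem State.Words.setArr {B : ℕ} {s : State} (hs : s.Words B) {a j v : ℕ} (hv : v < B) :
    (s.setArr a j v).Words B := by
  refine ⟨hs.1, fun b i => ?_⟩
  rw [State.arr_setArr]; split_ifs
  · rw [Function.update_apply]; split_ifs
    · exact hv
    · exact hs.2 _ _
  · exact hs.2 _ _

/-- An upper bound for the running time of a loop-free program. -/
def Program.time : Program → ℕ
  | .skip => 1
  | .set _ e => e.cost + 1
  | .put _ e₁ e₂ => e₁.cost + e₂.cost + 1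
  | .seq P Q => P.time + Q.time
  | .branch e P Q => e.cost + 1 + max P.time Q.time
  | .loop _ _ => 0

/-- A sufficient condition for the loop-free program to succeed with result in `Q`; loops are
given the condition `False`. -/
def wp (B : ℕ) : Program → (State → Prop) → State → Prop
  | .skip, Q, s => Q s
  | .set x e, Q, s => e.Fits B s ∧ Q (s.setReg x (e.val s))
  | .put a e₁ e₂, Q, s => e₁.Fits B s ∧ e₂.Fits B s ∧ Q (s.setArr a (e₁.val s) (e₂.val s))
  | .seq P P', Q, s => wp B P (wp B P' Q) s
  | .branch e P P', Q, s =>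
    e.Fits B s ∧ (e.val s ≠ 0 → wp B P Q s) ∧ (e.val s = 0 → wp B P' Q s)
  | .loop _ _, _, _ => False

theorem Runs.of_wp_time {B : ℕ} (hB : 1 < B) {P : Program} {s : State} {Q : State → Prop}
    (h : wp B P Q s) : Runs B P s P.time Q := by
  induction P generalizing s Q with
  | skip => exact fun hs => ⟨1, s, .skip s, le_rfl, hs, h⟩
  | set x e =>
    exact fun hs => ⟨_, _, .set (Expr.eval_eq hB hs h.1), le_rfl,
      hs.setReg (Expr.val_lt hB hs h.1), h.2⟩
  | put a e₁ e₂ =>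
    exact fun hs => ⟨_, _, .put (Expr.eval_eq hB hs h.1) (Expr.eval_eq hB hs h.2.1), le_rfl,
      hs.setArr (Expr.val_lt hB hs h.2.1), h.2.2⟩
  | seq P P' ih ih' =>
    exact Runs.seq ((ih h).weaken le_rfl fun s' hs' => ih' hs')
  | branch e P P' ih ih' =>
    intro hs
    by_cases hv : e.val s = 0
    · obtain ⟨t, s', h1, h2, h3, h4⟩ := ih' (h.2.2 hv) hs
      have he := Expr.eval_eq hB hs h.1
      rw [hv] at he
      refine ⟨_, s', .branch_false he h1, ?_, h3, h4⟩
      simp only [Program.time]; omega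
    · obtain ⟨t, s', h1, h2, h3, h4⟩ := ih (h.2.1 hv) hs
      refine ⟨_, s', .branch_true (Expr.eval_eq hB hs h.1) hv h1, ?_, h3, h4⟩
      simp only [Program.time]; omega
  | loop e P => exact h.elim

theorem Runs.of_wp {B T : ℕ} (hB : 1 < B) {P : Program} {s : State} {Q : State → Prop}
    (hT : P.time ≤ T) (h : wp B P Q s) : Runs B P s T Q :=
  (Runs.of_wp_time hB h).weaken hT fun _ h => h

/-- A loop whose body is executed exactly `K` times, the `k`-th time within `f k` steps. -/
theorem Runs.loop {B : ℕ} (hB : 1 < B) {e : Expr} {P : Program} {K : ℕ} {f : ℕ → ℕ}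
    (Inv : ℕ → State → Prop) {s : State} {Q : State → Prop} (h0 : Inv 0 s)
    (hstep : ∀ k s, k < K → Inv k s →
      e.Fits B s ∧ e.val s ≠ 0 ∧ Runs B P s (f k) (Inv (k + 1)))
    (hend : ∀ s, Inv K s → e.Fits B s ∧ e.val s = 0 ∧ Q s) :
    Runs B (.loop e P) s (∑ k ∈ Finset.range K, f k + (K + 1) * (e.cost + 1)) Q := by
  suffices H : ∀ d k s, k + d = K → Inv k s →
      Runs B (.loop e P) s (∑ i ∈ Finset.range d, f (k + i) + (d + 1) * (e.cost + 1)) Q by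
    simpa using H K 0 s (by simp) h0
  intro d
  induction d with
  | zero =>
    intro k s hk hI hs
    obtain rfl : k = K := by omega
    obtain ⟨h1, h2, h3⟩ := hend s hI
    have he := Expr.eval_eq hB hs h1
    rw [h2] at he
    exact ⟨_, s, .loop_false he, by simp, hs, h3⟩
  | succ d ih =>
    intro k s hk hI hs
    obtain ⟨h1, h2, h3⟩ := hstep k s (by omega) hI
    obtain ⟨t, s', e1, e2, e3, e4⟩ := h3 hs
    obtain ⟨t', s'', e1', e2', e3', e4'⟩ := ih (k + 1) s' (by omega) e4 e3
    refine ⟨_, s'', .loop_true (Expr.eval_eq hB hs h1) h2 e1 e1', ?_, e3', e4'⟩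
    rw [Finset.sum_range_succ']
    simp only [Nat.add_zero]
    have : ∀ i, f (k + 1 + i) = f (k + (i + 1)) := fun i => by congr 1; omega
    simp only [this] at e2'
    rw [add_mul (d + 1) 1]
    omega

end WordRAM

/-! ### Zero-sum sequences and equal subset sums -/

section ZeroSum

open scoped Pointwise
open Classical in
/-- Scherk's theorem in a finite abelian group. It is proved with Dyson's transform, which
moves elements from `B` to `A` and preserves the hypothesis. -/
theorem card_add_card_le_card_add_succ {G : Type*} [AddCommGroup G] [Finite G]
    (A B : Finset G) (hA : 0 ∈ A) (hB : 0 ∈ B)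
    (h : ∀ a ∈ A, ∀ b ∈ B, a + b = 0 → a = 0) : A.card + B.card ≤ (A + B).card + 1 := by
  induction hn : B.card using Nat.strong_induction_on generalizing A B with
  | _ n ih =>
    subst hn
    by_cases hB0 : B = {0}
    · subst hB0; simp
    obtain ⟨b, hb, hb0⟩ : ∃ b ∈ B, b ≠ 0 := by
      by_contra! hcon
      exact hB0 (Finset.eq_singleton_iff_unique_mem.2 ⟨hB, hcon⟩)
    obtain ⟨e, he, b', hb', heb⟩ : ∃ e ∈ A, ∃ b' ∈ B, e + b' ∉ A := by
      by_contra! hcon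
      have hmul : ∀ n : ℕ, n • b ∈ A := by
        intro n
        induction n with
        | zero => simpa using hA
        | succ n ihn => rw [succ_nsmul]; exact hcon _ ihn _ hb
      have hord := addOrderOf_pos b
      have hz : (addOrderOf b - 1) • b + b = 0 := by
        rw [← succ_nsmul, Nat.sub_add_cancel hord, addOrderOf_nsmul_eq_zero]
      have := h _ (hmul _) b hb hz
      rw [this, zero_add] at hz
      exact hb0 hz
    set A' := A ∪ (B.filter fun x => e + x ∉ A).image (e + ·) with hA'
    set B' := B.filter fun x => e + x ∈ A with hB'
    have hcardA : A'.card = A.card + (B.filter fun x => e + x ∉ A).card := by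
      rw [hA', Finset.card_union_of_disjoint, Finset.card_image_of_injective _
        (add_right_injective e)]
      rw [Finset.disjoint_left]
      intro x hx hx'
      obtain ⟨y, hy, rfl⟩ := Finset.mem_image.1 hx'
      exact (Finset.mem_filter.1 hy).2 hx
    have hcardB : B'.card + (B.filter fun x => e + x ∉ A).card = B.card :=
      Finset.card_filter_add_card_filter_not _
    have hpos : 0 < (B.filter fun x => e + x ∉ A).card :=
      Finset.card_pos.2 ⟨b', by simp [hb', heb]⟩
    have key := ih B'.card (by omega) A' B' (by simp [hA', hA]) (by simp [hB', hB, he]) ?_ rfl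
    · have hsub : A' + B' ⊆ A + B := by
        intro z hz
        obtain ⟨a, ha, x, hx, rfl⟩ := Finset.mem_add.1 hz
        obtain ⟨hxB, hxA⟩ := Finset.mem_filter.1 hx
        rcases Finset.mem_union.1 ha with ha | ha
        · exact Finset.add_mem_add ha hxB
        · obtain ⟨y, hy, rfl⟩ := Finset.mem_image.1 ha
          have := Finset.add_mem_add hxA (Finset.mem_filter.1 hy).1
          convert this using 1
          abel
      have := Finset.card_le_card hsub
      omega
    · intro a ha x hx hax
      obtain ⟨hxB, hxA⟩ := Finset.mem_filter.1 hx
      rcases Finset.mem_union.1 ha with ha | ha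
      · exact h a ha x hxB hax
      · obtain ⟨y, hy, rfl⟩ := Finset.mem_image.1 ha
        have hyB := (Finset.mem_filter.1 hy).1
        have h1 : (e + x) + y = 0 := by rw [← hax]; abel
        have h2 := h _ hxA y hyB h1
        rw [h2, zero_add] at h1
        have h3 : e = 0 := h e he x hxB h2
        rw [h1, h3, add_zero]

open Classical in
/-- Sums of at most `j` elements of `X` form a set of more than `j * |X|` elements as long as
there is no zero sum, by Scherk's theorem. -/
theorem exists_multiset_sum_eq_zero {G : Type*} [AddCommGroup G] [Fintype G] (X : Finset G)
    (h : ℕ) (hX : Fintype.card G ≤ h * X.card) :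
    ∃ s : Multiset G, s ≠ 0 ∧ s.card ≤ h ∧ (∀ x ∈ s, x ∈ X) ∧ s.sum = 0 := by
  by_contra! hcon
  have hGpos : 0 < Fintype.card G := Fintype.card_pos
  have hh : 0 < h := Nat.pos_of_ne_zero fun h0 => by subst h0; omega
  have h0X : (0 : G) ∉ X := fun h0 =>
    hcon {0} (by simp) (by simpa [Nat.succ_le_iff] using hh) (by simpa using h0) (by simp)
  set S : ℕ → Finset G := fun j =>
    Finset.univ.filter fun g => ∃ s : Multiset G, s.card ≤ j ∧ (∀ x ∈ s, x ∈ X) ∧ s.sum = g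
    with hS
  have hcard : ∀ j ≤ h, j * X.card + 1 ≤ (S j).card := by
    intro j
    induction j with
    | zero =>
      intro _
      have : (0 : G) ∈ S 0 := by simp [hS]
      have := Finset.card_pos.2 ⟨_, this⟩
      omega
    | succ j ih =>
      intro hj
      have h1 := card_add_card_le_card_add_succ (S j) (insert 0 X)
        (by simp only [hS, Finset.mem_filter, Finset.mem_univ, true_and]
            exact ⟨0, by simp, by simp, by simp⟩) (by simp) ?_
      · have hsub : S j + insert 0 X ⊆ S (j + 1) := by
          intro z hz
          obtain ⟨a, ha, b, hb, rfl⟩ := Finset.mem_add.1 hz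
          obtain ⟨s, hs1, hs2, rfl⟩ := (Finset.mem_filter.1 ha).2
          simp only [hS, Finset.mem_filter, Finset.mem_univ, true_and]
          rcases Finset.mem_insert.1 hb with rfl | hb
          · exact ⟨s, by omega, hs2, by simp⟩
          · refine ⟨b ::ₘ s, by simpa using hs1, ?_, by simp [add_comm]⟩
            intro x hx
            rcases Multiset.mem_cons.1 hx with rfl | hx
            · exact hb
            · exact hs2 x hx
        have h2 := Finset.card_le_card hsub
        rw [Finset.card_insert_of_notMem h0X] at h1
        have := ih (by omega)
        rw [add_mul]
        omega
      · intro a ha b hb hab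
        obtain ⟨s, hs1, hs2, rfl⟩ := (Finset.mem_filter.1 ha).2
        rcases Finset.mem_insert.1 hb with rfl | hb
        · simpa using hab
        · exfalso
          refine hcon (b ::ₘ s) (by simp) (by rw [Multiset.card_cons]; omega) ?_
            (by rw [Multiset.sum_cons, add_comm]; exact hab)
          intro x hx
          rcases Multiset.mem_cons.1 hx with rfl | hx
          · exact hb
          · exact hs2 x hx
  have := hcard h le_rfl
  have h2 := Finset.card_le_univ (S h)
  omega

end ZeroSum

/-- Numbers from an interval `[c, 2c)` that contains `w` are distinct modulo `w`, so that the
zero-sum theorem applies to their residues. -/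
theorem exists_multiset_dvd_sum {c w h : ℕ} (K : Finset ℕ) (hw : c ≤ w) (hc : 0 < c)
    (hK : ∀ u ∈ K, c ≤ u ∧ u < 2 * c) (h1 : w ≤ h * K.card) :
    ∃ s : Multiset ℕ, s ≠ 0 ∧ s.card ≤ h ∧ (∀ u ∈ s, u ∈ K) ∧ w ∣ s.sum := by
  classical
  have : NeZero w := ⟨by omega⟩
  have hinj : Set.InjOn (fun u : ℕ => (u : ZMod w)) K := by
    intro u hu v hv huv
    have huv' : u ≡ v [MOD w] := (ZMod.natCast_eq_natCast_iff _ _ _).1 huv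
    have hu := hK u hu
    have hv := hK v hv
    rcases le_total u v with hle | hle
    · have := Nat.eq_zero_of_dvd_of_lt ((Nat.modEq_iff_dvd' hle).1 huv') (by omega)
      omega
    · have := Nat.eq_zero_of_dvd_of_lt ((Nat.modEq_iff_dvd' hle).1 huv'.symm) (by omega)
      omega
  obtain ⟨s, hs0, hs1, hs2, hs3⟩ :=
    exists_multiset_sum_eq_zero (K.image fun u : ℕ => (u : ZMod w)) h
      (by rw [Finset.card_image_of_injOn hinj, ZMod.card]; exact h1)
  have hex : ∀ x : ZMod w, ∃ u : ℕ, x ∈ s → u ∈ K ∧ (u : ZMod w) = x := by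
    intro x
    by_cases hx : x ∈ s
    · obtain ⟨u, hu, hux⟩ := Finset.mem_image.1 (hs2 x hx)
      exact ⟨u, fun _ => ⟨hu, hux⟩⟩
    · exact ⟨0, fun h => (hx h).elim⟩
  choose g hg using hex
  refine ⟨s.map g, by simpa using hs0, by simpa using hs1, ?_, ?_⟩
  · intro u hu
    obtain ⟨x, hx, rfl⟩ := Multiset.mem_map.1 hu
    exact (hg x hx).1
  · rw [← ZMod.natCast_eq_zero_iff, ← hs3]
    rw [← Nat.coe_castAddMonoidHom (α := ZMod w), map_multiset_sum, Multiset.map_map]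
    congr 1
    conv_rhs => rw [← Multiset.map_id s]
    exact Multiset.map_congr rfl fun x hx => by simpa using (hg x hx).2

theorem Multiset.exists_le_map_eq {α β : Type*} (f : α → β) (t : Multiset α) (s : Multiset β)
    (h : s ≤ t.map f) : ∃ u ≤ t, u.map f = s := by
  classical
  induction t using Multiset.induction_on generalizing s with
  | empty => exact ⟨0, le_rfl, by simpa [eq_comm] using h⟩
  | cons a t ih =>
    rw [Multiset.map_cons] at h
    by_cases ha : f a ∈ s
    · obtain ⟨u, hu, hus⟩ := ih (s.erase (f a)) (Multiset.erase_le_iff_le_cons.2 h)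
      exact ⟨a ::ₘ u, Multiset.cons_le_cons a hu, by
        rw [Multiset.map_cons, hus, Multiset.cons_erase ha]⟩
    · obtain ⟨u, hu, hus⟩ := ih s ((Multiset.le_cons_of_notMem ha).1 h)
      exact ⟨u, hu.trans (Multiset.le_cons_self t a), hus⟩

theorem Finset.exists_subset_map_eq {α : Type*} (ω : α → ℕ) (A : Finset α) (s : Multiset ℕ)
    (h : ∀ u ∈ s, s.card ≤ (A.filter fun x => ω x = u).card) :
    ∃ A' ⊆ A, A'.val.map ω = s := by
  classical
  obtain ⟨u, hu, hus⟩ := Multiset.exists_le_map_eq ω A.val s (by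
    rw [Multiset.le_iff_count]
    intro a
    by_cases ha : a ∈ s
    · refine (Multiset.count_le_card a s).trans ((h a ha).trans (le_of_eq ?_))
      rw [Multiset.count_map, Finset.card_def, Finset.filter_val]
      simp only [eq_comm]
    · rw [Multiset.count_eq_zero_of_notMem ha]; exact Nat.zero_le _)
  exact ⟨⟨u, Multiset.nodup_of_le hu A.nodup⟩, Finset.val_le_iff.1 hu, hus⟩

/-- The exchange lemma behind the selection of copies. Let `A` contain at least `T` elements of
each of the weights `u ∈ K`, all of them in `[c, 2c)`, with `|K| * T ≥ 16 U`, and let `B` consist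
of more than `T` elements of a single weight `w ≥ c`. If the set `D` of forbidden
elements is of size at most `U`, then for most weights half of their elements of `A` remain, and
a short sequence of these weights sums up to a multiple of `w`. -/
theorem exists_subsets_sum_eq {α : Type*} [DecidableEq α] (ω : α → ℕ) (A D B : Finset α)
    (K : Finset ℕ) {c w T U : ℕ} (hc : 0 < c) (hT : 0 < T) (hK : ∀ u ∈ K, c ≤ u ∧ u < 2 * c)
    (hA : ∀ u ∈ K, T ≤ (A.filter fun x => ω x = u).card) (hKT : 16 * U ≤ K.card * T)
    (hD : D.card ≤ U) (hcw : c ≤ w) (hwU : w ≤ U)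
    (hB : ∀ x ∈ B, ω x = w) (hBT : T + 1 ≤ B.card) :
    ∃ A' ⊆ A \ D, ∃ B' ⊆ B, A'.Nonempty ∧ B'.Nonempty ∧ ∑ x ∈ A', ω x = ∑ x ∈ B', ω x := by
  classical
  obtain ⟨h, hh⟩ : ∃ h, h = (T + 1) / 2 := ⟨_, rfl⟩
  set K1 := K.filter fun u => h ≤ ((A \ D).filter fun x => ω x = u).card with hK1
  set K2 := K.filter fun u => ¬ h ≤ ((A \ D).filter fun x => ω x = u).card with hK2
  have hcard : K1.card + K2.card = K.card := Finset.card_filter_add_card_filter_not _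
  -- Each weight of `K2` has at least `T + 1 - h ≥ T / 2` elements in `D`.
  have hK2D : K2.card * (T + 1 - h) ≤ D.card := by
    refine (Finset.card_nsmul_le_sum K2 (fun u => (D.filter fun x => ω x = u).card) _ ?_).trans ?_
    · intro u hu
      obtain ⟨hu1, hu2⟩ := Finset.mem_filter.1 hu
      have h1 := hA u hu1
      have h2 : (A.filter fun x => ω x = u) ⊆
          ((A \ D).filter fun x => ω x = u) ∪ (D.filter fun x => ω x = u) := by
        intro x hx
        simp only [Finset.mem_filter, Finset.mem_union, Finset.mem_sdiff] at hx ⊢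
        tauto
      have h3 := (Finset.card_le_card h2).trans (Finset.card_union_le _ _)
      omega
    · rw [← Finset.card_biUnion]
      · exact Finset.card_le_card (Finset.biUnion_subset.2 fun u _ => Finset.filter_subset _ _)
      · intro u _ v _ huv
        rw [Function.onFun, Finset.disjoint_left]
        intro x hx hx'
        exact huv ((Finset.mem_filter.1 hx).2.symm.trans (Finset.mem_filter.1 hx').2)
  have hK1h : w ≤ h * K1.card := by
    have h1 : K2.card * T ≤ 2 * (K2.card * (T + 1 - h)) := by
      rw [Nat.mul_left_comm]; exact Nat.mul_le_mul_left _ (by omega)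
    have h2 : K1.card * T ≤ 2 * (h * K1.card) := by
      rw [Nat.mul_comm h, Nat.mul_left_comm]; exact Nat.mul_le_mul_left _ (by omega)
    have h3 : K.card * T = K1.card * T + K2.card * T := by rw [← add_mul, hcard]
    omega
  obtain ⟨s, hs0, hs1, hs2, q, hq⟩ := exists_multiset_dvd_sum K1 hcw hc
    (fun u hu => hK u (Finset.mem_filter.1 hu).1) hK1h
  obtain ⟨A', hA'1, hA'2⟩ := Finset.exists_subset_map_eq ω (A \ D) s
    (fun u hu => hs1.trans (Finset.mem_filter.1 (hs2 u hu)).2)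
  have hsumA : ∑ x ∈ A', ω x = w * q := by rw [← hq, ← hA'2]; rfl
  have hspos : 0 < s.card := Multiset.card_pos.2 hs0
  have hA'card : A'.card = s.card := by rw [← hA'2, Multiset.card_map]; rfl
  have hq1 : 0 < q := by
    obtain ⟨x, hx⟩ := Finset.card_pos.1 (hA'card ▸ hspos)
    have hxs : ω x ∈ s := by rw [← hA'2]; exact Multiset.mem_map_of_mem ω hx
    have h1 := Multiset.le_sum_of_mem hxs
    have h2 := (hK _ (Finset.mem_filter.1 (hs2 _ hxs)).1).1
    rw [hq] at h1
    refine Nat.pos_of_ne_zero fun h0 => ?_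
    subst h0
    omega
  have hq2 : q ≤ T + 1 := by
    have h1 : s.sum ≤ s.card • (2 * c) := Multiset.sum_le_card_nsmul s _ fun x hx =>
      (hK _ (Finset.mem_filter.1 (hs2 x hx)).1).2.le
    rw [hq, smul_eq_mul] at h1
    have h2 : c * q ≤ c * (2 * s.card) := calc
      c * q ≤ w * q := Nat.mul_le_mul_right _ hcw
      _ ≤ s.card * (2 * c) := h1
      _ = c * (2 * s.card) := by ring
    have h3 := Nat.le_of_mul_le_mul_left h2 hc
    omega
  obtain ⟨B', hB'1, hB'2⟩ := Finset.exists_subset_card_eq (hq2.trans hBT)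
  refine ⟨A', hA'1, B', hB'1, Finset.card_pos.1 (hA'card ▸ hspos),
    Finset.card_pos.1 (by omega), ?_⟩
  rw [hsumA, Finset.sum_congr rfl fun x hx => hB x (hB'1 hx), Finset.sum_const, hB'2, smul_eq_mul,
    mul_comm]

theorem Finset.exists_chain {α : Type*} [DecidableEq α] (S : Finset α) :
    ∃ F : ℕ → Finset α, F 0 = ∅ ∧ F S.card = S ∧
      ∀ i < S.card, ∃ x ∈ S, x ∉ F i ∧ F (i + 1) = insert x (F i) := by
  induction S using Finset.induction_on with
  | empty => exact ⟨fun _ => ∅, rfl, rfl, by simp⟩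
  | insert a s ha ih =>
    obtain ⟨F, h0, h1, h2⟩ := ih
    refine ⟨fun i => if i ≤ s.card then F i else insert a s, by simp [h0], ?_, ?_⟩
    · simp [Finset.card_insert_of_notMem ha]
    · intro i hi
      rw [Finset.card_insert_of_notMem ha] at hi
      rcases Nat.lt_or_ge i s.card with hlt | hge
      · obtain ⟨x, hx, hxi, hF⟩ := h2 i hlt
        refine ⟨x, Finset.mem_insert_of_mem hx, ?_, ?_⟩
        · simpa [hlt.le] using hxi
        · simp [hlt.le, Nat.succ_le_of_lt hlt, hF]
      · obtain rfl : i = s.card := by omega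
        exact ⟨a, Finset.mem_insert_self a s, by simpa [h1] using ha, by simp [h1]⟩

/-- Two sets of weights whose totals differ suitably have nonempty parts of equal weight as soon
as one of them has `m` elements: subtract from each prefix sum of the first set the largest
prefix sum of the second set below it, and apply the pigeonhole principle. -/
theorem exists_subsets_sum_eq_of_card {α : Type*} [DecidableEq α] (ω : α → ℕ) (R S : Finset α)
    {m : ℕ} (hR : ∀ x ∈ R, 0 < ω x) (hS : ∀ x ∈ S, ω x ≤ m)
    (hRS : ∑ x ∈ R, ω x < ∑ x ∈ S, ω x + m) (hcard : m ≤ R.card) :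
    ∃ R' ⊆ R, ∃ S' ⊆ S, R'.Nonempty ∧ S'.Nonempty ∧ ∑ x ∈ R', ω x = ∑ x ∈ S', ω x := by
  obtain ⟨F, hF0, hF1, hF2⟩ := R.exists_chain
  obtain ⟨G, hG0, hG1, hG2⟩ := S.exists_chain
  have mono : ∀ (X : Finset α) (H : ℕ → Finset α),
      (∀ i < X.card, ∃ x ∈ X, x ∉ H i ∧ H (i + 1) = insert x (H i)) →
      ∀ i j, i ≤ j → j ≤ X.card → H i ⊆ H j := by
    intro X H hH i j hij
    induction j, hij using Nat.le_induction with
    | base => exact fun _ => subset_rfl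
    | succ j hij ih =>
      intro hj
      obtain ⟨x, -, -, hx⟩ := hH j (by omega)
      rw [hx]
      exact (ih (by omega)).trans (Finset.subset_insert _ _)
  set r := fun i => ∑ x ∈ F i, ω x with hr
  set s := fun j => ∑ x ∈ G j, ω x with hs
  have hr_lt : ∀ i j, i < j → j ≤ R.card → r i < r j := by
    intro i j hij hj
    obtain ⟨x, hxR, hxi, hx⟩ := hF2 i (by omega)
    have h1 : r (i + 1) = ω x + r i := by
      simp only [hr, hx]; exact Finset.sum_insert hxi
    have h2 : r (i + 1) ≤ r j := Finset.sum_le_sum_of_subset (mono R F hF2 _ _ hij hj)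
    have h3 := hR x hxR
    omega
  set J := fun i => Nat.findGreatest (fun j => s j ≤ r i) S.card with hJ
  have hJ1 : ∀ i, J i ≤ S.card := fun i => Nat.findGreatest_le _
  have hJ2 : ∀ i, s (J i) ≤ r i := fun i =>
    Nat.findGreatest_spec (P := fun j => s j ≤ r i) (m := 0) (Nat.zero_le _) (by simp [hs, hG0])
  have hJ3 : ∀ i ≤ R.card, r i - s (J i) < m := by
    intro i hi
    have h0 := hJ2 i
    rcases Nat.lt_or_ge (J i) S.card with hlt | hge
    · have h1 : ¬ s (J i + 1) ≤ r i :=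
        Nat.findGreatest_is_greatest (P := fun j => s j ≤ r i) (Nat.lt_succ_self _) hlt
      obtain ⟨x, hxS, hxi, hx⟩ := hG2 _ hlt
      have h2 : s (J i + 1) = ω x + s (J i) := by
        simp only [hs, hx]; exact Finset.sum_insert hxi
      have h3 := hS x hxS
      omega
    · have h1 : J i = S.card := le_antisymm (hJ1 i) hge
      have h2 : s (J i) = ∑ x ∈ S, ω x := by rw [h1]; simp only [hs, hG1]
      have h3 : r i ≤ ∑ x ∈ R, ω x := by
        have := Finset.sum_le_sum_of_subset (f := ω) (mono R F hF2 i _ hi le_rfl)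
        rwa [hF1] at this
      omega
  obtain ⟨i, hi, i', hi', hne, heq⟩ := Finset.exists_ne_map_eq_of_card_lt_of_maps_to
    (s := Finset.range (R.card + 1)) (t := Finset.range m) (by simp; omega)
    (f := fun i => r i - s (J i))
    (fun i hi => by simpa using hJ3 i (by simpa [Nat.lt_succ_iff] using hi))
  wlog hlt : i < i' generalizing i i'
  · exact this i' hi' i hi hne.symm heq.symm (by omega)
  have hi'R : i' ≤ R.card := by simpa [Nat.lt_succ_iff] using hi'
  have h1 := hr_lt i i' hlt hi'R
  have h2 := hJ2 i
  have h3 := hJ2 i'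
  have hss : s (J i) < s (J i') := by omega
  have hJJ : J i < J i' := by
    by_contra hcon
    have : s (J i') ≤ s (J i) :=
      Finset.sum_le_sum_of_subset (mono S G hG2 _ _ (by omega) (hJ1 i))
    omega
  have hFF := mono R F hF2 i i' hlt.le hi'R
  have hGG := mono S G hG2 _ _ hJJ.le (hJ1 i')
  have e1 : ∑ x ∈ F i' \ F i, ω x + r i = r i' := Finset.sum_sdiff hFF
  have e2 : ∑ x ∈ G (J i') \ G (J i), ω x + s (J i) = s (J i') := Finset.sum_sdiff hGG
  have hFR := mono R F hF2 i' _ hi'R le_rfl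
  have hGS := mono S G hG2 _ _ (hJ1 i') le_rfl
  rw [hF1] at hFR
  rw [hG1] at hGS
  refine ⟨F i' \ F i, Finset.sdiff_subset.trans hFR, G (J i') \ G (J i),
    Finset.sdiff_subset.trans hGS, ?_, ?_, by omega⟩
  · rw [Finset.nonempty_iff_ne_empty]
    intro h0
    rw [h0, Finset.sum_empty] at e1
    omega
  · rw [Finset.nonempty_iff_ne_empty]
    intro h0
    rw [h0, Finset.sum_empty] at e2
    omega

/-! ### The efficiency order and the greedy solution -/

namespace BoundedKnapsack

variable (I : BoundedKnapsack)

theorem precedes_iff_efficiency (i j : Fin I.n) : I.Precedes i j ↔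
    (I.p j : ℚ) / I.w j < I.p i / I.w i ∨ ((I.p j : ℚ) / I.w j = I.p i / I.w i ∧ i < j) := by
  have hi : (0 : ℚ) < I.w i := by exact_mod_cast I.w_pos i
  have hj : (0 : ℚ) < I.w j := by exact_mod_cast I.w_pos j
  rw [div_lt_div_iff₀ hj hi, div_eq_div_iff hj.ne' hi.ne']
  unfold Precedes
  norm_cast

theorem Precedes.trans {I : BoundedKnapsack} {i j k : Fin I.n} (h : I.Precedes i j)
    (h' : I.Precedes j k) : I.Precedes i k := by
  rw [precedes_iff_efficiency] at *
  rcases h with h | ⟨h1, h2⟩ <;> rcases h' with h' | ⟨h1', h2'⟩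
  · exact .inl (h'.trans h)
  · exact .inl (h1' ▸ h)
  · exact .inl (h1 ▸ h')
  · exact .inr ⟨h1'.trans h1, h2.trans h2'⟩

theorem not_precedes_self (i : Fin I.n) : ¬ I.Precedes i i := by
  simp [Precedes]

theorem precedes_or_eq_or_precedes (i j : Fin I.n) :
    I.Precedes i j ∨ i = j ∨ I.Precedes j i := by
  rw [precedes_iff_efficiency, precedes_iff_efficiency]
  rcases lt_trichotomy ((I.p j : ℚ) / I.w j) (I.p i / I.w i) with h | h | h
  · exact .inl (.inl h)
  · rcases lt_trichotomy i j with h' | h' | h'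
    · exact .inl (.inr ⟨h, h'⟩)
    · exact .inr (.inl h')
    · exact .inr (.inr (.inr ⟨h.symm, h'⟩))
  · exact .inr (.inr (.inl h))

open Classical in
/-- The position of an item in the order of decreasing efficiency, counted from 0. -/
noncomputable def rank (i : Fin I.n) : ℕ := (Finset.univ.filter fun j => I.Precedes j i).card

theorem rank_lt_of_precedes {i j : Fin I.n} (h : I.Precedes i j) : I.rank i < I.rank j := by
  classical
  refine Finset.card_lt_card ⟨fun k hk => ?_, fun hsub => ?_⟩
  · simp only [Finset.mem_filter, Finset.mem_univ, true_and] at hk ⊢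
    exact hk.trans h
  · have := @hsub i (by simpa using h)
    exact I.not_precedes_self i (by simpa using this)

theorem precedes_iff_rank {i j : Fin I.n} : I.Precedes i j ↔ I.rank i < I.rank j := by
  refine ⟨I.rank_lt_of_precedes, fun h => ?_⟩
  rcases I.precedes_or_eq_or_precedes i j with h' | rfl | h'
  · exact h'
  · exact absurd h (lt_irrefl _)
  · exact absurd (I.rank_lt_of_precedes h') h.not_gt

theorem rank_injective : Function.Injective I.rank := by
  intro i j h
  rcases I.precedes_or_eq_or_precedes i j with h' | h' | h'
  · exact absurd h (I.rank_lt_of_precedes h').ne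
  · exact h'
  · exact absurd h (I.rank_lt_of_precedes h').ne'

theorem copyLE_iff_rank {x y : I.Copy} : I.CopyLE x y ↔
    I.rank x.1 < I.rank y.1 ∨ (x.1 = y.1 ∧ (x.2 : ℕ) ≤ (y.2 : ℕ)) := by
  rw [CopyLE, precedes_iff_rank]

theorem copyLE_refl (x : I.Copy) : I.CopyLE x x := .inr ⟨rfl, le_rfl⟩

theorem CopyLE.trans {I : BoundedKnapsack} {x y z : I.Copy} (h : I.CopyLE x y)
    (h' : I.CopyLE y z) : I.CopyLE x z := by
  rw [copyLE_iff_rank] at *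
  rcases h with h | ⟨h1, h2⟩ <;> rcases h' with h' | ⟨h1', h2'⟩
  · exact .inl (h.trans h')
  · exact .inl (h1' ▸ h)
  · exact .inl (h1 ▸ h')
  · exact .inr ⟨h1.trans h1', h2.trans h2'⟩

theorem copyLE_total (x y : I.Copy) : I.CopyLE x y ∨ I.CopyLE y x := by
  rw [copyLE_iff_rank, copyLE_iff_rank]
  rcases lt_trichotomy (I.rank x.1) (I.rank y.1) with h | h | h
  · exact .inl (.inl h)
  · have h' := I.rank_injective h
    rcases le_total (x.2 : ℕ) y.2 with h2 | h2
    · exact .inl (.inr ⟨h', h2⟩)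
    · exact .inr (.inr ⟨h'.symm, h2⟩)
  · exact .inr (.inl h)

theorem CopyLE.antisymm {I : BoundedKnapsack} {x y : I.Copy} (h : I.CopyLE x y)
    (h' : I.CopyLE y x) : x = y := by
  rw [copyLE_iff_rank] at *
  obtain ⟨i, c⟩ := x
  obtain ⟨j, d⟩ := y
  rcases h with h | ⟨h1, h2⟩ <;> rcases h' with h' | ⟨h1', h2'⟩ <;> dsimp only at *
  · omega
  · subst h1'; omega
  · subst h1; omega
  · subst h1
    obtain rfl : c = d := Fin.ext (le_antisymm h2 h2')
    rfl

theorem CopyLE.profit_mul_weight_le {I : BoundedKnapsack} {x y : I.Copy} (h : I.CopyLE x y) :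
    I.p y.1 * I.w x.1 ≤ I.p x.1 * I.w y.1 := by
  rcases h with (h | h) | h
  · exact h.le
  · exact h.1.le
  · rw [h.1]

theorem mem_greedy {x : I.Copy} :
    x ∈ I.greedy ↔ I.weight (Finset.univ.filter fun y => I.CopyLE y x) ≤ I.W := by
  simp [greedy]

theorem weight_mono {S T : Finset I.Copy} (h : S ⊆ T) : I.weight S ≤ I.weight T :=
  Finset.sum_le_sum_of_subset h

theorem mem_greedy_of_copyLE {x y : I.Copy} (h : I.CopyLE y x) (hx : x ∈ I.greedy) :
    y ∈ I.greedy := by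
  rw [mem_greedy] at *
  refine (I.weight_mono fun z hz => ?_).trans hx
  simp only [Finset.mem_filter, Finset.mem_univ, true_and] at hz ⊢
  exact hz.trans h

theorem copyLE_of_mem_greedy {x y : I.Copy} (hx : x ∈ I.greedy) (hy : y ∉ I.greedy) :
    I.CopyLE x y :=
  (I.copyLE_total x y).resolve_right fun h => hy (I.mem_greedy_of_copyLE h hx)

/-- The number of copies that do not come before `x`. -/
def later (x : I.Copy) : ℕ := (Finset.univ.filter fun y => I.CopyLE x y).card

theorem later_lt {x y : I.Copy} (h : I.CopyLE x y) (hne : x ≠ y) : I.later y < I.later x := by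
  refine Finset.card_lt_card ⟨fun k hk => ?_, fun hsub => ?_⟩
  · simp only [Finset.mem_filter, Finset.mem_univ, true_and] at hk ⊢
    exact h.trans hk
  · have := @hsub x (by simpa using I.copyLE_refl x)
    exact hne (h.antisymm (by simpa using this))

theorem weight_greedy_le : I.weight I.greedy ≤ I.W := by
  rcases I.greedy.eq_empty_or_nonempty with h | h
  · simp [h, weight]
  · obtain ⟨x, hx, hmin⟩ := Finset.exists_min_image I.greedy I.later h
    refine (I.weight_mono fun y hy => ?_).trans (I.mem_greedy.1 hx)
    simp only [Finset.mem_filter, Finset.mem_univ, true_and]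
    by_contra hcon
    have hxy := (I.copyLE_total x y).resolve_right hcon
    have := I.later_lt hxy (fun h => hcon (h ▸ I.copyLE_refl x))
    exact absurd (hmin y hy) this.not_ge

theorem exists_lt_weight_greedy_add {x : I.Copy} (hx : x ∉ I.greedy) :
    ∃ z : I.Copy, I.W < I.weight I.greedy + I.w z.1 := by
  obtain ⟨z, hz, hmax⟩ := Finset.exists_max_image (Finset.univ.filter fun y => y ∉ I.greedy)
    I.later ⟨x, by simpa using hx⟩
  have hz' : z ∉ I.greedy := by simpa using hz
  refine ⟨z, ?_⟩
  have h1 : I.W < I.weight (Finset.univ.filter fun y => I.CopyLE y z) := by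
    rw [mem_greedy] at hz'; omega
  refine h1.trans_le ?_
  have h2 : (Finset.univ.filter fun y => I.CopyLE y z) ⊆ insert z I.greedy := by
    intro y hy
    simp only [Finset.mem_filter, Finset.mem_univ, true_and] at hy
    by_contra hcon
    rw [Finset.mem_insert, not_or] at hcon
    exact absurd (hmax y (by simpa using hcon.2)) (I.later_lt hy hcon.1).not_ge
  refine (I.weight_mono h2).trans (le_of_eq ?_)
  rw [weight, Finset.sum_insert hz', add_comm]
  rfl

/-! ### A canonical optimal solution -/

/-- No equal-weight exchange replaces copies of `opt` by earlier copies outside of `opt`. -/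
def Unimprovable (opt : Finset I.Copy) : Prop :=
  ∀ A B : Finset I.Copy, A ⊆ opt → Disjoint B opt → A.Nonempty → B.Nonempty →
    (∀ b ∈ B, ∀ a ∈ A, I.CopyLE b a) → I.weight A ≠ I.weight B

theorem sum_le_sum_of_mul_le {α : Type*} (ω g : α → ℕ) {A B : Finset α}
    (hpos : 0 < ∑ a ∈ A, ω a) (heq : ∑ a ∈ A, ω a = ∑ b ∈ B, ω b)
    (h : ∀ b ∈ B, ∀ a ∈ A, g a * ω b ≤ g b * ω a) : ∑ a ∈ A, g a ≤ ∑ b ∈ B, g b := by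
  refine Nat.le_of_mul_le_mul_right ?_ hpos
  calc (∑ a ∈ A, g a) * ∑ a ∈ A, ω a = ∑ a ∈ A, ∑ b ∈ B, g a * ω b := by
        rw [heq, Finset.sum_mul_sum]
    _ ≤ ∑ a ∈ A, ∑ b ∈ B, g b * ω a :=
        Finset.sum_le_sum fun a ha => Finset.sum_le_sum fun b hb => h b hb a ha
    _ = (∑ b ∈ B, g b) * ∑ a ∈ A, ω a := by rw [Finset.sum_comm, Finset.sum_mul_sum]

theorem sum_lt_sum_of_mul_lt {α : Type*} (ω g : α → ℕ) {A B : Finset α} (hA : A.Nonempty)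
    (hB : B.Nonempty) (heq : ∑ a ∈ A, ω a = ∑ b ∈ B, ω b)
    (h : ∀ b ∈ B, ∀ a ∈ A, g a * ω b < g b * ω a) : ∑ a ∈ A, g a < ∑ b ∈ B, g b := by
  refine Nat.lt_of_mul_lt_mul_right (a := ∑ a ∈ A, ω a) ?_
  calc (∑ a ∈ A, g a) * ∑ a ∈ A, ω a = ∑ a ∈ A, ∑ b ∈ B, g a * ω b := by
        rw [heq, Finset.sum_mul_sum]
    _ < ∑ a ∈ A, ∑ b ∈ B, g b * ω a :=
        Finset.sum_lt_sum_of_nonempty hA fun a ha =>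
          Finset.sum_lt_sum_of_nonempty hB fun b hb => h b hb a ha
    _ = (∑ b ∈ B, g b) * ∑ a ∈ A, ω a := by rw [Finset.sum_comm, Finset.sum_mul_sum]

theorem weight_pos {A : Finset I.Copy} (hA : A.Nonempty) : 0 < I.weight A :=
  Finset.sum_pos (fun x _ => I.w_pos x.1) hA

/-- Among the optimal solutions, one with the largest value of `∑ w x * later x` is
unimprovable, since an exchange of the forbidden kind does not decrease the profit and increases
this value. -/
theorem exists_isOptimal_unimprovable : ∃ opt, I.IsOptimal opt ∧ I.Unimprovable opt := by
  classical
  obtain ⟨S₀, hS₀, hmax₀⟩ := Finset.exists_max_image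
    (Finset.univ.filter fun S : Finset I.Copy => I.weight S ≤ I.W) I.profit
    ⟨∅, Finset.mem_filter.2 ⟨Finset.mem_univ _, by simp [weight]⟩⟩
  have hopt₀ : I.IsOptimal S₀ :=
    ⟨by simpa using hS₀, fun T hT => hmax₀ T (by simpa using hT)⟩
  obtain ⟨opt, hopt, hmax⟩ := Finset.exists_max_image
    (Finset.univ.filter fun S : Finset I.Copy => I.IsOptimal S)
    (fun S => ∑ x ∈ S, I.w x.1 * I.later x) ⟨S₀, by simpa using hopt₀⟩
  replace hopt : I.IsOptimal opt := by simpa using hopt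
  refine ⟨opt, hopt, fun A B hA hB hA0 hB0 hBA heq => ?_⟩
  have hdisj : Disjoint (opt \ A) B := (hB.mono_right Finset.sdiff_subset).symm
  have hsum : ∀ g : I.Copy → ℕ,
      ∑ x ∈ (opt \ A) ∪ B, g x + ∑ x ∈ A, g x = ∑ x ∈ opt, g x + ∑ x ∈ B, g x := by
    intro g
    rw [Finset.sum_union hdisj, ← Finset.sum_sdiff hA]
    omega
  have hw := hsum fun x => I.w x.1
  have hp := hsum fun x => I.p x.1
  have hl := hsum fun x => I.w x.1 * I.later x
  have hple : ∑ x ∈ A, I.p x.1 ≤ ∑ x ∈ B, I.p x.1 :=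
    sum_le_sum_of_mul_le (fun x : I.Copy => I.w x.1) _ (I.weight_pos hA0) heq
      fun b hb a ha => (hBA b hb a ha).profit_mul_weight_le
  have hllt : ∑ x ∈ A, I.w x.1 * I.later x < ∑ x ∈ B, I.w x.1 * I.later x := by
    refine sum_lt_sum_of_mul_lt (fun x : I.Copy => I.w x.1) _ hA0 hB0 heq fun b hb a ha => ?_
    have hne : b ≠ a := fun h => Finset.disjoint_left.1 hB hb (hA (h ▸ ha))
    have hlt := I.later_lt (hBA b hb a ha) hne
    have hpos : 0 < I.w a.1 * I.w b.1 := Nat.mul_pos (I.w_pos _) (I.w_pos _)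
    calc I.w a.1 * I.later a * I.w b.1 = I.w a.1 * I.w b.1 * I.later a := by ring
      _ < I.w a.1 * I.w b.1 * I.later b := Nat.mul_lt_mul_of_pos_left hlt hpos
      _ = I.w b.1 * I.later b * I.w a.1 := by ring
  have hoptnew : I.IsOptimal ((opt \ A) ∪ B) := by
    have h1 := hopt.1
    simp only [weight, profit, IsOptimal] at *
    refine ⟨by omega, fun T hT => (hopt.2 T hT).trans (by omega)⟩
  have := hmax _ (by simpa using hoptnew)
  omega

variable {I} {opt : Finset I.Copy} {U : ℕ}

theorem weight_sdiff_lt {G H : Finset I.Copy} {m : ℕ} (h : I.weight G < I.weight H + m) :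
    I.weight (G \ H) < I.weight (H \ G) + m := by
  have h1 := Finset.sum_sdiff (f := fun x : I.Copy => I.w x.1)
    (Finset.inter_subset_left (s₁ := G) (s₂ := H))
  have h2 := Finset.sum_sdiff (f := fun x : I.Copy => I.w x.1)
    (Finset.inter_subset_left (s₁ := H) (s₂ := G))
  rw [Finset.sdiff_inter_self_left] at h1 h2
  rw [Finset.inter_comm] at h2
  simp only [weight] at *
  omega

theorem IsOptimal.lt_weight_add (hopt : I.IsOptimal opt) {x : I.Copy} (hx : x ∉ opt) :
    I.W < I.weight opt + I.w x.1 := by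
  by_contra hcon
  have h1 := hopt.2 (insert x opt) (by
    rw [weight, Finset.sum_insert hx]; simp only [weight] at hcon; omega)
  rw [profit, profit, Finset.sum_insert hx] at h1
  have := I.p_pos x.1
  omega

theorem Unimprovable.card_greedy_sdiff_le (hun : I.Unimprovable opt) (hopt : I.IsOptimal opt)
    (hU : ∀ i, I.w i ≤ U) : (I.greedy \ opt).card ≤ U := by
  by_contra hcon
  obtain ⟨x, hx⟩ := Finset.card_pos.1 (show 0 < (I.greedy \ opt).card by omega)
  have hx' := hopt.lt_weight_add (Finset.mem_sdiff.1 hx).2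
  have hxU := hU x.1
  have hg := I.weight_greedy_le
  obtain ⟨R, hR, S, hS, hR0, hS0, heq⟩ := exists_subsets_sum_eq_of_card
    (fun x : I.Copy => I.w x.1) (I.greedy \ opt) (opt \ I.greedy) (m := U)
    (fun x _ => I.w_pos x.1) (fun x _ => hU x.1)
    (weight_sdiff_lt (by omega)) (by omega)
  refine hun S R (hS.trans Finset.sdiff_subset) ?_ hS0 hR0 ?_ heq.symm
  · exact Finset.disjoint_left.2 fun y hy => (Finset.mem_sdiff.1 (hR hy)).2
  · exact fun b hb a ha => I.copyLE_of_mem_greedy (Finset.mem_sdiff.1 (hR hb)).1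
      (Finset.mem_sdiff.1 (hS ha)).2

theorem Unimprovable.card_sdiff_greedy_le (hun : I.Unimprovable opt) (hopt : I.IsOptimal opt)
    (hU : ∀ i, I.w i ≤ U) : (opt \ I.greedy).card ≤ U := by
  by_contra hcon
  obtain ⟨x, hx⟩ := Finset.card_pos.1 (show 0 < (opt \ I.greedy).card by omega)
  obtain ⟨z, hz⟩ := I.exists_lt_weight_greedy_add (Finset.mem_sdiff.1 hx).2
  have hzU := hU z.1
  have ho := hopt.1
  obtain ⟨S, hS, R, hR, hS0, hR0, heq⟩ := exists_subsets_sum_eq_of_card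
    (fun x : I.Copy => I.w x.1) (opt \ I.greedy) (I.greedy \ opt) (m := U)
    (fun x _ => I.w_pos x.1) (fun x _ => hU x.1)
    (weight_sdiff_lt (by omega)) (by omega)
  refine hun S R (hS.trans Finset.sdiff_subset) ?_ hS0 hR0 ?_ heq
  · exact Finset.disjoint_left.2 fun y hy => (Finset.mem_sdiff.1 (hR hy)).2
  · exact fun b hb a ha => I.copyLE_of_mem_greedy (Finset.mem_sdiff.1 (hR hb)).1
      (Finset.mem_sdiff.1 (hS ha)).2

theorem Unimprovable.mem_opt (hun : I.Unimprovable opt) {x y : I.Copy}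
    (hw : I.w x.1 = I.w y.1) (hxy : I.CopyLE x y) (hy : y ∈ opt) : x ∈ opt := by
  by_contra hx
  refine hun {y} {x} (by simpa using hy) (by simpa using hx) (by simp) (by simp)
    (by simpa using hxy) ?_
  simpa [weight] using hw.symm

/-- If the last copies `A` of the greedy solution contain `T` copies of each of many similar
weights, then at most `T` copies of a similar weight `w` that come before `A` are removed. -/
theorem Unimprovable.card_removed_le (hun : I.Unimprovable opt) (hopt : I.IsOptimal opt)
    (hU : ∀ i, I.w i ≤ U) (A : Finset I.Copy) (hAG : A ⊆ I.greedy)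
    (hA : ∀ a ∈ A, ∀ b ∈ I.greedy, b ∉ A → I.CopyLE b a) (K : Finset ℕ) {c w T : ℕ}
    (hc : 0 < c) (hT : 0 < T) (hK : ∀ u ∈ K, c ≤ u ∧ u < 2 * c)
    (hKA : ∀ u ∈ K, T ≤ (A.filter fun x => I.w x.1 = u).card) (hKT : 16 * U ≤ K.card * T)
    (hcw : c ≤ w) (hwU : w ≤ U) :
    (((I.greedy \ opt).filter fun x => I.w x.1 = w) \ A).card ≤ T := by
  by_contra hcon
  obtain ⟨A', hA', B', hB', hA0, hB0, heq⟩ := exists_subsets_sum_eq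
    (fun x : I.Copy => I.w x.1) A (I.greedy \ opt) _ K hc hT hK hKA hKT
    (hun.card_greedy_sdiff_le hopt hU) hcw hwU
    (fun x hx => (Finset.mem_filter.1 (Finset.mem_sdiff.1 hx).1).2) (not_le.1 hcon)
  have hBm : ∀ b ∈ B', b ∈ I.greedy ∧ b ∉ opt ∧ b ∉ A := fun b hb => by
    have := hB' hb
    simp only [Finset.mem_sdiff, Finset.mem_filter] at this
    tauto
  refine hun A' B' (fun a ha => ?_) ?_ hA0 hB0 (fun b hb a ha => ?_) heq
  · have h1 := Finset.mem_sdiff.1 (hA' ha)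
    by_contra h2
    exact h1.2 (Finset.mem_sdiff.2 ⟨hAG h1.1, h2⟩)
  · exact Finset.disjoint_left.2 fun b hb => (hBm b hb).2.1
  · exact hA a (Finset.mem_sdiff.1 (hA' ha)).1 b (hBm b hb).1 (hBm b hb).2.2

/-- The counterpart of `card_removed_le` for the copies that are added to the greedy solution. -/
theorem Unimprovable.card_added_le (hun : I.Unimprovable opt) (hopt : I.IsOptimal opt)
    (hU : ∀ i, I.w i ≤ U) (A : Finset I.Copy) (hAG : ∀ a ∈ A, a ∉ I.greedy)
    (hA : ∀ a ∈ A, ∀ b ∉ I.greedy, b ∉ A → I.CopyLE a b) (K : Finset ℕ) {c w T : ℕ}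
    (hc : 0 < c) (hT : 0 < T) (hK : ∀ u ∈ K, c ≤ u ∧ u < 2 * c)
    (hKA : ∀ u ∈ K, T ≤ (A.filter fun x => I.w x.1 = u).card) (hKT : 16 * U ≤ K.card * T)
    (hcw : c ≤ w) (hwU : w ≤ U) :
    (((opt \ I.greedy).filter fun x => I.w x.1 = w) \ A).card ≤ T := by
  by_contra hcon
  obtain ⟨A', hA', B', hB', hA0, hB0, heq⟩ := exists_subsets_sum_eq
    (fun x : I.Copy => I.w x.1) A (opt \ I.greedy) _ K hc hT hK hKA hKT
    (hun.card_sdiff_greedy_le hopt hU) hcw hwU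
    (fun x hx => (Finset.mem_filter.1 (Finset.mem_sdiff.1 hx).1).2) (not_le.1 hcon)
  have hBm : ∀ b ∈ B', b ∈ opt ∧ b ∉ I.greedy ∧ b ∉ A := fun b hb => by
    have := hB' hb
    simp only [Finset.mem_sdiff, Finset.mem_filter] at this
    tauto
  refine hun B' A' (fun b hb => (hBm b hb).1) ?_ hB0 hA0 (fun a ha b hb => ?_) heq.symm
  · refine Finset.disjoint_left.2 fun a ha h2 => ?_
    have h1 := Finset.mem_sdiff.1 (hA' ha)
    exact h1.2 (Finset.mem_sdiff.2 ⟨h2, hAG a h1.1⟩)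
  · exact hA a (Finset.mem_sdiff.1 (hA' ha)).1 b (hBm b hb).2.1 (hBm b hb).2.2

end BoundedKnapsack

/-! ### Scanning a sequence of items and limiting the copies per weight -/

/-- A sequence of items to be scanned: item `k` has the key `key k` (in the application, its weight
and the side of the greedy solution on which it lies) and consists of `mult k` copies. The keys are
partitioned into classes, and `U` is the initial limit for the number of copies per key. -/
structure Scan where
  key : ℕ → ℕ
  mult : ℕ → ℕ
  cls : ℕ → ℕ
  U : ℕ

namespace Scan

variable (D : Scan)

/-- The number of copies with key `v` among the first `k` items. -/
def cnt (k v : ℕ) : ℕ := ∑ l ∈ Finset.range k, if D.key l = v then D.mult l else 0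

/-- The keys of class `κ` with at least `T` copies among the first `k` items. -/
def active (k κ T : ℕ) : Finset ℕ :=
  ((Finset.range k).image D.key).filter fun v => D.cls v = κ ∧ T ≤ D.cnt k v

/-- Item `k` raises the number of copies of its key from below `T` to at least `T`, when many keys
of its class have that many copies already. -/
def Blocks (k T : ℕ) : Prop :=
  D.cnt k (D.key k) < T ∧ T ≤ D.cnt k (D.key k) + D.mult k ∧
    16 * D.U ≤ (D.active k (D.cls (D.key k)) T).card * T

open Classical in
/-- The limit `b` for the key of item `k`, lowered to `2 * T` for each blocked threshold
`T = 2 ^ i` with `i < t`. -/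
noncomputable def lower (k b : ℕ) : ℕ → ℕ
  | 0 => b
  | t + 1 => if D.Blocks k (2 ^ t) then min (lower k b t) (2 * 2 ^ t) else lower k b t

/-- The limit for the number of copies with key `v` after the first `k` items. -/
noncomputable def lim : ℕ → ℕ → ℕ
  | 0, _ => D.U
  | k + 1, v => if D.key k = v then D.lower k (lim k v) D.U.size else lim k v

/-- The number of copies of item `k` that are selected: those that lie within the limit. -/
noncomputable def emit (k : ℕ) : ℕ :=
  min (D.cnt k (D.key k) + D.mult k) (D.lim (k + 1) (D.key k)) - D.cnt k (D.key k)

variable {D}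

@[simp] theorem cnt_zero (v : ℕ) : D.cnt 0 v = 0 := rfl

theorem cnt_succ (k v : ℕ) :
    D.cnt (k + 1) v = D.cnt k v + if D.key k = v then D.mult k else 0 :=
  Finset.sum_range_succ _ _

theorem mem_active {k κ T v : ℕ} (hT : 0 < T) :
    v ∈ D.active k κ T ↔ D.cls v = κ ∧ T ≤ D.cnt k v := by
  simp only [active, Finset.mem_filter, and_iff_right_iff_imp]
  rintro ⟨-, h⟩
  obtain ⟨l, hl, hne⟩ := Finset.exists_ne_zero_of_sum_ne_zero (show D.cnt k v ≠ 0 by omega)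
  exact Finset.mem_image.2 ⟨l, hl, by_contra fun h' => hne (if_neg h')⟩

theorem active_zero {κ T : ℕ} : D.active 0 κ T = ∅ := rfl

theorem card_active_succ {k κ T : ℕ} (hT : 0 < T) :
    (D.active (k + 1) κ T).card = (D.active k κ T).card +
      if D.cls (D.key k) = κ ∧ D.cnt k (D.key k) < T ∧ T ≤ D.cnt k (D.key k) + D.mult k
      then 1 else 0 := by
  split_ifs with h
  · have hn : D.key k ∉ D.active k κ T := fun hm => by
      have := ((mem_active hT).1 hm).2; omega
    rw [← Finset.card_insert_of_notMem hn]
    congr 1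
    ext v
    rw [Finset.mem_insert, mem_active hT, mem_active hT, cnt_succ]
    by_cases hv : D.key k = v
    · subst hv
      simp [h.1, h.2.2]
    · simp [hv, Ne.symm hv]
  · rw [add_zero]
    congr 1
    ext v
    rw [mem_active hT, mem_active hT, cnt_succ]
    by_cases hv : D.key k = v
    · subst hv
      simp only [if_true]
      refine and_congr_right fun h1 => ⟨fun h2 => ?_, fun h2 => by omega⟩
      by_contra h3
      exact h ⟨h1, by omega, h2⟩
    · simp [hv]

theorem lower_le (k b t : ℕ) : D.lower k b t ≤ b := by
  induction t with
  | zero => exact le_rfl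
  | succ t ih =>
    rw [lower]; split_ifs
    · exact (min_le_left _ _).trans ih
    · exact ih

theorem lower_antitone (k b : ℕ) : Antitone (D.lower k b) := by
  refine antitone_nat_of_succ_le fun t => ?_
  rw [lower]; split_ifs
  · exact min_le_left _ _
  · exact le_rfl

theorem lower_le_of_blocks {k b t i : ℕ} (hi : i < t) (h : D.Blocks k (2 ^ i)) :
    D.lower k b t ≤ 2 * 2 ^ i := by
  refine (D.lower_antitone k b (Nat.succ_le_of_lt hi)).trans ?_
  rw [Nat.succ_eq_add_one, lower, if_pos h]
  exact min_le_right _ _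

theorem le_lower {k b t r : ℕ} (hb : r ≤ b)
    (h : ∀ i < t, D.Blocks k (2 ^ i) → r ≤ 2 * 2 ^ i) : r ≤ D.lower k b t := by
  induction t with
  | zero => exact hb
  | succ t ih =>
    have := ih fun i hi => h i (by omega)
    rw [lower]; split_ifs with h'
    · exact le_min this (h t (by omega) h')
    · exact this

theorem lim_succ_le (k v : ℕ) : D.lim (k + 1) v ≤ D.lim k v := by
  rw [lim]; split_ifs
  · exact lower_le _ _ _
  · exact le_rfl

theorem lim_antitone {k l : ℕ} (h : k ≤ l) (v : ℕ) : D.lim l v ≤ D.lim k v :=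
  antitone_nat_of_succ_le (f := fun k => D.lim k v) (fun k => lim_succ_le k v) h

theorem lim_le (k v : ℕ) : D.lim k v ≤ D.U := lim_antitone (Nat.zero_le k) v

/-- A number of copies per key that respects every blocked threshold respects the limits. -/
theorem le_lim {N : ℕ} (ρ : ℕ → ℕ) (hU : ∀ v, ρ v ≤ D.U)
    (h : ∀ k < N, ∀ t, 2 ^ t ≤ D.U → D.Blocks k (2 ^ t) → ρ (D.key k) ≤ 2 * 2 ^ t) {k : ℕ}
    (hk : k ≤ N) (v : ℕ) : ρ v ≤ D.lim k v := by
  induction k with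
  | zero => exact hU v
  | succ k ih =>
    rw [lim]; split_ifs with hv
    · subst hv
      exact le_lower (ih (by omega)) fun i hi hb => h k hk i (Nat.lt_size.1 hi) hb
    · exact ih (by omega)

/-- The number of selected copies with key `v` among the first `k` items. -/
noncomputable def emitted (D : Scan) (k v : ℕ) : ℕ :=
  ∑ l ∈ Finset.range k, if D.key l = v then D.emit l else 0

theorem emitted_le (k v : ℕ) : D.emitted k v ≤ D.cnt k v ∧ D.emitted k v ≤ D.lim k v := by
  induction k with
  | zero => simp [emitted]
  | succ k ih =>
    have hstep : D.emitted (k + 1) v = D.emitted k v + if D.key k = v then D.emit k else 0 :=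
      Finset.sum_range_succ _ _
    rw [hstep, cnt_succ]
    split_ifs with hv
    · subst hv
      have hlow : D.emitted k (D.key k) ≤ D.lim (k + 1) (D.key k) := by
        rw [lim, if_pos rfl]
        refine le_lower ih.2 fun i _ hb => ?_
        have := hb.1
        omega
      rw [emit]
      omega
    · have : D.lim (k + 1) v = D.lim k v := by rw [lim, if_neg hv]
      rw [this]
      simpa using ih

/-- The keys of class `κ` that reached `T` copies without being limited to `2 * T`. -/
noncomputable def free (D : Scan) (k κ T : ℕ) : Finset ℕ :=
  (D.active k κ T).filter fun v => 2 * T < D.lim k v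

theorem card_free_mul_le {k κ t : ℕ} (ht : 2 ^ t ≤ D.U) :
    (D.free k κ (2 ^ t)).card * 2 ^ t ≤ 17 * D.U := by
  have hT : 0 < 2 ^ t := by positivity
  induction k with
  | zero => simp [free, active_zero]
  | succ k ih =>
    have hsub : ∀ v ∈ D.free (k + 1) κ (2 ^ t), v ∉ D.free k κ (2 ^ t) →
        v = D.key k ∧ D.cls v = κ ∧ ¬ D.Blocks k (2 ^ t) := by
      intro v hv hv'
      simp only [free, Finset.mem_filter, mem_active hT] at hv hv'
      have hlim := D.lim_succ_le k v
      have hlt : D.cnt k v < 2 ^ t := by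
        by_contra hcon
        exact hv' ⟨⟨hv.1.1, by omega⟩, by omega⟩
      have hc := hv.1.2
      rw [cnt_succ] at hc
      have hkv : D.key k = v := by
        by_contra hne
        rw [if_neg hne] at hc
        omega
      refine ⟨hkv.symm, hv.1.1, fun hb => ?_⟩
      have h2 := hv.2
      rw [lim, if_pos hkv] at h2
      have := lower_le_of_blocks (b := D.lim k v) (Nat.lt_size.2 ht) hb
      omega
    by_cases hall : ∀ v ∈ D.free (k + 1) κ (2 ^ t), v ∈ D.free k κ (2 ^ t)
    · exact (Nat.mul_le_mul_right _ (Finset.card_le_card hall)).trans ih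
    · push Not at hall
      obtain ⟨v, hv, hv'⟩ := hall
      obtain ⟨hvk, hvκ, hnb⟩ := hsub v hv hv'
      have hcard : (D.free (k + 1) κ (2 ^ t)).card ≤ (D.active k κ (2 ^ t)).card + 1 := by
        refine (Finset.card_le_card (t := insert v (D.free k κ (2 ^ t))) fun u hu => ?_).trans
          ((Finset.card_insert_le _ _).trans
            (Nat.add_le_add_right (Finset.card_le_card (Finset.filter_subset _ _)) 1))
        by_contra hcon
        rw [Finset.mem_insert, not_or] at hcon
        exact hcon.1 ((hsub u hu hcon.2).1.trans hvk.symm)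
      simp only [free, Finset.mem_filter, mem_active hT] at hv hv'
      have hc := hv.1.2
      have hlim := D.lim_succ_le k v
      rw [cnt_succ, if_pos hvk.symm] at hc
      have hlt : D.cnt k v < 2 ^ t := by
        by_contra hcon
        exact hv' ⟨⟨hv.1.1, by omega⟩, by omega⟩
      have hsmall : (D.active k κ (2 ^ t)).card * 2 ^ t < 16 * D.U := by
        by_contra hcon
        subst hvk
        exact hnb ⟨hlt, hc, by rw [hvκ]; omega⟩
      calc _ ≤ ((D.active k κ (2 ^ t)).card + 1) * 2 ^ t := Nat.mul_le_mul_right _ hcard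
        _ ≤ 17 * D.U := by rw [add_mul]; omega

theorem emitted_le_sum (k v : ℕ) : D.emitted k v ≤
    2 + ∑ t ∈ Finset.range D.U.size, if v ∈ D.free k (D.cls v) (2 ^ t) then 4 * 2 ^ t else 0 := by
  obtain ⟨h1, h2⟩ := D.emitted_le k v
  have h3 := D.lim_le k v
  obtain ⟨e, he⟩ : ∃ e, e = D.emitted k v := ⟨_, rfl⟩
  rw [← he] at h1 h2 ⊢
  by_cases he2 : e ≤ 2
  · omega
  have hlog1 := Nat.pow_log_le_self 2 (show (e - 1) / 2 ≠ 0 by omega)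
  have hlog2 := Nat.lt_pow_succ_log_self (b := 2) (by norm_num) ((e - 1) / 2)
  set t := Nat.log 2 ((e - 1) / 2)
  rw [pow_succ] at hlog2
  have hmem : v ∈ D.free k (D.cls v) (2 ^ t) := by
    simp only [free, Finset.mem_filter, mem_active (show 0 < 2 ^ t by positivity)]
    exact ⟨⟨trivial, by omega⟩, by omega⟩
  have := Finset.single_le_sum (f := fun t => if v ∈ D.free k (D.cls v) (2 ^ t) then 4 * 2 ^ t
    else 0) (fun _ _ => Nat.zero_le _) (Finset.mem_range.2 (Nat.lt_size.2
      (show 2 ^ t ≤ D.U by omega)))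
  simp only [hmem, if_true] at this
  omega

/-- The number of selected copies is nearly linear in `U`. -/
theorem sum_emit_le {N : ℕ} (V C : Finset ℕ) (hV : ∀ k < N, D.key k ∈ V)
    (hC : ∀ k < N, D.cls (D.key k) ∈ C) :
    ∑ k ∈ Finset.range N, D.emit k ≤ 2 * V.card + 68 * D.U * D.U.size * C.card := by
  classical
  set V' := (Finset.range N).image D.key with hV'
  have hVV : V' ⊆ V := fun v hv => by
    obtain ⟨k, hk, rfl⟩ := Finset.mem_image.1 hv
    exact hV k (Finset.mem_range.1 hk)
  have h1 : ∑ k ∈ Finset.range N, D.emit k = ∑ v ∈ V', D.emitted N v := by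
    simp only [emitted]
    rw [Finset.sum_comm]
    refine Finset.sum_congr rfl fun k hk => ?_
    rw [Finset.sum_ite_eq, if_pos (Finset.mem_image_of_mem _ hk)]
  have h2 : ∀ t ∈ Finset.range D.U.size,
      (∑ v ∈ V', if v ∈ D.free N (D.cls v) (2 ^ t) then 4 * 2 ^ t else 0) ≤
        68 * D.U * C.card := by
    intro t ht
    calc _ ≤ ∑ v ∈ V', ∑ κ ∈ C, if v ∈ D.free N κ (2 ^ t) then 4 * 2 ^ t else 0 := by
          refine Finset.sum_le_sum fun v hv => ?_
          obtain ⟨k, hk, rfl⟩ := Finset.mem_image.1 hv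
          exact Finset.single_le_sum
            (f := fun κ => if D.key k ∈ D.free N κ (2 ^ t) then 4 * 2 ^ t else 0)
            (fun _ _ => Nat.zero_le _) (hC k (Finset.mem_range.1 hk))
      _ = ∑ κ ∈ C, ∑ v ∈ V', if v ∈ D.free N κ (2 ^ t) then 4 * 2 ^ t else 0 :=
          Finset.sum_comm
      _ ≤ ∑ κ ∈ C, 68 * D.U := by
          refine Finset.sum_le_sum fun κ _ => ?_
          rw [← Finset.sum_filter, Finset.sum_const, smul_eq_mul]
          have h3 := D.card_free_mul_le (k := N) (κ := κ) (Nat.lt_size.1 (Finset.mem_range.1 ht))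
          have h4 : (V'.filter fun v => v ∈ D.free N κ (2 ^ t)).card ≤
              (D.free N κ (2 ^ t)).card :=
            Finset.card_le_card fun v hv => (Finset.mem_filter.1 hv).2
          calc _ ≤ (D.free N κ (2 ^ t)).card * (4 * 2 ^ t) := Nat.mul_le_mul_right _ h4
            _ = 4 * ((D.free N κ (2 ^ t)).card * 2 ^ t) := by ring
            _ ≤ 68 * D.U := by omega
      _ = 68 * D.U * C.card := by rw [Finset.sum_const, smul_eq_mul, mul_comm]
  calc _ = ∑ v ∈ V', D.emitted N v := h1
    _ ≤ ∑ v ∈ V', (2 + ∑ t ∈ Finset.range D.U.size,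
          if v ∈ D.free N (D.cls v) (2 ^ t) then 4 * 2 ^ t else 0) :=
        Finset.sum_le_sum fun v _ => D.emitted_le_sum N v
    _ = 2 * V'.card + ∑ t ∈ Finset.range D.U.size,
          ∑ v ∈ V', (if v ∈ D.free N (D.cls v) (2 ^ t) then 4 * 2 ^ t else 0) := by
        rw [Finset.sum_add_distrib, Finset.sum_const, smul_eq_mul, mul_comm, Finset.sum_comm]
    _ ≤ 2 * V.card + ∑ t ∈ Finset.range D.U.size, 68 * D.U * C.card :=
        Nat.add_le_add (Nat.mul_le_mul_left _ (Finset.card_le_card hVV)) (Finset.sum_le_sum h2)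
    _ = 2 * V.card + 68 * D.U * D.U.size * C.card := by
        rw [Finset.sum_const, Finset.card_range, smul_eq_mul]; ring

end Scan

/-! ### Merge sort on the word RAM -/

/-- Every number below `n` occurs among the first `n` values of `X`, and these are below `n`. -/
def IsPermutation (n : ℕ) (X : ℕ → ℕ) : Prop :=
  (∀ a < n, X a < n) ∧ ∀ v < n, ∃ a < n, X a = v

/-- The values of `X` below `n` are sorted by `rk` within each aligned block of length `s`. -/
def SortedRuns (n : ℕ) (rk X : ℕ → ℕ) (s : ℕ) : Prop :=
  ∀ q a a', q * s ≤ a → a < a' → a' < (q + 1) * s → a' < n → rk (X a) ≤ rk (X a')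

theorem IsPermutation.injOn {n : ℕ} {X : ℕ → ℕ} (h : IsPermutation n X) {a b : ℕ} (ha : a < n)
    (hb : b < n) (hab : X a = X b) : a = b := by
  have hsurj : Function.Surjective fun i : Fin n => (⟨X i, h.1 i i.2⟩ : Fin n) := fun v => by
    obtain ⟨a, ha, hav⟩ := h.2 v v.2
    exact ⟨⟨a, ha⟩, Fin.ext hav⟩
  have := Finite.injective_iff_surjective.2 hsurj (a₁ := ⟨a, ha⟩) (a₂ := ⟨b, hb⟩) (Fin.ext hab)
  exact congrArg Fin.val this

/-- The state of a merging pass that combines the sorted blocks of length `s` in `X` in pairs and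
has written the first `k` values of `Y`. The current pair of blocks starts at `b`, and the next
elements of the two blocks are at `i` and `j`. -/
structure MergeInv (n s : ℕ) (rk X Y : ℕ → ℕ) (k b i j : ℕ) : Prop where
  base : ∃ q, b = q * (2 * s)
  le_k : b ≤ k
  k_le : k ≤ b + 2 * s
  le_i : b ≤ i
  i_le : i ≤ b + s
  le_j : b + s ≤ j
  j_le : j ≤ b + 2 * s
  j_le' : j ≤ n ∨ j = b + s
  count : i + j = k + b + s
  lt_n : ∀ a < k, Y a < n
  surj : ∀ a < n, (a < i ∨ (b + s ≤ a ∧ a < j)) → ∃ c < k, Y c = X a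
  sorted : ∀ q a a', q * (2 * s) ≤ a → a < a' → a' < (q + 1) * (2 * s) → a' < k →
    rk (Y a) ≤ rk (Y a')
  bound : ∀ a, b ≤ a → a < k → ∀ c < n, ((i ≤ c ∧ c < b + s) ∨ (j ≤ c ∧ c < b + 2 * s)) →
    rk (Y a) ≤ rk (X c)

namespace MergeInv

variable {n s k b i j : ℕ} {rk X Y : ℕ → ℕ}

theorem init : MergeInv n s rk X Y 0 0 0 s :=
  { base := ⟨0, by simp⟩, le_k := le_rfl, k_le := by omega, le_i := le_rfl, i_le := by omega
    le_j := by omega, j_le := by omega, j_le' := by omega, count := by omega, lt_n := by simp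
    surj := by intro a _ h; omega
    sorted := by intro _ _ _ _ _ _ h; omega
    bound := by intro _ _ h; omega }

theorem next_block (h : MergeInv n s rk X Y k b i j) (hk : k = b + 2 * s) :
    MergeInv n s rk X Y k k k (k + s) := by
  obtain ⟨⟨q, hq⟩, h1, h2, h3, h4, h5, h6, h6', h7, h8, h9, h10, h11⟩ := h
  refine ⟨⟨q + 1, by rw [add_mul]; omega⟩, le_rfl, by omega, le_rfl, by omega, by omega, by omega,
    by omega, by omega, h8, fun a ha h => h9 a ha (by omega), h10, by intro _ _ h; omega⟩

theorem base_le (h : MergeInv n s rk X Y k b i j) {q a : ℕ}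
    (h1 : q * (2 * s) ≤ a) (h3 : k < (q + 1) * (2 * s)) : b ≤ a := by
  obtain ⟨q', hq'⟩ := h.base
  by_contra hcon
  have h4 : q * (2 * s) < q' * (2 * s) := by omega
  have h5 : q < q' := Nat.lt_of_mul_lt_mul_right h4
  have h6 : (q + 1) * (2 * s) ≤ q' * (2 * s) := Nat.mul_le_mul_right _ h5
  have := h.le_k
  omega

/-- Writing a value `v` that is at least the values written so far in this block. -/
theorem sorted_update (h : MergeInv n s rk X Y k b i j) {v : ℕ}
    (hv : ∀ a, b ≤ a → a < k → rk (Y a) ≤ rk v) (q a a' : ℕ) (h1 : q * (2 * s) ≤ a) (h2 : a < a')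
    (h3 : a' < (q + 1) * (2 * s)) (h4 : a' < k + 1) :
    rk (Function.update Y k v a) ≤ rk (Function.update Y k v a') := by
  rw [Function.update_of_ne (by omega)]
  rcases Nat.lt_succ_iff_lt_or_eq.1 h4 with h5 | rfl
  · rw [Function.update_of_ne (by omega)]
    exact h.sorted q a a' h1 h2 h3 h5
  · rw [Function.update_self]
    exact hv a (h.base_le h1 h3) h2

theorem run_left (h : MergeInv n s rk X Y k b i j) (hX : SortedRuns n rk X s) {a c : ℕ}
    (ha : b ≤ a) (hac : a ≤ c) (hc : c < b + s) (hcn : c < n) : rk (X a) ≤ rk (X c) := by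
  obtain ⟨q, hq⟩ := h.base
  rcases hac.eq_or_lt with rfl | hac
  · exact le_rfl
  · have e1 : 2 * q * s = b := by rw [hq]; ring
    exact hX (2 * q) a c (by omega) hac (by rw [add_mul]; omega) hcn

theorem run_right (h : MergeInv n s rk X Y k b i j) (hX : SortedRuns n rk X s) {a c : ℕ}
    (ha : b + s ≤ a) (hac : a ≤ c) (hc : c < b + 2 * s) (hcn : c < n) : rk (X a) ≤ rk (X c) := by
  obtain ⟨q, hq⟩ := h.base
  rcases hac.eq_or_lt with rfl | hac
  · exact le_rfl
  · have e1 : 2 * q * s = b := by rw [hq]; ring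
    exact hX (2 * q + 1) a c (by rw [add_mul]; omega) hac
      (by rw [add_mul, add_mul]; omega) hcn

theorem take_left (h : MergeInv n s rk X Y k b i j) (hX : SortedRuns n rk X s)
    (hp : ∀ a < n, X a < n) (hk : k < b + 2 * s) (hi : i < b + s) (hin : i < n)
    (hle : j < b + 2 * s → j < n → rk (X i) ≤ rk (X j)) :
    MergeInv n s rk X (Function.update Y k (X i)) (k + 1) b (i + 1) j := by
  have hmin : ∀ c < n, ((i ≤ c ∧ c < b + s) ∨ (j ≤ c ∧ c < b + 2 * s)) → rk (X i) ≤ rk (X c) := by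
    rintro c hc (h1 | h1)
    · exact h.run_left hX h.le_i h1.1 h1.2 hc
    · exact (hle (by omega) (by omega)).trans (h.run_right hX h.le_j h1.1 h1.2 hc)
  have hsort := h.sorted_update fun a ha hak => h.bound a ha hak i hin (.inl ⟨le_rfl, hi⟩)
  have hb := h.bound
  have hs := h.surj
  have hl := h.lt_n
  obtain ⟨hbase, h1, h2, h3, h4, h5, h6, h6', h7, -, -, -, -⟩ := h
  refine ⟨hbase, by omega, by omega, by omega, by omega, by omega, by omega, by omega, by omega,
    ?_, ?_, hsort, ?_⟩
  · intro a ha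
    rcases Nat.lt_succ_iff_lt_or_eq.1 ha with h' | rfl
    · rw [Function.update_of_ne (by omega)]; exact hl a h'
    · rw [Function.update_self]; exact hp i hin
  · intro a ha hor
    by_cases hai : a = i
    · exact ⟨k, by omega, by rw [Function.update_self, hai]⟩
    · obtain ⟨c, hc, hcX⟩ := hs a ha (by omega)
      exact ⟨c, by omega, by rw [Function.update_of_ne (by omega), hcX]⟩
  · intro a ha hak c hc hor
    rcases Nat.lt_succ_iff_lt_or_eq.1 hak with h' | rfl
    · rw [Function.update_of_ne (by omega)]; exact hb a ha h' c hc (by omega)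
    · rw [Function.update_self]; exact hmin c hc (by omega)

theorem take_right (h : MergeInv n s rk X Y k b i j) (hX : SortedRuns n rk X s)
    (hp : ∀ a < n, X a < n) (hk : k < b + 2 * s) (hj : j < b + 2 * s) (hjn : j < n)
    (hle : i < b + s → rk (X j) ≤ rk (X i)) :
    MergeInv n s rk X (Function.update Y k (X j)) (k + 1) b i (j + 1) := by
  have hmin : ∀ c < n, ((i ≤ c ∧ c < b + s) ∨ (j ≤ c ∧ c < b + 2 * s)) → rk (X j) ≤ rk (X c) := by
    rintro c hc (h1 | h1)
    · exact (hle (by omega)).trans (h.run_left hX h.le_i h1.1 h1.2 hc)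
    · exact h.run_right hX h.le_j h1.1 h1.2 hc
  have hsort := h.sorted_update fun a ha hak => h.bound a ha hak j hjn (.inr ⟨le_rfl, hj⟩)
  have hb := h.bound
  have hs := h.surj
  have hl := h.lt_n
  obtain ⟨hbase, h1, h2, h3, h4, h5, h6, h6', h7, -, -, -, -⟩ := h
  refine ⟨hbase, by omega, by omega, by omega, by omega, by omega, by omega, by omega, by omega,
    ?_, ?_, hsort, ?_⟩
  · intro a ha
    rcases Nat.lt_succ_iff_lt_or_eq.1 ha with h' | rfl
    · rw [Function.update_of_ne (by omega)]; exact hl a h'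
    · rw [Function.update_self]; exact hp j hjn
  · intro a ha hor
    by_cases hai : a = j
    · exact ⟨k, by omega, by rw [Function.update_self, hai]⟩
    · obtain ⟨c, hc, hcX⟩ := hs a ha (by omega)
      exact ⟨c, by omega, by rw [Function.update_of_ne (by omega), hcX]⟩
  · intro a ha hak c hc hor
    rcases Nat.lt_succ_iff_lt_or_eq.1 hak with h' | rfl
    · rw [Function.update_of_ne (by omega)]; exact hb a ha h' c hc (by omega)
    · rw [Function.update_self]; exact hmin c hc (by omega)

theorem isPermutation (h : MergeInv n s rk X Y n b i j) (hp : IsPermutation n X) :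
    IsPermutation n Y := by
  refine ⟨h.lt_n, fun v hv => ?_⟩
  obtain ⟨a, ha, rfl⟩ := hp.2 v hv
  have h1 := h.count
  have h2 := h.i_le
  have h3 := h.le_j
  have h4 := h.j_le'
  by_cases hlt : a < i ∨ (b + s ≤ a ∧ a < j)
  · exact h.surj a ha hlt
  · -- The positions `[i, b + s)` and `[j, n)` are empty as the counts add up to `n`.
    omega

end MergeInv

namespace WordRAM

infixl:65 " +ₑ " => Expr.op Op.add
infixl:65 " -ₑ " => Expr.op Op.sub
infixl:70 " *ₑ " => Expr.op Op.mul
infixl:70 " /ₑ " => Expr.op Op.div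
infix:50 " <ₑ " => Expr.op Op.lt
infix:50 " =ₑ " => Expr.op Op.eq
infixr:40 " ;; " => Program.seq

/-- Nonzero if item `a` precedes item `b` in the order of decreasing efficiency. -/
def precedesExpr (a b : Expr) : Expr :=
  (.get 1 b *ₑ .get 0 a <ₑ .get 1 a *ₑ .get 0 b) +ₑ
    (.get 1 b *ₑ .get 0 a =ₑ .get 1 a *ₑ .get 0 b) *ₑ (a <ₑ b)

/-- Array 3 becomes the identity below register 0. -/
def identityProg : Program :=
  .set 3 (.lit 0) ;;
  .loop (.reg 3 <ₑ .reg 0) (.put 3 (.reg 3) (.reg 3) ;; .set 3 (.reg 3 +ₑ .lit 1))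

/-- One step of a merging pass from array 3 to array 4: registers 3 to 7 hold the position written
to, the length of the blocks, the start of the current pair of blocks, and the positions read from
in the two blocks. Register 8 tells whether the second block provides the next value. -/
def mergeStep : Program :=
  .branch (.reg 3 =ₑ .reg 5 +ₑ .reg 4 +ₑ .reg 4)
    (.set 5 (.reg 3) ;; .set 6 (.reg 3) ;; .set 7 (.reg 3 +ₑ .reg 4)) .skip ;;
  .set 8 (.lit 0) ;;
  .branch (.reg 6 <ₑ .reg 5 +ₑ .reg 4)
    (.branch ((.reg 7 <ₑ .reg 5 +ₑ .reg 4 +ₑ .reg 4) *ₑ (.reg 7 <ₑ .reg 0))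
      (.set 8 (precedesExpr (.get 3 (.reg 7)) (.get 3 (.reg 6)))) .skip)
    (.set 8 (.lit 1)) ;;
  .branch (.reg 8)
    (.put 4 (.reg 3) (.get 3 (.reg 7)) ;; .set 7 (.reg 7 +ₑ .lit 1))
    (.put 4 (.reg 3) (.get 3 (.reg 6)) ;; .set 6 (.reg 6 +ₑ .lit 1)) ;;
  .set 3 (.reg 3 +ₑ .lit 1)

/-- One merging pass, after which the result is copied back to array 3. -/
def mergePass : Program :=
  (.set 3 (.lit 0) ;; .set 5 (.lit 0) ;; .set 6 (.lit 0) ;; .set 7 (.reg 4)) ;;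
  .loop (.reg 3 <ₑ .reg 0) mergeStep ;;
  .set 3 (.lit 0) ;;
  .loop (.reg 3 <ₑ .reg 0)
    (.put 3 (.reg 3) (.get 4 (.reg 3)) ;; .set 3 (.reg 3 +ₑ .lit 1))

/-- Array 3 becomes the list of the items in the order of decreasing efficiency. -/
def sortProg : Program :=
  identityProg ;; .set 4 (.lit 1) ;;
  .loop (.reg 4 <ₑ .reg 0) (mergePass ;; .set 4 (.reg 4 +ₑ .reg 4))

/-- The state `s'` differs from `s` only in the registers from 3 on and in the arrays 3 and 4. -/
def SameInput (s s' : State) : Prop :=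
  s'.reg 0 = s.reg 0 ∧ s'.reg 1 = s.reg 1 ∧ s'.reg 2 = s.reg 2 ∧
    ∀ a, a ≠ 3 → a ≠ 4 → s'.arr a = s.arr a

/-- The bounds on the sizes of the numbers in the input that prevent overflows. -/
structure Small (B N : ℕ) (s : State) : Prop where
  two_le : 2 ≤ N
  lt : 16 * (N * N) < B
  n_le : s.reg 0 ≤ N
  w_le : ∀ j, s.arr 0 j ≤ N
  p_le : ∀ j, s.arr 1 j ≤ N
  m_le : ∀ j, s.arr 2 j ≤ N

theorem Small.lin {B N : ℕ} {s : State} (h : Small B N s) : 32 * N < B := by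
  have h1 := h.lt
  have h2 := Nat.mul_le_mul_right N h.two_le
  omega

theorem Small.mul {B N : ℕ} {s : State} (h : Small B N s) {x y : ℕ} (hx : x ≤ N) (hy : y ≤ N) :
    x * y < B := by
  have h1 := h.lt
  have h2 := Nat.mul_le_mul hx hy
  omega

theorem Small.congr {B N : ℕ} {s s' : State} (h : Small B N s) (hs : SameInput s s') :
    Small B N s' := by
  obtain ⟨h1, -, -, h2⟩ := hs
  refine ⟨h.two_le, h.lt, h1 ▸ h.n_le, ?_, ?_, ?_⟩
  · rw [h2 0 (by decide) (by decide)]; exact h.w_le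
  · rw [h2 1 (by decide) (by decide)]; exact h.p_le
  · rw [h2 2 (by decide) (by decide)]; exact h.m_le

/-- The order of decreasing efficiency for weights and profits given by functions. -/
def Before (w p : ℕ → ℕ) (a b : ℕ) : Prop :=
  p b * w a < p a * w b ∨ (p b * w a = p a * w b ∧ a < b)

theorem precedesExpr_val {s : State} {a b : Expr} :
    (precedesExpr a b).val s ≠ 0 ↔ Before (s.arr 0) (s.arr 1) (a.val s) (b.val s) := by
  simp only [precedesExpr, Expr.val, Op.eval, Before]
  by_cases h1 : s.arr 1 (b.val s) * s.arr 0 (a.val s) < s.arr 1 (a.val s) * s.arr 0 (b.val s) <;>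
    by_cases h2 : s.arr 1 (b.val s) * s.arr 0 (a.val s) = s.arr 1 (a.val s) * s.arr 0 (b.val s) <;>
    by_cases h3 : a.val s < b.val s <;> simp [h1, h2, h3]

theorem ite_le_one (p : Prop) [Decidable p] : (if p then 1 else 0) ≤ 1 := by
  split_ifs <;> simp

theorem ite_mul_ite_le_one (p q : Prop) [Decidable p] [Decidable q] :
    (if p then 1 else 0) * (if q then 1 else 0) ≤ 1 :=
  Nat.mul_le_mul (ite_le_one p) (ite_le_one q)

theorem precedesExpr_fits {B N : ℕ} {s : State} (h : Small B N s) {a b : Expr} (ha : a.Fits B s)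
    (hb : b.Fits B s) : (precedesExpr a b).Fits B s := by
  have h1 := h.lin
  have h2 := h.two_le
  have h3 := h.mul (h.p_le (b.val s)) (h.w_le (a.val s))
  have h4 := h.mul (h.p_le (a.val s)) (h.w_le (b.val s))
  simp only [precedesExpr, Expr.Fits, Expr.val, Op.eval, ha, hb, true_and]
  refine ⟨⟨h3, h4⟩, ⟨⟨h3, h4⟩, ?_⟩, ?_⟩
  · exact (ite_mul_ite_le_one _ _).trans_lt (by omega)
  · exact (Nat.add_le_add (ite_le_one _) (ite_mul_ite_le_one _ _)).trans_lt (by omega)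

theorem runs_identityProg {B N n : ℕ} {s : State} (h : Small B N s) (hn : s.reg 0 = n) :
    Runs B identityProg s (20 * (n + 1)) fun s' => SameInput s s' ∧ ∀ j < n, s'.arr 3 j = j := by
  have h1 := h.lin
  have h2 := h.two_le
  have h3 := h.n_le
  have hB : 1 < B := by omega
  refine Runs.weaken (T := 2 + (∑ k ∈ Finset.range n, 8 + (n + 1) * 4)) ?_ (by
    rw [Finset.sum_const, Finset.card_range, smul_eq_mul]; omega) fun _ h => h
  refine Runs.seq ((Runs.of_wp hB (Q := fun s' => SameInput s s' ∧ s'.reg 3 = 0) (by decide)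
    ?_).weaken le_rfl fun s₁ hs₁ => ?_)
  · simp [wp, Expr.Fits, Expr.val, SameInput]
    omega
  refine Runs.loop hB (K := n) (fun k s' => SameInput s s' ∧ s'.reg 3 = k ∧
    ∀ j < k, s'.arr 3 j = j) ⟨hs₁.1, hs₁.2, by simp⟩ ?_ ?_
  · rintro k s' hk ⟨hI, hr, ha⟩
    have h0 : s'.reg 0 = n := hI.1.trans hn
    refine ⟨by simp [Expr.Fits], by simp [Expr.val, Op.eval, hr, h0, hk], ?_⟩
    refine Runs.of_wp hB (by decide) ?_
    simp only [wp, Expr.Fits, Expr.val, Op.eval, SameInput] at hI ⊢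
    simp [hr, hI]
    refine ⟨by omega, ?_, ?_⟩
    · intro a h3 h4
      simp [h3, hI.2.2.2 a h3 h4]
    · intro j hj
      rw [Function.update_apply]
      split_ifs with hjk
      · exact hjk.symm
      · exact ha j (by omega)
  · rintro s' ⟨hI, hr, ha⟩
    have h0 : s'.reg 0 = n := hI.1.trans hn
    exact ⟨by simp [Expr.Fits], by simp [Expr.val, Op.eval, hr, h0], hI, ha⟩

/-- The state during a merging pass, up to the loop counter. -/
def MergeState (n r : ℕ) (rk X : ℕ → ℕ) (s : State) (k : ℕ) (s' : State) : Prop :=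
  SameInput s s' ∧ s'.arr 3 = X ∧ s'.reg 4 = r ∧ s'.reg 3 = k ∧
    MergeInv n r rk X (s'.arr 4) k (s'.reg 5) (s'.reg 6) (s'.reg 7)

theorem runs_mergeStep {B N n r k : ℕ} {rk X : ℕ → ℕ} {s s' : State} (h : Small B N s)
    (hn : s.reg 0 = n) (hr : r ≤ 2 * N) (hr0 : 0 < r) (hX : SortedRuns n rk X r)
    (hp : ∀ a < n, X a < n)
    (hrk : ∀ a < n, ∀ b < n, Before (s.arr 0) (s.arr 1) a b ↔ rk a < rk b) (hk : k < n)
    (hI : MergeState n r rk X s k s') :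
    Runs B mergeStep s' mergeStep.time (MergeState n r rk X s (k + 1)) := by
  obtain ⟨hsame, hA3, h4, h3, hM⟩ := hI
  have hsm := h.congr hsame
  have h1 := h.lin
  have h2 := h.two_le
  have hnN := h.n_le
  have hB : 1 < B := by omega
  have hn' : s'.reg 0 = n := hsame.1.trans hn
  -- The state after the first instruction, where `k` lies in the current pair of blocks.
  obtain ⟨b, i, j, hM', hkb, hfirst⟩ : ∃ b i j, MergeInv n r rk X (s'.arr 4) k b i j ∧
      k < b + 2 * r ∧ ∀ Q : State → Prop, (∀ s'', SameInput s s'' → s''.arr = s'.arr →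
        s''.reg 4 = r → s''.reg 3 = k → s''.reg 5 = b → s''.reg 6 = i → s''.reg 7 = j → Q s'') →
      wp B (.branch (.reg 3 =ₑ .reg 5 +ₑ .reg 4 +ₑ .reg 4)
        (.set 5 (.reg 3) ;; .set 6 (.reg 3) ;; .set 7 (.reg 3 +ₑ .reg 4)) .skip) Q s' := by
    have hle := hM.le_k
    have hle2 := hM.k_le
    by_cases hkb : k = s'.reg 5 + 2 * r
    · refine ⟨k, k, k + r, hM.next_block hkb, by omega, fun Q hQ => ?_⟩
      have : k = s'.reg 5 + r + r := by omega
      simp only [wp, Expr.Fits, Expr.val, Op.eval, h3, h4, State.reg_setReg]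
      refine ⟨⟨trivial, ⟨trivial, trivial, by omega⟩, trivial, by omega⟩, fun _ => ?_,
        fun hcon => absurd this (by simpa using hcon)⟩
      refine ⟨trivial, trivial, by simp; omega, ?_⟩
      apply hQ <;> simp [h3, h4]
      exact ⟨by simp [hsame.1], by simp [hsame.2.1], by simp [hsame.2.2.1], hsame.2.2.2⟩
    · refine ⟨_, _, _, hM, by omega, fun Q hQ => ?_⟩
      have : ¬ k = s'.reg 5 + r + r := by omega
      simp only [wp, Expr.Fits, Expr.val, Op.eval, h3, h4, State.reg_setReg]
      refine ⟨⟨trivial, ⟨trivial, trivial, by omega⟩, trivial, by omega⟩,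
        fun hcon => absurd this (by simpa using hcon), fun _ => ?_⟩
      exact hQ s' hsame rfl h4 h3 rfl rfl rfl
  refine Runs.of_wp hB le_rfl ?_
  rw [mergeStep, wp]
  refine hfirst _ fun t hst harr t4 t3 t5 t6 t7 => ?_
  have hM1 := hM'.count
  have hM2 := hM'.le_i
  have hM3 := hM'.le_j
  have hM4 := hM'.i_le
  have hM5 := hM'.le_k
  have hM6 := hM'.j_le
  have hin : i < b + r → i < n := by omega
  have tsm := h.congr hst
  have tn : t.reg 0 = n := hst.1.trans hn
  have tA3 : t.arr 3 = X := by rw [harr, hA3]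
  -- Register 8 says from which block the next value comes.
  have hsecond : ∀ Q : State → Prop, (∀ f,
      (f ≠ 0 → j < b + 2 * r ∧ j < n ∧ (i < b + r → rk (X j) ≤ rk (X i))) →
      (f = 0 → i < b + r ∧ (j < b + 2 * r → j < n → rk (X i) ≤ rk (X j))) →
      Q (t.setReg 8 f)) →
      wp B (.set 8 (.lit 0)) (wp B (.branch (.reg 6 <ₑ .reg 5 +ₑ .reg 4)
        (.branch ((.reg 7 <ₑ .reg 5 +ₑ .reg 4 +ₑ .reg 4) *ₑ (.reg 7 <ₑ .reg 0))
          (.set 8 (precedesExpr (.get 3 (.reg 7)) (.get 3 (.reg 6)))) .skip)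
        (.set 8 (.lit 1))) Q) t := by
    intro Q hQ
    simp only [wp, Expr.Fits, Expr.val, Op.eval, State.setReg_setReg]
    simp only [State.reg_setReg, t4, t5, t6, t7, tn]
    simp only [Nat.reduceEqDiff, if_false, true_and, (by decide : ¬ (0 : ℕ) = 8)]
    refine ⟨by omega, by omega, fun hib => ⟨⟨⟨by omega, by omega⟩,
      (ite_mul_ite_le_one _ _).trans_lt (by omega)⟩, fun hjb => ?_, fun hjb => ?_⟩, fun hib => ?_⟩
    · have hib' : i < b + r := by by_contra hcon; simp [hcon] at hib
      have hjb' : j < b + r + r ∧ j < n := by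
        by_contra hcon
        rw [not_and_or] at hcon
        rcases hcon with hcon | hcon <;> simp [hcon] at hjb
      have hiff := (precedesExpr_val (s := t.setReg 8 0) (a := .get 3 (.reg 7))
        (b := .get 3 (.reg 6)))
      simp only [Expr.val, State.reg_setReg, State.arr_setReg, t6, t7, tA3, Nat.reduceEqDiff,
        if_false, hst.2.2.2 0 (by decide) (by decide),
        hst.2.2.2 1 (by decide) (by decide),
        hrk _ (hp j hjb'.2) _ (hp i (hin hib'))] at hiff
      refine ⟨precedesExpr_fits (N := N) ?_ ?_ ?_, hQ _ (fun hf => ?_) (fun hf => ?_)⟩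
      · exact ⟨tsm.two_le, tsm.lt, by simpa using tsm.n_le, tsm.w_le, tsm.p_le, tsm.m_le⟩
      · simp [Expr.Fits]
      · simp [Expr.Fits]
      · exact ⟨by omega, hjb'.2, fun _ => (hiff.1 hf).le⟩
      · exact ⟨hib', fun _ _ => not_lt.1 fun hlt => hiff.2 hlt hf⟩
    · have hib' : i < b + r := by by_contra hcon; simp [hcon] at hib
      refine hQ _ (fun hf => absurd rfl hf) fun _ => ⟨hib', fun h1 h2 => ?_⟩
      simp [show j < b + r + r by omega, h2] at hjb
    · have hib' : ¬ i < b + r := by intro hcon; simp [hcon] at hib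
      exact ⟨by omega, hQ _ (fun _ => ⟨by omega, by omega, fun h1 => absurd h1 hib'⟩)
        (fun hf => absurd hf one_ne_zero)⟩
  rw [wp, wp]
  refine hsecond _ fun f hf1 hf2 => ?_
  have hsame' : ∀ x ∉ [(0 : ℕ), 1, 2], ∀ v, SameInput s (t.setReg x v) := by
    intro x hx v
    simp only [List.mem_cons, List.not_mem_nil, or_false, not_or] at hx
    simp [SameInput, Ne.symm hx.1, Ne.symm hx.2.1, Ne.symm hx.2.2, hst.1, hst.2.1, hst.2.2.1]
    exact hst.2.2.2
  simp only [wp, Expr.Fits, Expr.val, Op.eval, State.reg_setReg, State.reg_setArr,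
    State.arr_setReg, t3, t6, t7, tA3]
  simp only [Nat.reduceEqDiff, if_false, if_true, true_and]
  have hfinal : ∀ x v a c, MergeInv n r rk X (Function.update (t.arr 4) k v) (k + 1) b a c →
      (x = 7 ∧ a = i ∧ c = j + 1 ∨ x = 6 ∧ a = i + 1 ∧ c = j) →
      MergeState n r rk X s (k + 1)
        ((((t.setReg 8 f).setArr 4 k v).setReg x (if x = 7 then c else a)).setReg 3 (k + 1)) := by
    intro x v a c hinv hx
    refine ⟨⟨?_, ?_, ?_, ?_⟩, ?_, ?_, ?_, ?_⟩
    all_goals rcases hx with ⟨rfl, rfl, rfl⟩ | ⟨rfl, rfl, rfl⟩ <;>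
      simp [hst.1, hst.2.1, hst.2.2.1, tA3, t4, t5, t6, t7, hinv]
    all_goals
      intro a' h3' h4'
      simp [h4', hst.2.2.2 a' h3' h4']
  refine ⟨fun hf => ?_, fun hf => ?_⟩
  · obtain ⟨g1, g2, g3⟩ := hf1 hf
    refine ⟨by omega, by omega, ?_⟩
    have := hM'.take_right hX hp hkb g1 g2 g3
    rw [← harr] at this
    exact hfinal 7 (X j) i (j + 1) this (.inl ⟨rfl, rfl, rfl⟩)
  · obtain ⟨g1, g2⟩ := hf2 hf
    refine ⟨by omega, by omega, ?_⟩
    have := hM'.take_left hX hp hkb g1 (hin g1) g2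
    rw [← harr] at this
    exact hfinal 6 (X i) (i + 1) j this (.inr ⟨rfl, rfl, rfl⟩)


theorem runs_mergePass {B N n r : ℕ} {rk : ℕ → ℕ} {s s' : State} (h : Small B N s)
    (hn : s.reg 0 = n) (hr : r ≤ 2 * N) (hr0 : 0 < r) (hsame : SameInput s s')
    (h4 : s'.reg 4 = r) (hX : SortedRuns n rk (s'.arr 3) r) (hp : IsPermutation n (s'.arr 3))
    (hrk : ∀ a < n, ∀ b < n, Before (s.arr 0) (s.arr 1) a b ↔ rk a < rk b) :
    Runs B mergePass s' ((mergeStep.time + 20) * (n + 1)) fun t => SameInput s t ∧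
      t.reg 4 = r ∧ SortedRuns n rk (t.arr 3) (2 * r) ∧ IsPermutation n (t.arr 3) := by
  have h1 := h.lin
  have h2 := h.two_le
  have hnN := h.n_le
  have hB : 1 < B := by omega
  refine Runs.weaken (T := 8 + ((∑ k ∈ Finset.range n, mergeStep.time + (n + 1) * 4) + (2 +
    (∑ k ∈ Finset.range n, 8 + (n + 1) * 4)))) ?_ (by
    rw [Finset.sum_const, Finset.sum_const, Finset.card_range, smul_eq_mul, smul_eq_mul]
    linarith) fun _ h => h
  refine Runs.seq ((Runs.of_wp hB (Q := MergeState n r rk (s'.arr 3) s 0) (by decide)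
    ?_).weaken le_rfl fun s₁ hs₁ => ?_)
  · simp [wp, Expr.Fits, Expr.val, MergeState, SameInput, hsame.1, hsame.2.1, hsame.2.2.1, h4]
    exact ⟨by omega, hsame.2.2.2, MergeInv.init⟩
  refine Runs.seq ((Runs.loop hB (K := n) (Q := MergeState n r rk (s'.arr 3) s n)
    (MergeState n r rk (s'.arr 3) s) hs₁ ?_ ?_).weaken le_rfl fun s₂ hs₂ => ?_)
  · intro k t hk hI
    refine ⟨by simp [Expr.Fits], ?_, runs_mergeStep h hn hr hr0 hX hp.1 hrk hk hI⟩
    simp [Expr.val, Op.eval, hI.2.2.2.1, hI.1.1, hn, hk]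
  · intro t hI
    refine ⟨by simp [Expr.Fits], ?_, hI⟩
    simp [Expr.val, Op.eval, hI.2.2.2.1, hI.1.1, hn]
  obtain ⟨hs2, hA3, hr4, -, hM⟩ := hs₂
  refine Runs.seq ((Runs.of_wp hB (Q := fun t => SameInput s t ∧ t.reg 4 = r ∧ t.reg 3 = 0 ∧
    t.arr 4 = s₂.arr 4) (by decide) ?_).weaken le_rfl fun s₃ hs₃ => ?_)
  · simp [wp, Expr.Fits, Expr.val, SameInput, hs2.1, hs2.2.1, hs2.2.2.1, hr4]
    exact ⟨by omega, hs2.2.2.2⟩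
  refine Runs.loop hB (K := n) (fun k t => SameInput s t ∧ t.reg 4 = r ∧ t.reg 3 = k ∧
    t.arr 4 = s₂.arr 4 ∧ ∀ j < k, t.arr 3 j = s₂.arr 4 j)
    ⟨hs₃.1, hs₃.2.1, hs₃.2.2.1, hs₃.2.2.2, by simp⟩ ?_ ?_
  · rintro k t hk ⟨hI, t4, t3, tA4, tA3⟩
    refine ⟨by simp [Expr.Fits], by simp [Expr.val, Op.eval, t3, hI.1, hn, hk],
      Runs.of_wp hB (by decide) ?_⟩
    simp [wp, Expr.Fits, Expr.val, Op.eval, SameInput, hI.1, hI.2.1, hI.2.2.1, t3, t4, tA4]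
    refine ⟨by omega, ?_, ?_⟩
    · intro a h3 h4
      simp [h3, hI.2.2.2 a h3 h4]
    · intro j hj
      rw [Function.update_apply]
      split_ifs with hjk
      · rw [hjk]
      · exact tA3 j (by omega)
  · rintro t ⟨hI, t4, t3, tA4, tA3⟩
    refine ⟨by simp [Expr.Fits], by simp [Expr.val, Op.eval, t3, hI.1, hn], hI, t4, ?_, ?_⟩
    · intro q a a' h1 h2 h3 h4
      rw [tA3 a (by omega), tA3 a' h4]
      exact hM.sorted q a a' h1 h2 h3 h4
    · have hp2 := hM.isPermutation hp
      refine ⟨fun a ha => by rw [tA3 a ha]; exact hp2.1 a ha, fun v hv => ?_⟩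
      obtain ⟨a, ha, hav⟩ := hp2.2 v hv
      exact ⟨a, ha, by rw [tA3 a ha, hav]⟩

/-- Sorting takes `O(n log n)` steps. -/
theorem runs_sortProg {B N n : ℕ} {rk : ℕ → ℕ} {s : State} (h : Small B N s) (hn : s.reg 0 = n)
    (hrk : ∀ a < n, ∀ b < n, Before (s.arr 0) (s.arr 1) a b ↔ rk a < rk b) :
    Runs B sortProg s ((mergeStep.time + 30) * (n + 1) * (Nat.clog 2 n + 1)) fun t =>
      SameInput s t ∧ IsPermutation n (t.arr 3) ∧
        ∀ a a', a < a' → a' < n → rk (t.arr 3 a) ≤ rk (t.arr 3 a') := by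
  have h1 := h.lin
  have h2 := h.two_le
  have hnN := h.n_le
  have hB : 1 < B := by omega
  refine Runs.weaken (T := 20 * (n + 1) + (2 + (∑ k ∈ Finset.range (Nat.clog 2 n),
    ((mergeStep.time + 20) * (n + 1) + 4) + (Nat.clog 2 n + 1) * 4))) ?_ (by
      rw [Finset.sum_const, Finset.card_range, smul_eq_mul]
      nlinarith [Nat.zero_le (mergeStep.time * (n + 1)), Nat.zero_le (n * Nat.clog 2 n)])
      fun _ h => h
  refine Runs.seq ((runs_identityProg h hn).weaken le_rfl fun s₁ ⟨hs₁, hid⟩ => ?_)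
  refine Runs.seq ((Runs.of_wp hB (Q := fun t => SameInput s t ∧ t.reg 4 = 1 ∧
    ∀ j < n, t.arr 3 j = j) (by decide) ?_).weaken le_rfl fun s₂ hs₂ => ?_)
  · simp [wp, Expr.Fits, Expr.val, SameInput, hs₁.1, hs₁.2.1, hs₁.2.2.1]
    exact ⟨by omega, hs₁.2.2.2, hid⟩
  refine Runs.loop hB (K := Nat.clog 2 n) (fun k t => SameInput s t ∧ t.reg 4 = 2 ^ k ∧
    SortedRuns n rk (t.arr 3) (2 ^ k) ∧ IsPermutation n (t.arr 3)) ⟨hs₂.1, hs₂.2.1, ?_, ?_⟩ ?_ ?_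
  · intro q a a' g1 g2 g3 g4
    omega
  · exact ⟨fun a ha => by rw [hs₂.2.2 a ha]; exact ha, fun v hv => ⟨v, hv, hs₂.2.2 v hv⟩⟩
  · rintro k t hk ⟨hI, t4, hX, hp⟩
    have hkn : 2 ^ k < n := (Nat.lt_clog_iff_pow_lt (by norm_num)).1 hk
    refine ⟨by simp [Expr.Fits], by simp [Expr.val, Op.eval, t4, hI.1, hn, hkn], ?_⟩
    refine Runs.seq ((runs_mergePass h hn (by omega) (by positivity) hI t4 hX hp hrk).weaken
      le_rfl fun u ⟨hu, u4, hX', hp'⟩ => Runs.of_wp hB (by decide) ?_)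
    simp [wp, Expr.Fits, Expr.val, Op.eval, SameInput, hu.1, hu.2.1, hu.2.2.1, u4]
    refine ⟨by omega, hu.2.2.2, by rw [pow_succ]; omega, ?_, hp'⟩
    rwa [pow_succ, mul_comm]
  · rintro t ⟨hI, t4, hX, hp⟩
    have hkn : n ≤ 2 ^ Nat.clog 2 n := Nat.le_pow_clog (by norm_num) n
    refine ⟨by simp [Expr.Fits], by simp [Expr.val, Op.eval, t4, hI.1, hn, hkn], hI, hp, ?_⟩
    intro a a' g1 g2
    exact hX 0 a a' (by omega) g1 (by omega) g2

end WordRAM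

/-! ### The largest weight and the greedy solution on the word RAM -/

namespace WordRAM

/-- Register 2 becomes the largest weight (or 0 if there are no items). -/
def maxWeightProg : Program :=
  .set 3 (.lit 0) ;;
  .loop (.reg 3 <ₑ .reg 0)
    (.branch (.reg 2 <ₑ .get 0 (.reg 3)) (.set 2 (.get 0 (.reg 3))) .skip ;;
      .set 3 (.reg 3 +ₑ .lit 1))

/-- For each position in the order of array 3, array 5 receives the number of copies in the
greedy solution, array 6 the weight and array 7 the multiplicity of the item there. Register 1
holds the remaining capacity; the truncated subtraction makes it 0 as soon as an item does not
fit completely. -/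
def greedyProg : Program :=
  .set 3 (.lit 0) ;;
  .loop (.reg 3 <ₑ .reg 0)
    (.set 4 (.get 3 (.reg 3)) ;;
      .put 6 (.reg 3) (.get 0 (.reg 4)) ;;
      .put 7 (.reg 3) (.get 2 (.reg 4)) ;;
      .set 5 (.reg 1 /ₑ .get 0 (.reg 4)) ;;
      .branch (.get 2 (.reg 4) <ₑ .reg 5) (.set 5 (.get 2 (.reg 4))) .skip ;;
      .put 5 (.reg 3) (.reg 5) ;;
      .set 1 (.reg 1 -ₑ .get 2 (.reg 4) *ₑ .get 0 (.reg 4)) ;;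
      .set 3 (.reg 3 +ₑ .lit 1))

theorem runs_maxWeightProg {B N n : ℕ} {s : State} (h : Small B N s) (hn : s.reg 0 = n)
    (h2 : s.reg 2 = 0) : Runs B maxWeightProg s (20 * (n + 1)) fun t =>
      t.reg 0 = n ∧ t.reg 1 = s.reg 1 ∧ t.reg 2 = (Finset.range n).sup (s.arr 0) ∧
        t.arr = s.arr := by
  have hlin := h.lin
  have htwo := h.two_le
  have hnN := h.n_le
  have hB : 1 < B := by omega
  refine Runs.weaken (T := 2 + (∑ k ∈ Finset.range n, 12 + (n + 1) * 4)) ?_ (by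
    rw [Finset.sum_const, Finset.card_range, smul_eq_mul]; omega) fun _ h => h
  refine Runs.seq ((Runs.of_wp hB (Q := fun t => t.reg 0 = n ∧ t.reg 1 = s.reg 1 ∧
    t.reg 2 = 0 ∧ t.reg 3 = 0 ∧ t.arr = s.arr) (by decide) ?_).weaken le_rfl fun s₁ hs₁ => ?_)
  · simp [wp, Expr.Fits, Expr.val, hn, h2]
    omega
  refine Runs.loop hB (K := n) (fun k t => t.reg 0 = n ∧ t.reg 1 = s.reg 1 ∧
    t.reg 2 = (Finset.range k).sup (s.arr 0) ∧ t.reg 3 = k ∧ t.arr = s.arr) hs₁ ?_ ?_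
  · rintro k t hk ⟨t0, t1, t2, t3, ta⟩
    refine ⟨by simp [Expr.Fits], by simp [Expr.val, Op.eval, t3, t0, hk],
      Runs.of_wp hB (by decide) ?_⟩
    simp [wp, Expr.Fits, Expr.val, Op.eval, t0, t1, t2, t3, ta, Finset.range_add_one]
    refine ⟨fun hlt => ⟨by omega, fun j hj => ?_⟩, fun hle => ⟨by omega, hle⟩⟩
    exact (Finset.le_sup (f := s.arr 0) (Finset.mem_range.2 hj)).trans hlt.le
  · rintro t ⟨t0, t1, t2, t3, ta⟩
    exact ⟨by simp [Expr.Fits], by simp [Expr.val, Op.eval, t3, t0], t0, t1, t2, ta⟩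

theorem forall_le_update {Y g : ℕ → ℕ} {k v : ℕ} (h : ∀ q < k, Y q = g q) (hv : v = g k) :
    ∀ q ≤ k, Function.update Y k v q = g q := by
  intro q hq
  rw [Function.update_apply]
  split_ifs with hqk
  · rw [hv, hqk]
  · exact h q (by omega)

theorem runs_greedyProg {B N n W : ℕ} {s : State} (h : Small B N s) (hn : s.reg 0 = n)
    (hW : s.reg 1 = W) (hmw : ∀ j, s.arr 2 j * s.arr 0 j < B) :
    Runs B greedyProg s (60 * (n + 1)) fun t =>
      t.reg 0 = n ∧ t.reg 2 = s.reg 2 ∧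
        (∀ a, a ≠ 5 → a ≠ 6 → a ≠ 7 → t.arr a = s.arr a) ∧
        (∀ q < n, t.arr 6 q = s.arr 0 (s.arr 3 q)) ∧
        (∀ q < n, t.arr 7 q = s.arr 2 (s.arr 3 q)) ∧
        ∀ q < n, t.arr 5 q = min (s.arr 2 (s.arr 3 q))
          ((W - ∑ i ∈ Finset.range q, s.arr 2 (s.arr 3 i) * s.arr 0 (s.arr 3 i)) /
            s.arr 0 (s.arr 3 q)) := by
  have hlin := h.lin
  have htwo := h.two_le
  have hnN := h.n_le
  have hB : 1 < B := by omega
  refine Runs.weaken (T := 2 + (∑ k ∈ Finset.range n, 46 + (n + 1) * 4)) ?_ (by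
    rw [Finset.sum_const, Finset.card_range, smul_eq_mul]; omega) fun _ h => h
  refine Runs.seq ((Runs.of_wp hB (Q := fun t => t.reg 0 = n ∧ t.reg 1 = W ∧
    t.reg 2 = s.reg 2 ∧ t.reg 3 = 0 ∧ t.arr = s.arr) (by decide) ?_).weaken le_rfl
    fun s₁ hs₁ => ?_)
  · simp [wp, Expr.Fits, Expr.val, hn, hW]
    omega
  refine Runs.loop hB (K := n) (fun k t => t.reg 0 = n ∧
    t.reg 1 = W - ∑ i ∈ Finset.range k, s.arr 2 (s.arr 3 i) * s.arr 0 (s.arr 3 i) ∧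
    t.reg 2 = s.reg 2 ∧ t.reg 3 = k ∧
    (∀ a, a ≠ 5 → a ≠ 6 → a ≠ 7 → t.arr a = s.arr a) ∧
        (∀ q < k, t.arr 6 q = s.arr 0 (s.arr 3 q)) ∧
        (∀ q < k, t.arr 7 q = s.arr 2 (s.arr 3 q)) ∧
        ∀ q < k, t.arr 5 q = min (s.arr 2 (s.arr 3 q))
          ((W - ∑ i ∈ Finset.range q, s.arr 2 (s.arr 3 i) * s.arr 0 (s.arr 3 i)) /
            s.arr 0 (s.arr 3 q))) ?_ ?_ ?_
  · obtain ⟨h0, h1, h2, h3, ha⟩ := hs₁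
    exact ⟨h0, by simpa using h1, h2, h3, fun a _ _ _ => by rw [ha], by simp, by simp, by simp⟩
  · rintro k t hk ⟨t0, t1, t2, t3, ta, t6, t7, t5⟩
    refine ⟨by simp [Expr.Fits], by simp [Expr.val, Op.eval, t3, t0, hk],
      Runs.of_wp hB (by decide) ?_⟩
    have e0 := ta 0 (by decide) (by decide) (by decide)
    have e2 := ta 2 (by decide) (by decide) (by decide)
    have e3 := ta 3 (by decide) (by decide) (by decide)
    simp [wp, Expr.Fits, Expr.val, Op.eval, t0, t1, t2, t3, e0, e2, e3]
    rw [Finset.sum_range_succ, ← Nat.sub_sub]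
    have hframe : ∀ v a, ¬ a = 5 → ¬ a = 6 → ¬ a = 7 → (if a = 5 then v else if a = 7 then
        Function.update (t.arr 7) k (s.arr 2 (s.arr 3 k)) else if a = 6 then
        Function.update (t.arr 6) k (s.arr 0 (s.arr 3 k)) else t.arr a) = s.arr a :=
      fun v a h5 h6 h7 => by rw [if_neg h5, if_neg h7, if_neg h6, ta a h5 h6 h7]
    refine ⟨fun hlt => ⟨hmw _, ⟨hB, by omega⟩, rfl, hframe _, forall_le_update t6 rfl,
      forall_le_update t7 rfl, forall_le_update t5 (min_eq_left hlt.le).symm⟩,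
      fun hle => ⟨hmw _, ⟨hB, by omega⟩, rfl, hframe _, forall_le_update t6 rfl,
      forall_le_update t7 rfl, forall_le_update t5 (min_eq_right hle).symm⟩⟩
  · rintro t ⟨t0, t1, t2, t3, ta⟩
    exact ⟨by simp [Expr.Fits], by simp [Expr.val, Op.eval, t3, t0], t0, t2, ta⟩

end WordRAM

/-! ### The scan on the word RAM -/

/-- The scan of both sides of the greedy solution, where `w`, `m` and `take` are the weights, the
multiplicities and the numbers of greedily taken copies in the order of decreasing efficiency:
first the taken copies from the last item to the first, then the other copies from the first item
to the last. The key consists of the weight and the side, and the class consists of the power of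
two below the weight and the side. -/
def twoSidedScan (n U : ℕ) (w m take : ℕ → ℕ) : Scan where
  key k := if k < n then 2 * w (n - 1 - k) else 2 * w (k - n) + 1
  mult k := if k < n then take (n - 1 - k) else m (k - n) - take (k - n)
  cls v := 2 * 2 ^ Nat.log 2 (v / 2) + v % 2
  U := U

/-- The position in the order of efficiency of the item scanned in step `k`. -/
def scanPos (n k : ℕ) : ℕ := if k < n then n - 1 - k else k - n

/-- The number, within its item, of the first copy selected in step `k`: the selected copies are
the last ones of the greedy solution or the first ones outside. -/
noncomputable def scanStart (D : Scan) (n : ℕ) (take : ℕ → ℕ) (k : ℕ) : ℕ :=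
  if k < n then take (n - 1 - k) - D.emit k else take (k - n)

namespace WordRAM

/-- The treatment of one threshold `T`, in register 13. Registers 6, 10, 11 and 12 hold the number
of copies of the current item, the class of its key, the number of copies with its key that were
scanned before, and the limit for this key. Array 10 counts the active keys. -/
def thresholdStep : Program :=
  .branch ((.reg 11 <ₑ .reg 13) *ₑ (.reg 13 <ₑ .reg 11 +ₑ .reg 6 +ₑ .lit 1))
    (.set 14 (.reg 10 *ₑ (.reg 2 +ₑ .lit 1) +ₑ .reg 13) ;;
      .branch (.lit 16 *ₑ .reg 2 <ₑ .get 10 (.reg 14) *ₑ .reg 13 +ₑ .lit 1)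
        (.branch (.reg 13 +ₑ .reg 13 <ₑ .reg 12) (.set 12 (.reg 13 +ₑ .reg 13)) .skip)
        .skip ;;
      .put 10 (.reg 14) (.get 10 (.reg 14) +ₑ .lit 1))
    .skip ;;
  .set 13 (.reg 13 +ₑ .reg 13)

theorem classIndex_injective {U κ κ' T T' : ℕ} (hT : T ≤ U) (hT' : T' ≤ U)
    (h : κ * (U + 1) + T = κ' * (U + 1) + T') : κ = κ' ∧ T = T' := by
  have h1 : (κ * (U + 1) + T) / (U + 1) = κ := by
    rw [mul_comm, Nat.mul_add_div (by omega), Nat.div_eq_of_lt (by omega), add_zero]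
  have h2 : (κ' * (U + 1) + T') / (U + 1) = κ' := by
    rw [mul_comm, Nat.mul_add_div (by omega), Nat.div_eq_of_lt (by omega), add_zero]
  have : κ = κ' := by rw [← h1, h, h2]
  subst this
  exact ⟨rfl, by omega⟩

theorem runs_thresholdLoop {B N k b : ℕ} {D : Scan} {s : State} (hN : 2 ≤ N)
    (hNB : 16 * (N * N) < B) (hU : D.U ≤ N) (hk : k ≤ 2 * N)
    (hκ : D.cls (D.key k) ≤ 2 * N + 1) (hcx : D.cnt k (D.key k) + D.mult k ≤ N)
    (s2 : s.reg 2 = D.U) (s6 : s.reg 6 = D.mult k) (s10 : s.reg 10 = D.cls (D.key k))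
    (s11 : s.reg 11 = D.cnt k (D.key k)) (s12 : s.reg 12 = b) (s13 : s.reg 13 = 1)
    (hA : ∀ κ i, 2 ^ i ≤ D.U → s.arr 10 (κ * (D.U + 1) + 2 ^ i) = (D.active k κ (2 ^ i)).card) :
    Runs B (.loop (.reg 13 <ₑ .reg 2 +ₑ .lit 1) thresholdStep) s (80 * (D.U.size + 1)) fun t =>
      (∀ x, x ≠ 12 → x ≠ 13 → x ≠ 14 → t.reg x = s.reg x) ∧ (∀ a, a ≠ 10 → t.arr a = s.arr a) ∧
      t.reg 12 = D.lower k b D.U.size ∧ ∀ κ i, 2 ^ i ≤ D.U →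
        t.arr 10 (κ * (D.U + 1) + 2 ^ i) = (D.active (k + 1) κ (2 ^ i)).card := by
  have hlin : 32 * N < B := by
    have := Nat.mul_le_mul_right N hN
    omega
  have hB : 1 < B := by omega
  refine Runs.weaken (T := ∑ i ∈ Finset.range D.U.size, 70 + (D.U.size + 1) * 6) ?_ (by
    rw [Finset.sum_const, Finset.card_range, smul_eq_mul]; omega) fun _ h => h
  refine Runs.loop hB (K := D.U.size) (fun i t =>
    (∀ x, x ≠ 12 → x ≠ 13 → x ≠ 14 → t.reg x = s.reg x) ∧ (∀ a, a ≠ 10 → t.arr a = s.arr a) ∧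
      t.reg 12 = D.lower k b i ∧ t.reg 13 = 2 ^ i ∧ ∀ κ i', 2 ^ i' ≤ D.U →
        t.arr 10 (κ * (D.U + 1) + 2 ^ i') =
          (D.active (if i' < i then k + 1 else k) κ (2 ^ i')).card) ?_ ?_ ?_
  · exact ⟨fun _ _ _ _ => rfl, fun _ _ => rfl, s12, s13, by simpa using hA⟩
  · rintro i t hi ⟨hreg, harr, t12, t13, tA⟩
    have hT := Nat.lt_size.1 hi
    have t2 := (hreg 2 (by decide) (by decide) (by decide)).trans s2
    have t6 := (hreg 6 (by decide) (by decide) (by decide)).trans s6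
    have t10 := (hreg 10 (by decide) (by decide) (by decide)).trans s10
    have t11 := (hreg 11 (by decide) (by decide) (by decide)).trans s11
    have hact := tA (D.cls (D.key k)) i hT
    rw [if_neg (lt_irrefl i)] at hact
    have hcard : (D.active k (D.cls (D.key k)) (2 ^ i)).card ≤ 2 * N :=
      ((Finset.card_filter_le _ _).trans Finset.card_image_le).trans (by simpa using hk)
    refine ⟨?_, ?_, Runs.of_wp hB (by decide) ?_⟩
    · simp [Expr.Fits, Expr.val, t2]; omega
    · simp [Expr.val, Op.eval, t2, t13]; omega
    have hstep : ∀ κ i', 2 ^ i' ≤ D.U →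
        (D.active (if i' < i + 1 then k + 1 else k) κ (2 ^ i')).card =
        if i' = i then (D.active k κ (2 ^ i)).card + (if D.cls (D.key k) = κ ∧
          D.cnt k (D.key k) < 2 ^ i ∧ 2 ^ i ≤ D.cnt k (D.key k) + D.mult k then 1 else 0)
        else (D.active (if i' < i then k + 1 else k) κ (2 ^ i')).card := by
      intro κ i' hi'
      by_cases h : i' = i
      · subst h
        rw [if_pos (Nat.lt_succ_self _), if_pos rfl, Scan.card_active_succ (by positivity)]
      · rw [if_neg h]
        have : i' < i + 1 ↔ i' < i := by omega
        simp only [this]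
    have hidx1 := Nat.mul_le_mul hκ (Nat.add_le_add_right hU 1)
    have hidx2 : (2 * N + 1) * (N + 1) = 2 * (N * N) + 3 * N + 1 := by ring
    have hcT := Nat.mul_le_mul hcard (hT.trans hU)
    have hcT' : 2 * N * N = 2 * (N * N) := by ring
    have hNN := Nat.mul_le_mul_right N hN
    have hpow : 2 ^ i + 2 ^ i = 2 ^ (i + 1) := by rw [pow_succ]; omega
    have hcross : 2 ^ i ≤ D.cnt k (D.key k) + D.mult k → D.cnt k (D.key k) < 2 ^ i →
        ∀ κ i', 2 ^ i' ≤ D.U →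
          Function.update (t.arr 10) (D.cls (D.key k) * (D.U + 1) + 2 ^ i)
            ((D.active k (D.cls (D.key k)) (2 ^ i)).card + 1) (κ * (D.U + 1) + 2 ^ i') =
          (D.active (if i' ≤ i then k + 1 else k) κ (2 ^ i')).card := by
      intro h1 h2 κ i' hi'
      have := hstep κ i' hi'
      simp only [Nat.lt_succ_iff] at this
      rw [this, Function.update_apply]
      by_cases h3 : κ * (D.U + 1) + 2 ^ i' = D.cls (D.key k) * (D.U + 1) + 2 ^ i
      · obtain ⟨h4, h5⟩ := classIndex_injective hi' hT h3
        rw [if_pos h3, if_pos (Nat.pow_right_injective le_rfl h5), if_pos ⟨h4.symm, h2, h1⟩, h4]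
      · rw [if_neg h3, tA κ i' hi']
        by_cases h4 : i' = i
        · subst h4
          rw [if_pos rfl, if_neg (lt_irrefl i'), if_neg fun h => h3 (by rw [h.1]), add_zero]
        · rw [if_neg h4]
    have hnocross : ¬ (D.cnt k (D.key k) < 2 ^ i ∧ 2 ^ i ≤ D.cnt k (D.key k) + D.mult k) →
        ∀ κ i', 2 ^ i' ≤ D.U → t.arr 10 (κ * (D.U + 1) + 2 ^ i') =
          (D.active (if i' ≤ i then k + 1 else k) κ (2 ^ i')).card := by
      intro h1 κ i' hi'
      have := hstep κ i' hi'
      simp only [Nat.lt_succ_iff] at this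
      rw [this, tA κ i' hi']
      by_cases h2 : i' = i
      · subst h2
        rw [if_pos rfl, if_neg (lt_irrefl i'), if_neg fun h => h1 h.2, add_zero]
      · rw [if_neg h2]
    simp only [thresholdStep, wp, Expr.Fits, Expr.val, Op.eval, t2, t6, t10, t11, t12, t13,
      State.reg_setReg, State.reg_setArr, State.arr_setReg, State.arr_setArr]
    simp [hact]
    refine ⟨⟨⟨by omega, hB, by omega⟩, by split_ifs <;> omega⟩, fun h1 h2 => ⟨⟨⟨⟨hB, by omega⟩,
      by omega⟩, by omega⟩, ⟨⟨by omega, by omega⟩, by omega, hB, by omega⟩, fun h3 => ⟨by omega,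
      fun h4 => ⟨by omega, ⟨hB, by omega⟩, by omega, ?_, ?_, ?_, hpow, hcross h1 h2⟩,
      fun h4 => ⟨⟨hB, by omega⟩, by omega, ?_, ?_, ?_, hpow, hcross h1 h2⟩⟩,
      fun h3 => ⟨⟨hB, by omega⟩, by omega, ?_, ?_, ?_, hpow, hcross h1 h2⟩⟩,
      fun h => ⟨by omega, ?_, harr, ?_, hpow, hnocross (by omega)⟩⟩
    · intro x h12 h13 h14; simp [h12, h13, h14, hreg x h12 h13 h14]
    · intro a ha; simp [ha, harr a ha]
    · rw [Scan.lower, if_pos ⟨h2, h1, h3⟩]; omega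
    · intro x h12 h13 h14; simp [h13, h14, hreg x h12 h13 h14]
    · intro a ha; simp [ha, harr a ha]
    · rw [Scan.lower, if_pos ⟨h2, h1, h3⟩]; omega
    · intro x h12 h13 h14; simp [h13, h14, hreg x h12 h13 h14]
    · intro a ha; simp [ha, harr a ha]
    · rw [Scan.lower, if_neg fun hb => absurd hb.2.2 (by omega)]
    · intro x h12 h13 h14; simp [h13, hreg x h12 h13 h14]
    · rw [Scan.lower, if_neg fun hb => absurd (h hb.2.1) (not_le.2 hb.1)]
  · rintro t ⟨hreg, harr, t12, t13, tA⟩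
    have t2 := (hreg 2 (by decide) (by decide) (by decide)).trans s2
    have hT : D.U < 2 ^ D.U.size := Nat.lt_size_self _
    refine ⟨?_, ?_, hreg, harr, t12, fun κ i hi => ?_⟩
    · simp [Expr.Fits, Expr.val, t2]; omega
    · simp [Expr.val, Op.eval, t2, t13]; omega
    · rw [tA κ i hi, if_pos (Nat.lt_size.2 hi)]

end WordRAM

theorem Scan.emit_le (D : Scan) (k : ℕ) : D.emit k ≤ D.mult k := by
  rw [Scan.emit]; omega

theorem Scan.cnt_le (D : Scan) (k v : ℕ) : D.cnt k v ≤ ∑ l ∈ Finset.range k, D.mult l :=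
  Finset.sum_le_sum fun l _ => by split_ifs <;> omega

theorem Scan.lim_key_succ (D : Scan) (k : ℕ) :
    D.lim (k + 1) (D.key k) = D.lower k (D.lim k (D.key k)) D.U.size := by
  rw [Scan.lim, if_pos rfl]

/-- The number of copies selected in the first `k` steps of a scan. -/
noncomputable def Scan.offset (D : Scan) (k : ℕ) : ℕ := ∑ l ∈ Finset.range k, D.emit l

theorem Scan.offset_succ (D : Scan) (k : ℕ) : D.offset (k + 1) = D.offset k + D.emit k :=
  Finset.sum_range_succ _ _

theorem Scan.offset_mono (D : Scan) : Monotone D.offset :=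
  monotone_nat_of_le_succ fun k => by rw [D.offset_succ]; omega

theorem Scan.offset_le (D : Scan) (k : ℕ) : D.offset k ≤ ∑ l ∈ Finset.range k, D.mult l :=
  Finset.sum_le_sum fun l _ => D.emit_le l

namespace WordRAM

/-- Registers 4 to 9 receive the position of the item to be scanned in step number register 3,
the side, the number of copies, the item, its weight and its key. -/
def loadProg : Program :=
  .branch (.reg 3 <ₑ .reg 0)
    (.set 4 (.reg 0 -ₑ .lit 1 -ₑ .reg 3) ;; .set 5 (.lit 0) ;; .set 6 (.get 5 (.reg 4)))
    (.set 4 (.reg 3 -ₑ .reg 0) ;; .set 5 (.lit 1) ;;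
      .set 6 (.get 7 (.reg 4) -ₑ .get 5 (.reg 4))) ;;
  .set 7 (.get 3 (.reg 4)) ;;
  .set 8 (.get 6 (.reg 4)) ;;
  .set 9 (.lit 2 *ₑ .reg 8 +ₑ .reg 5) ;;
  .set 10 (.lit 1)

/-- Register 10 becomes the largest power of two that is at most the weight. -/
def classLoop : Program :=
  .loop (.reg 10 +ₑ .reg 10 <ₑ .reg 8 +ₑ .lit 1) (.set 10 (.reg 10 +ₑ .reg 10))

/-- Registers 10 to 13 receive the class of the key, the number of copies and the limit for the
key, and the first threshold. Array 9 holds the difference of register 2 and the limits, so that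
its initial value is right. -/
def lookupProg : Program :=
  .set 10 (.lit 2 *ₑ .reg 10 +ₑ .reg 5) ;;
  .set 11 (.get 8 (.reg 9)) ;;
  .set 12 (.reg 2 -ₑ .get 9 (.reg 9)) ;;
  .set 13 (.lit 1)

/-- The new limit and number of copies are stored, and registers 15 to 17 receive the number of
copies to be selected, the first of them, and 0. -/
def storeProg : Program :=
  .put 9 (.reg 9) (.reg 2 -ₑ .reg 12) ;;
  .put 8 (.reg 9) (.reg 11 +ₑ .reg 6) ;;
  .branch (.reg 11 +ₑ .reg 6 <ₑ .reg 12) (.set 15 (.reg 6)) (.set 15 (.reg 12 -ₑ .reg 11)) ;;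
  .branch (.reg 5) (.set 16 (.get 5 (.reg 4))) (.set 16 (.reg 6 -ₑ .reg 15)) ;;
  .set 17 (.lit 0)

/-- The selected copies of the current item are written to arrays 0 and 1. -/
def emitLoop : Program :=
  .loop (.reg 17 <ₑ .reg 15)
    (.put 0 (.reg 18) (.reg 7) ;;
      .put 1 (.reg 18) (.reg 16 +ₑ .reg 17) ;;
      .set 18 (.reg 18 +ₑ .lit 1) ;;
      .set 17 (.reg 17 +ₑ .lit 1))

/-- One step of the scan. -/
def scanStep : Program :=
  loadProg ;; classLoop ;; lookupProg ;;
  .loop (.reg 13 <ₑ .reg 2 +ₑ .lit 1) thresholdStep ;;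
  storeProg ;; emitLoop ;;
  .set 3 (.reg 3 +ₑ .lit 1)

/-- The scan of both sides of the greedy solution. -/
def scanProg : Program :=
  (.set 3 (.lit 0) ;; .set 18 (.lit 0)) ;;
  .loop (.reg 3 <ₑ .reg 0 +ₑ .reg 0) scanStep ;;
  .set 0 (.reg 18)

/-- The items in the order of efficiency have the weights `w`, the multiplicities `m` and the
numbers `take` of copies in the greedy solution; all these numbers are at most `N`, and words hold
more than `16 * N ^ 2` values. -/
structure ScanData (B N n U : ℕ) (w m take : ℕ → ℕ) : Prop where
  two_le : 2 ≤ N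
  lt : 16 * (N * N) < B
  n_le : n ≤ N
  U_le : U ≤ N
  w_pos : ∀ q < n, 0 < w q
  w_le : ∀ q < n, w q ≤ U
  take_le : ∀ q < n, take q ≤ m q
  m_le : ∀ q < n, m q ≤ N
  sum_le : ∑ l ∈ Finset.range (2 * n), (twoSidedScan n U w m take).mult l ≤ N

/-- The arrays 0 and 1 hold the copies selected in the first `k` steps, and the first `r` copies
selected in the next step. -/
def OutputInv (D : Scan) (n : ℕ) (X take : ℕ → ℕ) (k r : ℕ) (t : State) : Prop :=
  t.reg 18 = D.offset k + r ∧
    (∀ l < k, ∀ j < D.emit l, t.arr 0 (D.offset l + j) = X (scanPos n l) ∧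
      t.arr 1 (D.offset l + j) = scanStart D n take l + j) ∧
    ∀ j < r, t.arr 0 (D.offset k + j) = X (scanPos n k) ∧
      t.arr 1 (D.offset k + j) = scanStart D n take k + j

/-- The arrays 3, 5, 6 and 7 hold the order of the items and the data of the scan. -/
def DataInv (n U : ℕ) (X w m take : ℕ → ℕ) (t : State) : Prop :=
  t.reg 0 = n ∧ t.reg 2 = U ∧ t.arr 3 = X ∧ t.arr 5 = take ∧ t.arr 6 = w ∧ t.arr 7 = m

/-- The arrays 8, 9 and 10 hold the state of the scan after `k` steps. -/
def TableInv (D : Scan) (k : ℕ) (t : State) : Prop :=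
  (∀ v, t.arr 8 v = D.cnt k v) ∧ (∀ v, D.U - t.arr 9 v = D.lim k v) ∧
    ∀ κ i, 2 ^ i ≤ D.U → t.arr 10 (κ * (D.U + 1) + 2 ^ i) = (D.active k κ (2 ^ i)).card

theorem OutputInv.succ {D : Scan} {n k : ℕ} {X take : ℕ → ℕ} {t : State}
    (h : OutputInv D n X take k (D.emit k) t) : OutputInv D n X take (k + 1) 0 t := by
  refine ⟨by rw [h.1, D.offset_succ, add_zero], fun l hl => ?_, by simp⟩
  rcases Nat.lt_succ_iff_lt_or_eq.1 hl with hl | rfl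
  · exact h.2.1 l hl
  · exact h.2.2

theorem OutputInv.congr {D : Scan} {n k r : ℕ} {X take : ℕ → ℕ} {t t' : State}
    (h : OutputInv D n X take k r t) (h18 : t'.reg 18 = t.reg 18) (h0 : t'.arr 0 = t.arr 0)
    (h1 : t'.arr 1 = t.arr 1) : OutputInv D n X take k r t' := by
  simpa [OutputInv, h18, h0, h1] using h

theorem TableInv.congr {D : Scan} {k : ℕ} {t t' : State} (h : TableInv D k t)
    (h8 : t'.arr 8 = t.arr 8) (h9 : t'.arr 9 = t.arr 9) (h10 : t'.arr 10 = t.arr 10) :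
    TableInv D k t' := by
  simpa [TableInv, h8, h9, h10] using h

theorem DataInv.congr {n U : ℕ} {X w m take : ℕ → ℕ} {t t' : State}
    (h : DataInv n U X w m take t) (h0 : t'.reg 0 = t.reg 0) (h2 : t'.reg 2 = t.reg 2)
    (h3 : t'.arr 3 = t.arr 3) (h5 : t'.arr 5 = t.arr 5) (h6 : t'.arr 6 = t.arr 6)
    (h7 : t'.arr 7 = t.arr 7) : DataInv n U X w m take t' := by
  simpa [DataInv, h0, h2, h3, h5, h6, h7] using h

/-- The registers 3 to 9 describe step `k` of the scan. -/
def LoadInv (D : Scan) (n : ℕ) (X w : ℕ → ℕ) (k : ℕ) (t : State) : Prop :=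
  t.reg 3 = k ∧ t.reg 4 = scanPos n k ∧ t.reg 5 = (if k < n then 0 else 1) ∧
    t.reg 6 = D.mult k ∧ t.reg 7 = X (scanPos n k) ∧ t.reg 8 = w (scanPos n k) ∧
    t.reg 9 = D.key k

namespace ScanData

variable {B N n U k : ℕ} {w m take X : ℕ → ℕ}

theorem lin (h : ScanData B N n U w m take) : 32 * N < B := by
  have h1 := h.lt
  have h2 := Nat.mul_le_mul_right N h.two_le
  omega

theorem scanPos_lt (hk : k < 2 * n) : scanPos n k < n := by
  rw [scanPos]; split_ifs <;> omega

theorem key_eq : (twoSidedScan n U w m take).key k =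
    2 * w (scanPos n k) + if k < n then 0 else 1 := by
  simp only [twoSidedScan, scanPos]; split_ifs <;> rfl

theorem cls_key_eq : (twoSidedScan n U w m take).cls ((twoSidedScan n U w m take).key k) =
    2 * 2 ^ Nat.log 2 (w (scanPos n k)) + if k < n then 0 else 1 := by
  rw [key_eq]
  simp only [twoSidedScan]
  split_ifs
  · rw [show (2 * w (scanPos n k) + 0) / 2 = w (scanPos n k) by omega]; omega
  · rw [show (2 * w (scanPos n k) + 1) / 2 = w (scanPos n k) by omega]; omega

theorem cnt_add_le (h : ScanData B N n U w m take) (hk : k < 2 * n) (v : ℕ) :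
    (twoSidedScan n U w m take).cnt k v + (twoSidedScan n U w m take).mult k ≤ N := by
  have h1 := (twoSidedScan n U w m take).cnt_le k v
  have h2 := Finset.sum_le_sum_of_subset (f := (twoSidedScan n U w m take).mult)
    (Finset.range_mono (show k + 1 ≤ 2 * n from hk))
  have h3 := h.sum_le
  rw [Finset.sum_range_succ] at h2
  omega

theorem offset_add_le (h : ScanData B N n U w m take) (hk : k < 2 * n) :
    (twoSidedScan n U w m take).offset k + (twoSidedScan n U w m take).emit k ≤ N := by
  rw [← Scan.offset_succ]
  exact ((twoSidedScan n U w m take).offset_le _).trans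
    ((Finset.sum_le_sum_of_subset (Finset.range_mono (show k + 1 ≤ 2 * n from hk))).trans h.sum_le)

theorem scanStart_add_le (h : ScanData B N n U w m take) (hk : k < 2 * n) :
    scanStart (twoSidedScan n U w m take) n take k + (twoSidedScan n U w m take).emit k ≤ N := by
  have h1 := (twoSidedScan n U w m take).emit_le k
  have h2 := h.take_le _ (scanPos_lt hk)
  have h3 := h.m_le _ (scanPos_lt hk)
  simp only [twoSidedScan] at h1
  simp only [scanStart, scanPos, twoSidedScan] at *
  split_ifs at * <;> omega

end ScanData

variable {B N n U k : ℕ} {w m take X : ℕ → ℕ} {s : State}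

local notation "𝒟" => twoSidedScan n U w m take

theorem runs_loadProg (h : ScanData B N n U w m take) (hk : k < 2 * n)
    (hdat : DataInv n U X w m take s) (s3 : s.reg 3 = k) :
    Runs B loadProg s loadProg.time fun t => LoadInv 𝒟 n X w k t ∧ t.reg 10 = 1 ∧
      t.reg 0 = s.reg 0 ∧ t.reg 2 = s.reg 2 ∧ t.reg 18 = s.reg 18 ∧ t.arr = s.arr := by
  have hlin := h.lin
  have htwo := h.two_le
  have hB : 1 < B := by omega
  have hwU := h.w_le _ (ScanData.scanPos_lt hk)
  have hU := h.U_le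
  have hn := h.n_le
  obtain ⟨s0, s2, a3, a5, a6, a7⟩ := hdat
  refine Runs.of_wp hB le_rfl ?_
  have hpos : scanPos n k = if k < n then n - 1 - k else k - n := rfl
  by_cases hkn : k < n
  · rw [if_pos hkn] at hpos
    rw [hpos] at hwU
    simp [loadProg, wp, Expr.Fits, Expr.val, Op.eval, s0, s3, a3, a5, a6, a7, hkn, LoadInv,
      hpos, twoSidedScan]
    omega
  · rw [if_neg hkn] at hpos
    rw [hpos] at hwU
    simp [loadProg, wp, Expr.Fits, Expr.val, Op.eval, s0, s3, a3, a5, a6, a7, hkn, LoadInv,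
      hpos, twoSidedScan]
    omega

theorem runs_classLoop (h : ScanData B N n U w m take) {v : ℕ} (hv : 0 < v) (hvN : v ≤ N)
    (s8 : s.reg 8 = v) (s10 : s.reg 10 = 1) :
    Runs B classLoop s (20 * (Nat.log 2 v + 1)) fun t => t = s.setReg 10 (2 ^ Nat.log 2 v) := by
  have hlin := h.lin
  have htwo := h.two_le
  have hB : 1 < B := by omega
  refine Runs.weaken (T := ∑ i ∈ Finset.range (Nat.log 2 v), 4 + (Nat.log 2 v + 1) * 8) ?_ (by
    rw [Finset.sum_const, Finset.card_range, smul_eq_mul]; omega) fun _ h => h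
  have hlog : 2 ^ Nat.log 2 v ≤ v := Nat.pow_log_le_self 2 hv.ne'
  refine Runs.loop hB (K := Nat.log 2 v) (fun i t => t = s.setReg 10 (2 ^ i)) ?_ ?_ ?_
  · cases s
    simp only [State.setReg, pow_zero] at s10 ⊢
    rw [← s10, Function.update_eq_self]
  · rintro i t hi rfl
    have h1 : 2 ^ (i + 1) ≤ v := (Nat.pow_le_pow_right (by norm_num) hi).trans hlog
    have h2 : 2 ^ i + 2 ^ i = 2 ^ (i + 1) := by rw [pow_succ]; omega
    refine ⟨?_, ?_, Runs.of_wp hB (by decide) ?_⟩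
    · simp [Expr.Fits, Expr.val, s8]; omega
    · simp [Expr.val, Op.eval, s8]; omega
    · simp [wp, Expr.Fits, Expr.val, Op.eval, h2]; omega
  · rintro t rfl
    have h1 : v < 2 ^ (Nat.log 2 v + 1) := Nat.lt_pow_succ_log_self (by norm_num) v
    have h2 : 2 ^ Nat.log 2 v + 2 ^ Nat.log 2 v = 2 ^ (Nat.log 2 v + 1) := by rw [pow_succ]; omega
    refine ⟨?_, ?_, rfl⟩
    · simp [Expr.Fits, Expr.val, s8]; omega
    · simp [Expr.val, Op.eval, s8]; omega

theorem runs_emitLoop (h : ScanData B N n U w m take) (hk : k < 2 * n)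
    (s7 : s.reg 7 = X (scanPos n k)) (s15 : s.reg 15 = (𝒟).emit k)
    (s16 : s.reg 16 = scanStart 𝒟 n take k) (s17 : s.reg 17 = 0)
    (hout : OutputInv 𝒟 n X take k 0 s) :
    Runs B emitLoop s (30 * ((𝒟).emit k + 1)) fun t => t.reg 0 = s.reg 0 ∧ t.reg 2 = s.reg 2 ∧
      t.reg 3 = s.reg 3 ∧ (∀ a, a ≠ 0 → a ≠ 1 → t.arr a = s.arr a) ∧
      OutputInv 𝒟 n X take k ((𝒟).emit k) t := by
  have hlin := h.lin
  have htwo := h.two_le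
  have hB : 1 < B := by omega
  have hoff := h.offset_add_le hk
  have hstart := h.scanStart_add_le hk
  refine Runs.weaken (T := ∑ i ∈ Finset.range ((𝒟).emit k), 20 + ((𝒟).emit k + 1) * 4) ?_ (by
    rw [Finset.sum_const, Finset.card_range, smul_eq_mul]; omega) fun _ h => h
  refine Runs.loop hB (K := (𝒟).emit k) (fun r t => (t.reg 0 = s.reg 0 ∧ t.reg 2 = s.reg 2 ∧
      t.reg 3 = s.reg 3 ∧ (∀ a, a ≠ 0 → a ≠ 1 → t.arr a = s.arr a) ∧
      OutputInv 𝒟 n X take k r t) ∧ t.reg 7 = s.reg 7 ∧ t.reg 15 = s.reg 15 ∧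
      t.reg 16 = s.reg 16 ∧ t.reg 17 = r)
    ⟨⟨rfl, rfl, rfl, fun _ _ _ => rfl, hout⟩, rfl, rfl, rfl, s17⟩ ?_ ?_
  · rintro r t hr ⟨⟨t0, t2, t3, ta, t18, hdone, hdone'⟩, t7, t15, t16, t17⟩
    rw [s7] at t7
    rw [s15] at t15
    rw [s16] at t16
    refine ⟨by simp [Expr.Fits], by simp [Expr.val, Op.eval, t15, t17, hr],
      Runs.of_wp hB (by decide) ?_⟩
    simp [wp, Expr.Fits, Expr.val, Op.eval, t0, t2, t3, t7, t15, t16, t17, t18, s7, s15, s16,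
      OutputInv]
    refine ⟨by omega, ⟨hB, by omega⟩, by omega, ?_, by omega, ?_, ?_⟩
    · intro a h0 h1
      simp [h0, h1, ta a h0 h1]
    · intro l hl j hj
      have h1 := (𝒟).offset_mono (show l + 1 ≤ k from hl)
      rw [Scan.offset_succ] at h1
      rw [Function.update_of_ne (by omega), Function.update_of_ne (by omega)]
      exact hdone l hl j hj
    · intro j hj
      rcases Nat.lt_succ_iff_lt_or_eq.1 (Nat.lt_succ_of_le hj) with hj' | rfl
      · rw [Function.update_of_ne (by omega), Function.update_of_ne (by omega)]
        exact hdone' j hj'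
      · simp
  · rintro t ⟨hI, t7, t15, t16, t17⟩
    exact ⟨by simp [Expr.Fits], by simp [Expr.val, Op.eval, t15, t17, s15], hI⟩

/-- The number of steps for the `k`-th step of the scan. -/
noncomputable def scanStepTime (D : Scan) (k : ℕ) : ℕ :=
  loadProg.time + lookupProg.time + storeProg.time + 30 + 100 * (D.U.size + 1) + 30 * D.emit k

/-- One step of the scan takes constant time for each threshold and for each selected copy. -/
theorem runs_scanStep (h : ScanData B N n U w m take) (hk : k < 2 * n)
    (hdat : DataInv n U X w m take s) (htab : TableInv 𝒟 k s) (s3 : s.reg 3 = k)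
    (hout : OutputInv 𝒟 n X take k 0 s) :
    Runs B scanStep s (scanStepTime 𝒟 k) fun t => DataInv n U X w m take t ∧
      TableInv 𝒟 (k + 1) t ∧ t.reg 3 = k + 1 ∧ OutputInv 𝒟 n X take (k + 1) 0 t := by
  have hlin := h.lin
  have htwo := h.two_le
  have hB : 1 < B := by omega
  have hposn := ScanData.scanPos_lt hk
  have hw0 := h.w_pos _ hposn
  have hwU := h.w_le _ hposn
  have hUN := h.U_le
  have hnN := h.n_le
  have hcx := h.cnt_add_le hk ((𝒟).key k)
  have hcls := ScanData.cls_key_eq (n := n) (U := U) (w := w) (m := m) (take := take) (k := k)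
  have hlog : 2 ^ Nat.log 2 (w (scanPos n k)) ≤ w (scanPos n k) := Nat.pow_log_le_self 2 hw0.ne'
  have hsize : Nat.log 2 (w (scanPos n k)) + 1 ≤ U.size :=
    Nat.lt_size.2 (hlog.trans hwU)
  have hside : (if k < n then 0 else 1 : ℕ) ≤ 1 := by split_ifs <;> omega
  refine Runs.weaken (T := loadProg.time + (20 * (Nat.log 2 (w (scanPos n k)) + 1) +
    (lookupProg.time + (80 * ((𝒟).U.size + 1) + (storeProg.time +
    (30 * ((𝒟).emit k + 1) + 4)))))) ?_ (by
      have : (𝒟).U = U := rfl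
      rw [scanStepTime, this]; omega) fun _ h => h
  refine Runs.seq ((runs_loadProg h hk hdat s3).weaken le_rfl
    fun t₁ ⟨⟨l3, l4, l5, l6, l7, l8, l9⟩, l10, l0, l2, l18, larr⟩ => ?_)
  refine Runs.seq ((runs_classLoop h hw0 (hwU.trans hUN) l8 l10).weaken le_rfl fun t₂ ht₂ => ?_)
  refine Runs.seq ((Runs.of_wp hB (Q := fun t => LoadInv 𝒟 n X w k t ∧ t.reg 0 = s.reg 0 ∧
    t.reg 2 = s.reg 2 ∧ t.reg 18 = s.reg 18 ∧ t.arr = s.arr ∧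
    t.reg 10 = (𝒟).cls ((𝒟).key k) ∧ t.reg 11 = (𝒟).cnt k ((𝒟).key k) ∧
    t.reg 12 = (𝒟).lim k ((𝒟).key k) ∧ t.reg 13 = 1) le_rfl ?_).weaken le_rfl
    fun t₃ ⟨hload, m0, m2, m18, marr, m10, m11, m12, m13⟩ => ?_)
  · subst ht₂
    have hl := htab.2.1 ((𝒟).key k)
    have hU : (𝒟).U = U := rfl
    rw [hU] at hl
    simp [lookupProg, wp, Expr.Fits, Expr.val, Op.eval, l0, l2, l3, l4, l5, l6, l7, l8, l9, l18,
      larr, LoadInv, hcls, htab.1, hdat.2.1, hl]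
    refine ⟨⟨⟨by omega, by omega⟩, by omega⟩, hB⟩
  obtain ⟨m3, m4, m5, m6, m7, m8, m9⟩ := hload
  refine Runs.seq ((runs_thresholdLoop (D := 𝒟) (k := k) htwo h.lt hUN (by omega)
    (by rw [hcls]; omega) hcx (by rw [m2]; exact hdat.2.1) m6 m10 m11 m12 m13
    (by rw [marr]; exact htab.2.2)).weaken le_rfl fun t₄ ⟨hreg, harr, n12, n10⟩ => ?_)
  rw [← Scan.lim_key_succ] at n12
  have n0 := (hreg 0 (by decide) (by decide) (by decide)).trans (m0.trans hdat.1)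
  have n2 := (hreg 2 (by decide) (by decide) (by decide)).trans (m2.trans hdat.2.1)
  have n3 := (hreg 3 (by decide) (by decide) (by decide)).trans m3
  have n4 := (hreg 4 (by decide) (by decide) (by decide)).trans m4
  have n5 := (hreg 5 (by decide) (by decide) (by decide)).trans m5
  have n6 := (hreg 6 (by decide) (by decide) (by decide)).trans m6
  have n7 := (hreg 7 (by decide) (by decide) (by decide)).trans m7
  have n9 := (hreg 9 (by decide) (by decide) (by decide)).trans m9
  have n11 := (hreg 11 (by decide) (by decide) (by decide)).trans m11
  have n18 := (hreg 18 (by decide) (by decide) (by decide)).trans m18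
  have narr : ∀ a, a ≠ 10 → t₄.arr a = s.arr a := fun a ha => by rw [harr a ha, marr]
  have hlimU : (𝒟).lim (k + 1) ((𝒟).key k) ≤ U := (𝒟).lim_le _ _
  refine Runs.seq ((Runs.of_wp hB (Q := fun t => DataInv n U X w m take t ∧
    TableInv 𝒟 (k + 1) t ∧ t.reg 3 = k ∧ t.reg 7 = X (scanPos n k) ∧
    t.reg 15 = (𝒟).emit k ∧ t.reg 16 = scanStart 𝒟 n take k ∧ t.reg 17 = 0 ∧
    t.reg 18 = s.reg 18 ∧ t.arr 0 = s.arr 0 ∧ t.arr 1 = s.arr 1) le_rfl ?_).weaken le_rfl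
    fun t₅ ⟨p1, p2, p3, p7, p15, p16, p17, p18, pa0, pa1⟩ => ?_)
  · have h8 : ∀ v, Function.update (s.arr 8) ((𝒟).key k)
        ((𝒟).cnt k ((𝒟).key k) + (𝒟).mult k) v = (𝒟).cnt (k + 1) v := by
      intro v
      rw [Function.update_apply, Scan.cnt_succ]
      by_cases hv : v = (𝒟).key k
      · rw [if_pos hv, if_pos hv.symm, hv]
      · rw [if_neg hv, if_neg (Ne.symm hv), add_zero, htab.1]
    have h9 : ∀ v, U - Function.update (s.arr 9) ((𝒟).key k)
        (U - (𝒟).lim (k + 1) ((𝒟).key k)) v = (𝒟).lim (k + 1) v := by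
      intro v
      rw [Function.update_apply]
      by_cases hv : v = (𝒟).key k
      · rw [if_pos hv, hv]; omega
      · rw [if_neg hv, Scan.lim, if_neg (Ne.symm hv)]
        exact htab.2.1 v
    have htable : ∀ u : State, u.arr 8 = Function.update (s.arr 8) ((𝒟).key k)
        ((𝒟).cnt k ((𝒟).key k) + (𝒟).mult k) → u.arr 9 = Function.update (s.arr 9) ((𝒟).key k)
        (U - (𝒟).lim (k + 1) ((𝒟).key k)) → u.arr 10 = t₄.arr 10 → TableInv 𝒟 (k + 1) u :=
      fun u e8 e9 e10 => ⟨by rw [e8]; exact h8, by rw [e9]; exact h9, by rw [e10]; exact n10⟩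
    have hemit : (𝒟).emit k = min ((𝒟).cnt k ((𝒟).key k) + (𝒟).mult k)
      ((𝒟).lim (k + 1) ((𝒟).key k)) - (𝒟).cnt k ((𝒟).key k) := rfl
    have hstart : scanStart 𝒟 n take k = if k < n then (𝒟).mult k - (𝒟).emit k
        else take (scanPos n k) := by
      simp only [scanStart, scanPos, twoSidedScan]; split_ifs <;> rfl
    obtain ⟨-, -, d3, d5, d6, d7⟩ := hdat
    have hdata : ∀ u : State, u.reg 0 = n → u.reg 2 = U → u.arr 3 = s.arr 3 →
        u.arr 5 = s.arr 5 → u.arr 6 = s.arr 6 → u.arr 7 = s.arr 7 → DataInv n U X w m take u :=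
      fun u e0 e2 e3 e5 e6 e7 => ⟨e0, e2, e3.trans d3, e5.trans d5, e6.trans d6, e7.trans d7⟩
    by_cases hkn : k < n <;>
      simp only [storeProg, wp, Expr.Fits, Expr.val, Op.eval, n2, n3, n4, n5, n6, n7, n9, n11,
        n12, n18, State.reg_setReg, State.reg_setArr, State.arr_setReg, State.arr_setArr, hkn,
        if_true, if_false, narr 5 (by decide), d5] <;>
      simp [hkn, hstart] <;>
      refine ⟨by omega, fun hlt => ⟨by omega, ?_, ?_, ?_⟩, fun hle => ⟨by omega, ?_, ?_, ?_⟩⟩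
    any_goals apply hdata <;> simp [n0, n2, narr]
    any_goals apply htable <;> simp [narr]
    all_goals
      rw [narr 0 (by decide), narr 1 (by decide)]
      simp only [and_self, and_true]
      omega
  refine Runs.seq ((runs_emitLoop (X := X) h hk p7 p15 p16 p17 (hout.congr p18 pa0 pa1)).weaken
    le_rfl fun t₆ ⟨q0, q2, q3, qa, qout⟩ => Runs.of_wp hB (by decide) ?_)
  simp only [wp, Expr.Fits, Expr.val, Op.eval, q3, p3]
  refine ⟨⟨trivial, hB, by omega⟩, ?_, ?_, by simp, ?_⟩
  · exact p1.congr q0 q2 (qa 3 (by decide) (by decide)) (qa 5 (by decide) (by decide))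
      (qa 6 (by decide) (by decide)) (qa 7 (by decide) (by decide))
  · exact p2.congr (qa 8 (by decide) (by decide)) (qa 9 (by decide) (by decide))
      (qa 10 (by decide) (by decide))
  · exact (qout.congr rfl rfl rfl).succ

end WordRAM

/-! ### The scan covers the symmetric difference -/

namespace BoundedKnapsack

variable {I : BoundedKnapsack}

theorem rank_lt (i : Fin I.n) : I.rank i < I.n := by
  classical
  have h : (Finset.univ.filter fun j => I.Precedes j i) ⊂ Finset.univ :=
    Finset.filter_ssubset.2 ⟨i, Finset.mem_univ i, I.not_precedes_self i⟩
  simpa [rank] using Finset.card_lt_card h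

theorem exists_rank_eq {q : ℕ} (hq : q < I.n) : ∃ i, I.rank i = q := by
  have hinj : Function.Injective fun i : Fin I.n => (⟨I.rank i, rank_lt i⟩ : Fin I.n) :=
    fun i j h => I.rank_injective (congrArg Fin.val h)
  obtain ⟨i, hi⟩ := Finite.injective_iff_surjective.1 hinj ⟨q, hq⟩
  exact ⟨i, congrArg Fin.val hi⟩

theorem card_copies_between (i : Fin I.n) {a b : ℕ} (hb : b ≤ I.m i) :
    (Finset.univ.filter fun x : I.Copy => x.1 = i ∧ a ≤ (x.2 : ℕ) ∧ (x.2 : ℕ) < b).card =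
      b - a := by
  rw [← Nat.card_Ico]
  refine Finset.card_bij (fun x _ => (x.2 : ℕ)) ?_ ?_ ?_
  · intro x hx
    simpa using (Finset.mem_filter.1 hx).2.2
  · rintro ⟨k, c⟩ hx ⟨l, d⟩ hy hxy
    have hk : k = i := (Finset.mem_filter.1 hx).2.1
    have hl : l = i := (Finset.mem_filter.1 hy).2.1
    subst hk hl
    obtain rfl : c = d := Fin.ext hxy
    rfl
  · intro c hc
    rw [Finset.mem_Ico] at hc
    exact ⟨⟨i, ⟨c, by omega⟩⟩, by simpa using hc, rfl⟩

/-- The functions `w`, `m` and `take` describe the items in the order of decreasing efficiency,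
and `take` describes the greedy solution. -/
structure Layout (I : BoundedKnapsack) (w m take : ℕ → ℕ) : Prop where
  w_rank : ∀ i, w (I.rank i) = I.w i
  m_rank : ∀ i, m (I.rank i) = I.m i
  take_le : ∀ i, take (I.rank i) ≤ I.m i
  mem_greedy : ∀ x : I.Copy, x ∈ I.greedy ↔ (x.2 : ℕ) < take (I.rank x.1)

open Classical in
/-- The step of the two-sided scan in which a copy is scanned. -/
noncomputable def scanStep (x : I.Copy) : ℕ :=
  if x ∈ I.greedy then I.n - 1 - I.rank x.1 else I.n + I.rank x.1

theorem scanStep_lt (x : I.Copy) : scanStep x < 2 * I.n := by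
  have := rank_lt x.1
  rw [scanStep]; split_ifs <;> omega

theorem scanStep_lt_n {x : I.Copy} : scanStep x < I.n ↔ x ∈ I.greedy := by
  have := rank_lt x.1
  rw [scanStep]; split_ifs with h <;> simp only [h, iff_true, iff_false] <;> omega

theorem scanPos_scanStep (x : I.Copy) : scanPos I.n (scanStep x) = I.rank x.1 := by
  have := rank_lt x.1
  rw [scanPos, scanStep]; split_ifs <;> omega

namespace Layout

variable {w m take : ℕ → ℕ} {U : ℕ}

local notation "𝒟" => twoSidedScan I.n U w m take

theorem key_scanStep (h : Layout I w m take) (x : I.Copy) :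
    (𝒟).key (scanStep x) = 2 * I.w x.1 + if x ∈ I.greedy then 0 else 1 := by
  classical
  rw [WordRAM.ScanData.key_eq, scanPos_scanStep, h.w_rank]
  simp only [scanStep_lt_n]

/-- Step `l` of the scan has as many copies as the model prescribes. -/
theorem card_scanStep_eq (h : Layout I w m take) {l : ℕ} (hl : l < 2 * I.n) :
    (Finset.univ.filter fun x : I.Copy => scanStep x = l).card = (𝒟).mult l := by
  obtain ⟨i, hi⟩ := exists_rank_eq (WordRAM.ScanData.scanPos_lt hl)
  have hiff : ∀ x : I.Copy, scanStep x = l ↔ x.1 = i ∧ (x ∈ I.greedy ↔ l < I.n) := by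
    intro x
    constructor
    · rintro rfl
      refine ⟨I.rank_injective ?_, scanStep_lt_n.symm⟩
      rw [hi, scanPos_scanStep]
    · rintro ⟨rfl, hx⟩
      have := rank_lt x.1
      rw [scanPos] at hi
      by_cases hg : x ∈ I.greedy
      · have := hx.1 hg
        rw [if_pos this] at hi
        rw [scanStep, if_pos hg]; omega
      · have : ¬ l < I.n := fun h => hg (hx.2 h)
        rw [if_neg this] at hi
        rw [scanStep, if_neg hg]; omega
  simp only [hiff, h.mem_greedy]
  by_cases hln : l < I.n
  · rw [scanPos, if_pos hln] at hi
    have e : (𝒟).mult l = take (I.rank i) - 0 := by simp [twoSidedScan, hln, hi]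
    rw [e, ← card_copies_between i (h.take_le i)]
    congr 1
    ext x
    simp only [Finset.mem_filter, Finset.mem_univ, true_and, hln, iff_true, Nat.zero_le]
    exact and_congr_right fun hx => by rw [congrArg I.rank hx]
  · rw [scanPos, if_neg hln] at hi
    have e : (𝒟).mult l = I.m i - take (I.rank i) := by
      simp [twoSidedScan, hln, ← hi, h.m_rank]
    rw [e, ← card_copies_between i le_rfl]
    congr 1
    ext x
    simp only [Finset.mem_filter, Finset.mem_univ, true_and, hln, iff_false, not_lt]
    refine and_congr_right fun hx => ?_
    subst hx
    exact ⟨fun h1 => ⟨h1, x.2.2⟩, fun h1 => h1.1⟩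

theorem cnt_eq (h : Layout I w m take) {k : ℕ} (hk : k ≤ 2 * I.n) (v : ℕ) :
    (𝒟).cnt k v = (Finset.univ.filter fun x : I.Copy =>
      scanStep x < k ∧ (𝒟).key (scanStep x) = v).card := by
  rw [Finset.card_eq_sum_card_fiberwise (f := scanStep) (t := Finset.range k)]
  · refine Finset.sum_congr rfl fun l hl => ?_
    have hl' := Finset.mem_range.1 hl
    split_ifs with hv
    · rw [← h.card_scanStep_eq (by omega), Finset.filter_filter]
      congr 1
      ext x
      simp only [Finset.mem_filter, Finset.mem_univ, true_and]
      constructor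
      · rintro rfl; exact ⟨⟨hl', hv⟩, rfl⟩
      · exact fun hx => hx.2
    · symm
      rw [Finset.card_eq_zero, Finset.filter_filter, Finset.filter_eq_empty_iff]
      rintro x - ⟨⟨-, h1⟩, rfl⟩
      exact hv h1
  · intro x hx
    simpa using (Finset.mem_filter.1 hx).2.1

theorem sum_mult (h : Layout I w m take) :
    ∑ l ∈ Finset.range (2 * I.n), (𝒟).mult l = ∑ i, I.m i := by
  have h1 : ∑ i, I.m i = Fintype.card I.Copy := by simp [Copy]
  rw [h1, ← Finset.card_univ, Finset.card_eq_sum_card_fiberwise (f := scanStep)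
    (t := Finset.range (2 * I.n)) fun x _ => by simpa using scanStep_lt x]
  exact Finset.sum_congr rfl fun l hl => (h.card_scanStep_eq (Finset.mem_range.1 hl)).symm

/-- If a threshold is blocked, the active keys of the class provide many weights within a factor
of 2 of each other that have `T` scanned copies each. -/
theorem exists_weights {k T : ℕ} (h : Layout I w m take) (hk : k < 2 * I.n) (hT : 0 < T) {w₀ e : ℕ}
    (hw₀ : 0 < w₀) (he : e < 2) (hkey : (𝒟).key k = 2 * w₀ + e) (hb : (𝒟).Blocks k T) :
    ∃ (K : Finset ℕ) (c : ℕ), 0 < c ∧ c ≤ w₀ ∧ 16 * U ≤ K.card * T ∧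
      ∀ u ∈ K, (c ≤ u ∧ u < 2 * c) ∧ T ≤ (𝒟).cnt k (2 * u + e) := by
  have hpar : ∀ v ∈ (𝒟).active k ((𝒟).cls ((𝒟).key k)) T, v = 2 * (v / 2) + e ∧
      2 ^ Nat.log 2 (v / 2) = 2 ^ Nat.log 2 w₀ := by
    intro v hv
    have h1 := ((Scan.mem_active hT).1 hv).1
    rw [hkey] at h1
    simp only [twoSidedScan] at h1
    rw [show (2 * w₀ + e) / 2 = w₀ by omega] at h1
    omega
  refine ⟨((𝒟).active k ((𝒟).cls ((𝒟).key k)) T).image (· / 2), 2 ^ Nat.log 2 w₀, by positivity,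
    Nat.pow_log_le_self 2 hw₀.ne', ?_, ?_⟩
  · rw [Finset.card_image_of_injOn]
    · exact hb.2.2
    · intro v hv v' hv' hvv
      have h1 := (hpar v hv).1
      have h2 := (hpar v' hv').1
      simp only at hvv
      omega
  · intro u hu
    obtain ⟨v, hv, rfl⟩ := Finset.mem_image.1 hu
    obtain ⟨h1, h2⟩ := hpar v hv
    have h3 := ((Scan.mem_active hT).1 hv).2
    refine ⟨?_, h1 ▸ h3⟩
    have hv2 : v / 2 ≠ 0 := by
      rw [h.cnt_eq hk.le] at h3
      obtain ⟨x, hx⟩ := Finset.card_pos.1 (hT.trans_le h3)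
      have hx' := (Finset.mem_filter.1 hx).2.2
      rw [h.key_scanStep] at hx'
      have := I.w_pos x.1
      omega
    rw [← h2]
    have h4 := Nat.pow_log_le_self 2 hv2
    have h5 := Nat.lt_pow_succ_log_self (b := 2) (by norm_num) (v / 2)
    rw [pow_succ] at h5
    omega

variable {opt : Finset I.Copy}

/-- The number of copies with key `v` in the symmetric difference. -/
noncomputable def changed (D : Scan) (opt : Finset I.Copy) (v : ℕ) : ℕ :=
  ((symmDiff I.greedy opt).filter fun x => D.key (scanStep x) = v).card

theorem changed_even (h : Layout I w m take) (u : ℕ) :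
    changed 𝒟 opt (2 * u) = ((I.greedy \ opt).filter fun x => I.w x.1 = u).card := by
  classical
  rw [changed]
  congr 1
  ext x
  simp only [Finset.mem_filter, h.key_scanStep, Finset.mem_symmDiff, Finset.mem_sdiff]
  by_cases hx : x ∈ I.greedy
  · simp [hx]
  · simp only [hx, if_false, false_and, false_or]
    exact iff_of_false (fun h => by omega) (fun h => h)

theorem changed_odd (h : Layout I w m take) (u : ℕ) :
    changed 𝒟 opt (2 * u + 1) = ((opt \ I.greedy).filter fun x => I.w x.1 = u).card := by
  classical
  rw [changed]
  congr 1
  ext x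
  simp only [Finset.mem_filter, h.key_scanStep, Finset.mem_symmDiff, Finset.mem_sdiff]
  by_cases hx : x ∈ I.greedy
  · simp only [hx, if_true, true_and, not_true, and_false, or_false, false_and, iff_false]
    omega
  · simp [hx]

theorem changed_le (h : Layout I w m take) (hun : I.Unimprovable opt) (hopt : I.IsOptimal opt)
    (hU : ∀ i, I.w i ≤ U) (v : ℕ) : changed 𝒟 opt v ≤ U := by
  classical
  rcases Nat.even_or_odd' v with ⟨u, rfl | rfl⟩
  · rw [h.changed_even]
    exact (Finset.card_filter_le _ _).trans (hun.card_greedy_sdiff_le hopt hU)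
  · rw [h.changed_odd]
    exact (Finset.card_filter_le _ _).trans (hun.card_sdiff_greedy_le hopt hU)

/-- A blocked threshold bounds the number of copies of this weight in the symmetric difference:
fewer than `T` of them were scanned before, and at most `T` others can be exchanged. -/
theorem changed_le_of_blocks (h : Layout I w m take) (hun : I.Unimprovable opt)
    (hopt : I.IsOptimal opt) (hU : ∀ i, I.w i ≤ U) {k T : ℕ} (hk : k < 2 * I.n) (hT : 0 < T)
    (hb : (𝒟).Blocks k T) : changed 𝒟 opt ((𝒟).key k) ≤ 2 * T := by
  classical
  obtain ⟨i, hi⟩ := exists_rank_eq (WordRAM.ScanData.scanPos_lt hk)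
  have hkey : (𝒟).key k = 2 * I.w i + if k < I.n then 0 else 1 := by
    rw [WordRAM.ScanData.key_eq, ← hi, h.w_rank]
  have hlt := hb.1
  obtain ⟨K, c, hc, hcw, hKT, hK⟩ := h.exists_weights hk hT (I.w_pos i)
    (by split_ifs <;> omega) hkey hb
  set A := Finset.univ.filter fun x : I.Copy =>
    scanStep x < k ∧ (x ∈ I.greedy ↔ k < I.n) with hA
  -- The copies with a given key scanned so far are the elements of `A` of a given weight.
  have hcnt : ∀ u, (𝒟).cnt k (2 * u + if k < I.n then 0 else 1) =
      (A.filter fun x => I.w x.1 = u).card := by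
    intro u
    rw [h.cnt_eq hk.le]
    congr 1
    ext x
    simp only [hA, Finset.mem_filter, Finset.mem_univ, true_and, h.key_scanStep, and_assoc]
    refine and_congr_right fun _ => ?_
    by_cases h1 : x ∈ I.greedy <;> by_cases h2 : k < I.n <;> simp [h1, h2] <;> omega
  rw [hkey, hcnt] at hlt
  simp only [hcnt] at hK
  rw [hkey]
  have hsplit : ∀ S : Finset I.Copy, (S.filter fun x => I.w x.1 = I.w i).card ≤
      ((S.filter fun x => I.w x.1 = I.w i) \ A).card +
        (A.filter fun x => I.w x.1 = I.w i).card := by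
    intro S
    refine (Finset.card_le_card fun x hx => ?_).trans (Finset.card_union_le _ _)
    simp only [Finset.mem_union, Finset.mem_sdiff, Finset.mem_filter] at hx ⊢
    tauto
  by_cases hkn : k < I.n
  · rw [if_pos hkn, add_zero, h.changed_even]
    have := hun.card_removed_le hopt hU A (fun x hx => by
      have := (Finset.mem_filter.1 hx).2.2; tauto) (fun a ha b hb' hbA => ?_) K hc hT
      (fun u hu => (hK u hu).1) (fun u hu => (hK u hu).2) hKT hcw (hU i)
    · have := hsplit (I.greedy \ opt)
      omega
    · simp only [hA, Finset.mem_filter, Finset.mem_univ, true_and, hkn, iff_true] at ha hbA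
      simp only [hb', and_true, not_lt] at hbA
      have h1 := ha.1
      rw [scanStep, if_pos ha.2] at h1
      rw [scanStep, if_pos hb'] at hbA
      exact I.copyLE_iff_rank.2 (.inl (by omega))
  · rw [if_neg hkn, h.changed_odd]
    have := hun.card_added_le hopt hU A (fun x hx => by
      have := (Finset.mem_filter.1 hx).2.2; tauto) (fun a ha b hb' hbA => ?_) K hc hT
      (fun u hu => (hK u hu).1) (fun u hu => (hK u hu).2) hKT hcw (hU i)
    · have := hsplit (opt \ I.greedy)
      omega
    · simp only [hA, Finset.mem_filter, Finset.mem_univ, true_and, hkn, iff_false] at ha hbA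
      simp only [hb', not_false_eq_true, and_true, not_lt] at hbA
      have h1 := ha.1
      rw [scanStep, if_neg ha.2] at h1
      rw [scanStep, if_neg hb'] at hbA
      exact I.copyLE_iff_rank.2 (.inl (by omega))

theorem changed_le_lim (h : Layout I w m take) (hun : I.Unimprovable opt)
    (hopt : I.IsOptimal opt) (hU : ∀ i, I.w i ≤ U) {k : ℕ} (hk : k ≤ 2 * I.n) (v : ℕ) :
    changed 𝒟 opt v ≤ (𝒟).lim k v :=
  Scan.le_lim (D := 𝒟) (N := 2 * I.n) (changed 𝒟 opt) (h.changed_le hun hopt hU)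
    (fun _ hk _ _ hb => h.changed_le_of_blocks hun hopt hU hk (by positivity) hb) hk v

/-- Every copy of the symmetric difference is selected, as together with it the symmetric
difference contains all copies of the same weight between it and the end of the greedy
solution. -/
theorem exists_of_mem_symmDiff (h : Layout I w m take)
    (hun : I.Unimprovable opt) (hopt : I.IsOptimal opt) (hU : ∀ i, I.w i ≤ U) {x : I.Copy}
    (hx : x ∈ symmDiff I.greedy opt) :
    ∃ j < (𝒟).emit (scanStep x), (x.2 : ℕ) = scanStart 𝒟 I.n take (scanStep x) + j := by
  classical
  have hxlt := scanStep_lt x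
  have hlim := h.changed_le_lim hun hopt hU (show scanStep x + 1 ≤ 2 * I.n from hxlt)
    ((𝒟).key (scanStep x))
  have hmul := (𝒟).emit_le (scanStep x)
  have hemit : (𝒟).emit (scanStep x) = min ((𝒟).cnt (scanStep x) ((𝒟).key (scanStep x)) +
    (𝒟).mult (scanStep x)) ((𝒟).lim (scanStep x + 1) ((𝒟).key (scanStep x))) -
    (𝒟).cnt (scanStep x) ((𝒟).key (scanStep x)) := rfl
  obtain ⟨a, b, hbm, hab⟩ : ∃ a b, b ≤ I.m x.1 ∧ (x ∈ I.greedy ∧ a = (x.2 : ℕ) ∧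
      b = take (I.rank x.1) ∨ x ∉ I.greedy ∧ a = take (I.rank x.1) ∧ b = x.2 + 1) := by
    by_cases hxg : x ∈ I.greedy
    · exact ⟨_, _, h.take_le x.1, .inl ⟨hxg, rfl, rfl⟩⟩
    · exact ⟨_, _, x.2.2, .inr ⟨hxg, rfl, rfl⟩⟩
  have hcard : (𝒟).cnt (scanStep x) ((𝒟).key (scanStep x)) + (b - a) ≤
      changed 𝒟 opt ((𝒟).key (scanStep x)) := by
    rw [h.cnt_eq hxlt.le, ← card_copies_between x.1 hbm, ← Finset.card_union_of_disjoint]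
    · refine Finset.card_le_card fun y hy => ?_
      have hy' : (y ∈ I.greedy ↔ x ∈ I.greedy) ∧ I.w y.1 = I.w x.1 ∧
          (x ∈ I.greedy → I.CopyLE x y) ∧ (x ∉ I.greedy → I.CopyLE y x) := by
        rcases Finset.mem_union.1 hy with hy | hy
        · obtain ⟨hlt, hkey⟩ := (Finset.mem_filter.1 hy).2
          rw [h.key_scanStep, h.key_scanStep] at hkey
          have hw : I.w y.1 = I.w x.1 := by split_ifs at hkey <;> omega
          have hg : y ∈ I.greedy ↔ x ∈ I.greedy := by
            by_cases h1 : y ∈ I.greedy <;> by_cases h2 : x ∈ I.greedy <;>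
              simp only [h1, h2, if_true, if_false] at hkey ⊢ <;> omega
          refine ⟨hg, hw, fun hxg => ?_, fun hxg => ?_⟩
          · rw [scanStep, scanStep, if_pos hxg, if_pos (hg.2 hxg)] at hlt
            exact I.copyLE_iff_rank.2 (.inl (by omega))
          · rw [scanStep, scanStep, if_neg hxg, if_neg fun h1 => hxg (hg.1 h1)] at hlt
            exact I.copyLE_iff_rank.2 (.inl (by omega))
        · obtain ⟨hyx, hya, hyb⟩ := (Finset.mem_filter.1 hy).2
          refine ⟨?_, by rw [hyx], fun hxg => .inr ⟨hyx.symm, ?_⟩, fun hxg => .inr ⟨hyx, ?_⟩⟩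
          · rw [h.mem_greedy, h.mem_greedy, congrArg I.rank hyx]
            rw [h.mem_greedy] at hab
            omega
          · rcases hab with hab | hab
            · omega
            · exact absurd hxg hab.1
          · rcases hab with hab | hab
            · exact absurd hab.1 hxg
            · omega
      obtain ⟨hg, hw, h1, h2⟩ := hy'
      rw [Finset.mem_filter, h.key_scanStep, h.key_scanStep, hw]
      simp only [hg]
      refine ⟨?_, trivial⟩
      rw [Finset.mem_symmDiff] at hx ⊢
      rcases hx with ⟨hxg, hxo⟩ | ⟨hxo, hxg⟩
      · exact .inl ⟨hg.2 hxg, fun hyo => hxo (hun.mem_opt hw.symm (h1 hxg) hyo)⟩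
      · exact .inr ⟨hun.mem_opt hw (h2 hxg) hxo, fun hyg => hxg (hg.1 hyg)⟩
    · rw [Finset.disjoint_left]
      intro y hy hy'
      obtain ⟨hlt, hkey⟩ := (Finset.mem_filter.1 hy).2
      obtain ⟨hyx, hya, hyb⟩ := (Finset.mem_filter.1 hy').2
      have hg : y ∈ I.greedy ↔ x ∈ I.greedy := by
        rw [h.mem_greedy, h.mem_greedy, congrArg I.rank hyx]
        rw [h.mem_greedy] at hab
        omega
      rw [scanStep, scanStep, congrArg I.rank hyx] at hlt
      simp only [hg] at hlt
      exact lt_irrefl _ hlt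
  have hmult : (𝒟).mult (scanStep x) = if x ∈ I.greedy then take (I.rank x.1)
      else I.m x.1 - take (I.rank x.1) := by
    have hpos := scanPos_scanStep x
    rw [← h.m_rank, ← hpos]
    simp only [twoSidedScan, scanPos, scanStep_lt_n]
    split_ifs <;> rfl
  have hstart : scanStart 𝒟 I.n take (scanStep x) = if x ∈ I.greedy
      then take (I.rank x.1) - (𝒟).emit (scanStep x) else take (I.rank x.1) := by
    have hpos := scanPos_scanStep x
    rw [← hpos]
    simp only [scanStart, scanPos, scanStep_lt_n]
    split_ifs <;> rfl
  have hx2 := x.2.2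
  have htake := h.take_le x.1
  have hmem := h.mem_greedy x
  refine ⟨x.2 - scanStart 𝒟 I.n take (scanStep x), ?_, ?_⟩
  · rcases hab with ⟨hxg, rfl, rfl⟩ | ⟨hxg, rfl, rfl⟩ <;>
      simp only [hxg, if_true, if_false, true_iff, false_iff] at hmult hstart hmem <;> omega
  · rcases hab with ⟨hxg, rfl, rfl⟩ | ⟨hxg, rfl, rfl⟩ <;>
      simp only [hxg, if_true, if_false, true_iff, false_iff] at hmult hstart hmem <;> omega

end Layout

end BoundedKnapsack

/-! ### The whole scan -/

theorem Scan.exists_eq_offset_add (D : Scan) {k t : ℕ} (ht : t < D.offset k) :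
    ∃ l < k, ∃ j < D.emit l, t = D.offset l + j := by
  induction k with
  | zero => simp [Scan.offset] at ht
  | succ k ih =>
    rw [D.offset_succ] at ht
    by_cases hk : t < D.offset k
    · obtain ⟨l, hl, h⟩ := ih hk
      exact ⟨l, by omega, h⟩
    · exact ⟨k, by omega, t - D.offset k, by omega, by omega⟩

theorem Scan.offset_add_lt (D : Scan) {k l j : ℕ} (hl : l < k) (hj : j < D.emit l) :
    D.offset l + j < D.offset k := by
  have h1 := D.offset_mono (show l + 1 ≤ k from hl)
  rw [D.offset_succ] at h1
  omega

theorem Scan.offset_add_inj (D : Scan) {l l' j j' : ℕ} (hj : j < D.emit l) (hj' : j' < D.emit l')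
    (h : D.offset l + j = D.offset l' + j') : l = l' ∧ j = j' := by
  rcases lt_trichotomy l l' with hl | rfl | hl
  · have := D.offset_add_lt hl hj; omega
  · exact ⟨rfl, by omega⟩
  · have := D.offset_add_lt hl hj'; omega

/-- There are at most `2 * U + 2` keys, in `2 * U.size` classes. -/
theorem offset_twoSidedScan_le {n U : ℕ} {w m take : ℕ → ℕ} (hw0 : ∀ q < n, 0 < w q)
    (hwU : ∀ q < n, w q ≤ U) :
    (twoSidedScan n U w m take).offset (2 * n) ≤ 4 * U + 4 + 136 * U * U.size * U.size := by
  have h := (twoSidedScan n U w m take).sum_emit_le (N := 2 * n) (Finset.range (2 * U + 2))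
    ((Finset.range U.size).image (fun i => 2 * 2 ^ i) ∪
      (Finset.range U.size).image (fun i => 2 * 2 ^ i + 1)) ?_ ?_
  · have h1 := (Finset.card_union_le ((Finset.range U.size).image (fun i => 2 * 2 ^ i))
      ((Finset.range U.size).image (fun i => 2 * 2 ^ i + 1))).trans
      (add_le_add Finset.card_image_le Finset.card_image_le)
    rw [Finset.card_range] at h1 h
    have h2 := Nat.mul_le_mul_left (68 * U * U.size) h1
    rw [Scan.offset]
    refine h.trans ((Nat.add_le_add_left h2 _).trans (le_of_eq ?_))
    ring
  · intro k hk
    have := hwU _ (WordRAM.ScanData.scanPos_lt hk)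
    rw [WordRAM.ScanData.key_eq, Finset.mem_range]
    split_ifs <;> omega
  · intro k hk
    have hq := WordRAM.ScanData.scanPos_lt hk
    have hsize : Nat.log 2 (w (scanPos n k)) < U.size :=
      Nat.lt_size.2 ((Nat.pow_log_le_self 2 (hw0 _ hq).ne').trans (hwU _ hq))
    rw [WordRAM.ScanData.cls_key_eq, Finset.mem_union, Finset.mem_image, Finset.mem_image]
    by_cases hkn : k < n
    · exact .inl ⟨_, Finset.mem_range.2 hsize, by simp [hkn]⟩
    · exact .inr ⟨_, Finset.mem_range.2 hsize, by simp [hkn]⟩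

namespace WordRAM

theorem runs_scanProg {B N n U : ℕ} {w m take X : ℕ → ℕ} {s : State}
    (h : ScanData B N n U w m take) (hdat : DataInv n U X w m take s)
    (h8 : ∀ v, s.arr 8 v = 0) (h9 : ∀ v, s.arr 9 v = 0) (h10 : ∀ v, s.arr 10 v = 0) :
    Runs B scanProg s (∑ k ∈ Finset.range (2 * n), scanStepTime (twoSidedScan n U w m take) k +
      12 * n + 12) fun t => t.reg 0 = (twoSidedScan n U w m take).offset (2 * n) ∧
        ∀ l < 2 * n, ∀ j < (twoSidedScan n U w m take).emit l,
          t.arr 0 ((twoSidedScan n U w m take).offset l + j) = X (scanPos n l) ∧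
          t.arr 1 ((twoSidedScan n U w m take).offset l + j) =
            scanStart (twoSidedScan n U w m take) n take l + j := by
  have hlin := h.lin
  have htwo := h.two_le
  have hnN := h.n_le
  have hB : 1 < B := by omega
  obtain ⟨D, hD⟩ : ∃ D, D = twoSidedScan n U w m take := ⟨_, rfl⟩
  have hDU : D.U = U := by rw [hD]; rfl
  rw [← hD]
  refine Runs.weaken (T := 4 + ((∑ k ∈ Finset.range (2 * n), scanStepTime D k +
    (2 * n + 1) * 6) + 2)) ?_ (by omega) fun _ h => h
  refine Runs.seq ((Runs.of_wp hB (Q := fun t => DataInv n U X w m take t ∧ TableInv D 0 t ∧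
    t.reg 3 = 0 ∧ OutputInv D n X take 0 0 t) (by decide) ?_).weaken le_rfl fun s₁ hs₁ => ?_)
  · simp only [wp, Expr.Fits, Expr.val]
    refine ⟨by omega, by omega, hdat.congr (by simp) (by simp) rfl rfl rfl rfl, ?_, by simp, ?_⟩
    · refine ⟨fun v => by simp [h8], fun v => by simp [h9, Scan.lim], fun κ i _ => ?_⟩
      simp [h10, Scan.active_zero]
    · simp [OutputInv, Scan.offset]
  refine Runs.seq (Runs.weaken (Q := fun t => DataInv n U X w m take t ∧
    OutputInv D n X take (2 * n) 0 t) (Runs.loop hB (K := 2 * n) (fun k t =>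
    DataInv n U X w m take t ∧ TableInv D k t ∧ t.reg 3 = k ∧ OutputInv D n X take k 0 t)
    hs₁ ?_ ?_) le_rfl fun t ⟨ht, hout⟩ => Runs.of_wp hB (by decide) ?_)
  · rintro k t hk ⟨ht, htab, t3, hout⟩
    subst hD
    refine ⟨?_, ?_, runs_scanStep h hk ht htab t3 hout⟩
    · exact ⟨trivial, trivial, trivial, by simp only [Expr.val, ht.1]; omega⟩
    · simp only [Expr.val, Op.eval, t3, ht.1]
      rw [if_pos (by omega)]; exact one_ne_zero
  · rintro t ⟨ht, htab, t3, hout⟩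
    refine ⟨?_, ?_, ht, hout⟩
    · exact ⟨trivial, trivial, trivial, by simp only [Expr.val, ht.1]; omega⟩
    · simp only [Expr.val, Op.eval, t3, ht.1]
      rw [if_neg (by omega)]
  · simp only [wp, Expr.Fits, Expr.val, true_and]
    exact ⟨by simpa using hout.1, hout.2.1⟩

end WordRAM

namespace BoundedKnapsack

variable {I : BoundedKnapsack}

namespace Layout

variable {w m take : ℕ → ℕ} {U : ℕ}

/-- The numbers written in the scan denote copies, and each copy is written in its own step. -/
theorem exists_copy (h : Layout I w m take) {l j : ℕ} (hl : l < 2 * I.n)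
    (hj : j < (twoSidedScan I.n U w m take).emit l) :
    ∃ x : I.Copy, I.rank x.1 = scanPos I.n l ∧
      (x.2 : ℕ) = scanStart (twoSidedScan I.n U w m take) I.n take l + j ∧ scanStep x = l := by
  obtain ⟨i, hi⟩ := exists_rank_eq (WordRAM.ScanData.scanPos_lt hl)
  obtain ⟨e, he⟩ : ∃ e, e = (twoSidedScan I.n U w m take).emit l := ⟨_, rfl⟩
  have h1 := (twoSidedScan I.n U w m take).emit_le l
  have h2 := h.take_le i
  have h3 := h.m_rank i
  have h4 := rank_lt i
  rw [← he] at h1 hj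
  simp only [scanStart, ← he]
  simp only [twoSidedScan] at h1
  rw [scanPos] at hi ⊢
  by_cases hln : l < I.n
  · rw [if_pos hln] at h1 hi ⊢
    rw [if_pos hln, ← hi]
    rw [← hi] at h1
    refine ⟨⟨i, ⟨take (I.rank i) - e + j, by omega⟩⟩, rfl, rfl, ?_⟩
    rw [scanStep, if_pos]
    · simp only; omega
    · rw [h.mem_greedy]
      simp only; omega
  · rw [if_neg hln] at h1 hi ⊢
    rw [if_neg hln, ← hi]
    rw [← hi] at h1
    refine ⟨⟨i, ⟨take (I.rank i) + j, by omega⟩⟩, rfl, rfl, ?_⟩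
    rw [scanStep, if_neg]
    · simp only; omega
    · rw [h.mem_greedy]
      simp only; omega

/-- The list of the selected copies, in the order of their selection. -/
theorem exists_list (h : Layout I w m take) (U : ℕ) : ∃ L : List I.Copy,
    L.length = (twoSidedScan I.n U w m take).offset (2 * I.n) ∧ L.Nodup ∧
      (∀ (t : ℕ) (ht : t < L.length), ∃ l < 2 * I.n, ∃ j < (twoSidedScan I.n U w m take).emit l,
        t = (twoSidedScan I.n U w m take).offset l + j ∧ I.rank L[t].1 = scanPos I.n l ∧
        (L[t].2 : ℕ) = scanStart (twoSidedScan I.n U w m take) I.n take l + j) ∧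
      ∀ x : I.Copy, ∀ j < (twoSidedScan I.n U w m take).emit (scanStep x),
        (x.2 : ℕ) = scanStart (twoSidedScan I.n U w m take) I.n take (scanStep x) + j → x ∈ L := by
  obtain ⟨D, hD⟩ : ∃ D, D = twoSidedScan I.n U w m take := ⟨_, rfl⟩
  have hex : ∀ t : Fin (D.offset (2 * I.n)), ∃ x : I.Copy, ∃ l < 2 * I.n, ∃ j < D.emit l,
      (t : ℕ) = D.offset l + j ∧ I.rank x.1 = scanPos I.n l ∧
      (x.2 : ℕ) = scanStart D I.n take l + j ∧ scanStep x = l := by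
    intro t
    obtain ⟨l, hl, j, hj, ht⟩ := D.exists_eq_offset_add t.2
    obtain ⟨x, h1, h2, h3⟩ := h.exists_copy hl (by rwa [hD] at hj)
    exact ⟨x, l, hl, j, hj, ht, h1, by rw [h2, hD], h3⟩
  choose f hf using hex
  rw [← hD]
  refine ⟨List.ofFn f, List.length_ofFn, List.nodup_ofFn.2 ?_, fun t ht => ?_, fun x j hj hx => ?_⟩
  · intro t t' htt
    obtain ⟨l, -, j, -, h1, -, h2, h3⟩ := hf t
    obtain ⟨l', -, j', -, h1', -, h2', h3'⟩ := hf t'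
    rw [htt] at h2 h3
    obtain rfl : l = l' := h3.symm.trans h3'
    exact Fin.ext (by omega)
  · obtain ⟨l, hl, j, hj, h1, h2, h3, -⟩ := hf ⟨t, by simpa using ht⟩
    rw [List.getElem_ofFn]
    exact ⟨l, hl, j, hj, h1, h2, h3⟩
  · have hlt := D.offset_add_lt (scanStep_lt x) hj
    obtain ⟨l, -, j', hj', h1, h2, h3, h4⟩ := hf ⟨_, hlt⟩
    obtain ⟨rfl, rfl⟩ := D.offset_add_inj hj hj' h1
    refine (List.mem_ofFn).2 ⟨⟨_, hlt⟩, ?_⟩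
    generalize f ⟨_, hlt⟩ = y at *
    obtain ⟨i, c⟩ := x
    obtain ⟨i', c'⟩ := y
    obtain rfl : i' = i := I.rank_injective (h2.trans (scanPos_scanStep _))
    obtain rfl : c' = c := Fin.ext (h3.trans hx.symm)
    rfl

end Layout

end BoundedKnapsack

/-! ### The order and the greedy solution computed on the word RAM -/

namespace BoundedKnapsack

variable {I : BoundedKnapsack}

theorem image_rank_filter_lt {r : ℕ} (hr : r ≤ I.n) :
    (Finset.univ.filter fun i => I.rank i < r).image I.rank = Finset.range r := by
  ext q
  simp only [Finset.mem_image, Finset.mem_filter, Finset.mem_univ, true_and, Finset.mem_range]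
  constructor
  · rintro ⟨i, hi, rfl⟩; exact hi
  · intro hq
    obtain ⟨i, hi⟩ := exists_rank_eq (I := I) (hq.trans_le hr)
    exact ⟨i, by omega, hi⟩

theorem sum_filter_rank_lt (f : ℕ → ℕ) {r : ℕ} (hr : r ≤ I.n) :
    ∑ i with I.rank i < r, f (I.rank i) = ∑ q ∈ Finset.range r, f q := by
  rw [← image_rank_filter_lt hr, Finset.sum_image fun i _ j _ h => I.rank_injective h]

/-- The weight of the prefix that ends with the copy `x`. -/
theorem weight_filter_copyLE (x : I.Copy) : I.weight (Finset.univ.filter fun y => I.CopyLE y x) =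
    ∑ i with I.rank i < I.rank x.1, I.m i * I.w i + (x.2 + 1) * I.w x.1 := by
  have hinner : ∀ i : Fin I.n, (∑ c : Fin (I.m i), if I.CopyLE ⟨i, c⟩ x then I.w i else 0) =
      (if I.rank i < I.rank x.1 then I.m i * I.w i else 0) +
        if i = x.1 then (x.2 + 1) * I.w x.1 else 0 := by
    intro i
    simp only [copyLE_iff_rank]
    by_cases hi : i = x.1
    · obtain ⟨i', c⟩ := x
      subst hi
      simp only [lt_irrefl, if_false, false_or, true_and, if_true, zero_add]
      rw [← Finset.sum_filter, Finset.sum_const, smul_eq_mul]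
      congr 1
      have : (Finset.univ.filter fun d : Fin (I.m i) => (d : ℕ) ≤ c) = Finset.Iic c := by
        ext d
        rw [Finset.mem_filter, Finset.mem_Iic, Fin.le_def]
        exact and_iff_right (Finset.mem_univ d)
      rw [this, Fin.card_Iic]
    · simp only [hi, if_false, false_and, or_false, add_zero]
      split_ifs <;> simp
  rw [weight, Finset.sum_filter, Fintype.sum_sigma, Finset.sum_congr rfl fun i _ => hinner i,
    Finset.sum_add_distrib, Finset.sum_filter]
  simp

/-- An item contributes to the greedy solution as many copies as fit into the capacity that is
left by all copies of the earlier items. -/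
theorem mem_greedy_iff_lt {w m : ℕ → ℕ} (hw : ∀ i, w (I.rank i) = I.w i)
    (hm : ∀ i, m (I.rank i) = I.m i) (x : I.Copy) : x ∈ I.greedy ↔ (x.2 : ℕ) <
      min (m (I.rank x.1)) ((I.W - ∑ q ∈ Finset.range (I.rank x.1), m q * w q) /
        w (I.rank x.1)) := by
  rw [greedy, Finset.mem_filter, weight_filter_copyLE,
    ← sum_filter_rank_lt (fun q => m q * w q) (rank_lt x.1).le]
  simp only [hw, hm, Finset.mem_univ, true_and, lt_min_iff, x.2.2]
  rw [← Nat.add_one_le_iff, Nat.le_div_iff_mul_le (I.w_pos x.1)]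
  have : 0 < (x.2 + 1) * I.w x.1 := Nat.mul_pos (by omega) (I.w_pos x.1)
  omega

/-- A list of the items that is sorted by the rank has the item of rank `q` at position `q`. -/
theorem apply_rank_of_sorted {X rk : ℕ → ℕ} (hrk : ∀ i : Fin I.n, rk i = I.rank i)
    (hX : IsPermutation I.n X)
    (hsort : ∀ a a', a < a' → a' < I.n → rk (X a) ≤ rk (X a')) (i : Fin I.n) :
    X (I.rank i) = i := by
  have hval : ∀ a (ha : a < I.n), rk (X a) = I.rank ⟨X a, hX.1 a ha⟩ := fun a ha =>
    hrk ⟨X a, hX.1 a ha⟩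
  have hinj : Function.Injective fun a : Fin I.n => (⟨rk (X a), by
      rw [hval a a.2]; exact rank_lt _⟩ : Fin I.n) := by
    intro a a' haa
    have h1 : rk (X a) = rk (X a') := congrArg Fin.val haa
    rw [hval a a.2, hval a' a'.2] at h1
    exact Fin.ext (hX.injOn a.2 a'.2 (congrArg Fin.val (I.rank_injective h1)))
  have hmono := (Monotone.strictMono_of_injective (fun a a' haa => by
    rcases haa.eq_or_lt with rfl | h
    · exact le_rfl
    · exact hsort a a' h a'.2) hinj)
  -- The only increasing bijection of `Fin n` is the identity.
  have hid := Subsingleton.elim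
    (StrictMono.orderIsoOfSurjective _ hmono (Finite.injective_iff_surjective.1 hinj))
    (OrderIso.refl _)
  have h1 := DFunLike.congr_fun hid ⟨I.rank i, rank_lt i⟩
  replace h1 : rk (X (I.rank i)) = I.rank i := congrArg Fin.val h1
  rw [hval _ (rank_lt i)] at h1
  exact congrArg Fin.val (I.rank_injective h1)

theorem n_le_magnitude : I.n ≤ I.magnitude := by rw [magnitude]; omega

theorem item_le_magnitude (i : Fin I.n) : I.w i + I.p i + I.m i ≤ I.magnitude := by
  have := Finset.single_le_sum (f := fun i => I.w i + I.p i + I.m i) (fun i _ => Nat.zero_le _)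
    (Finset.mem_univ i)
  rw [magnitude]
  omega

theorem sum_m_le_magnitude : ∑ i, I.m i ≤ I.magnitude := by
  have : ∑ i, I.m i ≤ ∑ i, (I.w i + I.p i + I.m i) :=
    Finset.sum_le_sum fun i _ => Nat.le_add_left _ _
  rw [magnitude]
  omega

theorem lt_magnitude_pow : 16 * (I.magnitude * I.magnitude) < I.magnitude ^ 7 := by
  have h2 : 2 ≤ I.magnitude := by rw [magnitude]; omega
  have h5 : 2 ^ 5 ≤ I.magnitude ^ 5 := Nat.pow_le_pow_left h2 5
  have h6 : I.magnitude ^ 7 = I.magnitude ^ 5 * (I.magnitude * I.magnitude) := by ring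
  have h7 := Nat.mul_le_mul_right (I.magnitude * I.magnitude) h5
  have h8 : 0 < I.magnitude * I.magnitude := by positivity
  omega

end BoundedKnapsack

namespace WordRAM

variable {I : BoundedKnapsack}

theorem small_initState : Small (I.magnitude ^ 7) I.magnitude (initState I) := by
  have hN := I.n_le_magnitude
  refine ⟨by rw [BoundedKnapsack.magnitude]; omega, I.lt_magnitude_pow, hN, ?_, ?_, ?_⟩ <;>
  · intro j
    by_cases hj : j < I.n
    · have := I.item_le_magnitude ⟨j, hj⟩
      simp [initState, hj]; omega
    · simp [initState, hj]

theorem words_initState : (initState I).Words (I.magnitude ^ 7) := by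
  have hs := small_initState (I := I)
  have hlin := hs.lin
  have h2 := hs.two_le
  constructor
  · intro x
    have hn := I.n_le_magnitude
    have hW : I.W ≤ I.magnitude := by rw [BoundedKnapsack.magnitude]; omega
    simp only [initState]
    split_ifs <;> omega
  · intro a j
    by_cases h0 : a = 0
    · subst h0; have := hs.w_le j; omega
    by_cases h1 : a = 1
    · subst h1; have := hs.p_le j; omega
    by_cases h2 : a = 2
    · subst h2; have := hs.m_le j; omega
    · simp [initState, h0, h1, h2]; omega

/-- The rank of an item, extended by 0 to all natural numbers. -/
noncomputable def rankFun (I : BoundedKnapsack) (j : ℕ) : ℕ :=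
  if h : j < I.n then I.rank ⟨j, h⟩ else 0

theorem rankFun_val (i : Fin I.n) : rankFun I i = I.rank i := by simp [rankFun]

theorem before_initState_iff {a b : ℕ} (ha : a < I.n) (hb : b < I.n) :
    Before ((initState I).arr 0) ((initState I).arr 1) a b ↔ rankFun I a < rankFun I b := by
  rw [rankFun, rankFun, dif_pos ha, dif_pos hb, ← I.precedes_iff_rank]
  simp [Before, BoundedKnapsack.Precedes, initState, ha, hb]

/-- The program that computes the candidates: the order of efficiency, the greedy solution and
the two-sided scan. -/
def candidateProg : Program := maxWeightProg ;; sortProg ;; greedyProg ;; scanProg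

end WordRAM

/-! ### The algorithm -/

namespace WordRAM

variable {I : BoundedKnapsack}

/-- The result of the algorithm: the list of the copies selected by the two-sided scan of the
items in the order of decreasing efficiency. -/
theorem runs_candidateProg {U : ℕ} (hU : U = (Finset.range I.n).sup ((initState I).arr 0)) :
    ∃ w m take : ℕ → ℕ, I.Layout w m take ∧ (∀ q < I.n, 0 < w q) ∧ (∀ q < I.n, w q ≤ U) ∧
      ∃ (time : ℕ) (final : State), Exec (I.magnitude ^ 7) candidateProg (initState I) time final ∧
        time ≤ 20 * (I.n + 1) + ((mergeStep.time + 30) * (I.n + 1) * (Nat.clog 2 I.n + 1) +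
          (60 * (I.n + 1) + (∑ k ∈ Finset.range (2 * I.n),
            scanStepTime (twoSidedScan I.n U w m take) k + 12 * I.n + 12))) ∧
        final.reg 0 = (twoSidedScan I.n U w m take).offset (2 * I.n) ∧
        ∀ i : Fin I.n, ∀ l < 2 * I.n, scanPos I.n l = I.rank i →
          ∀ j < (twoSidedScan I.n U w m take).emit l,
            final.arr 0 ((twoSidedScan I.n U w m take).offset l + j) = i ∧
            final.arr 1 ((twoSidedScan I.n U w m take).offset l + j) =
              scanStart (twoSidedScan I.n U w m take) I.n take l + j := by
  have hsmall := small_initState (I := I)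
  have hsame : ∀ {t : State}, SameInput (initState I) t → Small (I.magnitude ^ 7) I.magnitude t :=
    fun ht => ⟨hsmall.two_le, hsmall.lt, by rw [ht.1]; exact hsmall.n_le,
      by rw [ht.2.2.2 0 (by decide) (by decide)]; exact hsmall.w_le,
      by rw [ht.2.2.2 1 (by decide) (by decide)]; exact hsmall.p_le,
      by rw [ht.2.2.2 2 (by decide) (by decide)]; exact hsmall.m_le⟩
  have hitem : ∀ i : Fin I.n, (initState I).arr 0 i = I.w i ∧ (initState I).arr 2 i = I.m i := by
    intro i; simp [initState]
  obtain ⟨t₁, s₁, e₁, ht₁, hs₁, a0, a1, a2, aarr⟩ :=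
    runs_maxWeightProg hsmall (n := I.n) rfl rfl words_initState
  have hsmall₁ : Small (I.magnitude ^ 7) I.magnitude s₁ :=
    ⟨hsmall.two_le, hsmall.lt, by rw [a0]; exact hsmall.n_le, by rw [aarr]; exact hsmall.w_le,
      by rw [aarr]; exact hsmall.p_le, by rw [aarr]; exact hsmall.m_le⟩
  obtain ⟨t₂, s₂, e₂, ht₂, hs₂, ⟨b0, b1, b2, barr⟩, hperm, hsort⟩ :=
    runs_sortProg (rk := rankFun I) hsmall₁ a0
      (by rw [aarr]; exact fun a ha b hb => before_initState_iff ha hb) hs₁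
  rw [aarr] at barr
  have c0 := barr 0 (by decide) (by decide)
  have c2 := barr 2 (by decide) (by decide)
  have hsmall₂ : Small (I.magnitude ^ 7) I.magnitude s₂ :=
    ⟨hsmall.two_le, hsmall.lt, by rw [b0, a0]; exact hsmall.n_le, by rw [c0]; exact hsmall.w_le,
      by rw [barr 1 (by decide) (by decide)]; exact hsmall.p_le, by rw [c2]; exact hsmall.m_le⟩
  obtain ⟨t₃, s₃, e₃, ht₃, hs₃, d0, d2, darr, d6, d7, d5⟩ :=
    runs_greedyProg hsmall₂ (b0.trans a0) (b1.trans a1) (fun j => by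
      have h1 := Nat.mul_le_mul (hsmall₂.m_le j) (hsmall₂.w_le j)
      have h2 := hsmall.lt
      omega) hs₂
  have hX := BoundedKnapsack.apply_rank_of_sorted rankFun_val hperm hsort
  have hw : ∀ i : Fin I.n, s₃.arr 6 (I.rank i) = I.w i := fun i => by
    rw [d6 _ (I.rank_lt i), hX, c0, (hitem i).1]
  have hm : ∀ i : Fin I.n, s₃.arr 7 (I.rank i) = I.m i := fun i => by
    rw [d7 _ (I.rank_lt i), hX, c2, (hitem i).2]
  have htake : ∀ q < I.n, s₃.arr 5 q = min (s₃.arr 7 q)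
      ((I.W - ∑ i ∈ Finset.range q, s₃.arr 7 i * s₃.arr 6 i) / s₃.arr 6 q) := by
    intro q hq
    rw [d5 q hq, d6 q hq, d7 q hq]
    congr 3
    refine Finset.sum_congr rfl fun i hi => ?_
    have := Finset.mem_range.1 hi
    rw [d6 i (by omega), d7 i (by omega)]
  have htake_le : ∀ q < I.n, s₃.arr 5 q ≤ s₃.arr 7 q := fun q hq => by
    rw [htake q hq]; exact min_le_left _ _
  have hlay : I.Layout (s₃.arr 6) (s₃.arr 7) (s₃.arr 5) :=
    ⟨hw, hm, fun i => by rw [← hm]; exact htake_le _ (I.rank_lt i), fun x => by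
      rw [BoundedKnapsack.mem_greedy_iff_lt hw hm, htake _ (I.rank_lt x.1)]⟩
  have hw0 : ∀ q < I.n, 0 < s₃.arr 6 q := by
    intro q hq
    obtain ⟨i, rfl⟩ := I.exists_rank_eq hq
    rw [hw]; exact I.w_pos i
  have hwU : ∀ q < I.n, s₃.arr 6 q ≤ U := by
    intro q hq
    obtain ⟨i, rfl⟩ := I.exists_rank_eq hq
    rw [hw, hU, ← (hitem i).1]
    exact Finset.le_sup (f := (initState I).arr 0) (Finset.mem_range.2 i.2)
  have hdata : ScanData (I.magnitude ^ 7) I.magnitude I.n U (s₃.arr 6) (s₃.arr 7) (s₃.arr 5) := by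
    refine ⟨hsmall.two_le, hsmall.lt, hsmall.n_le, ?_, hw0, hwU, htake_le, ?_, ?_⟩
    · rw [hU]; exact Finset.sup_le fun j _ => hsmall.w_le j
    · intro q hq
      obtain ⟨i, rfl⟩ := I.exists_rank_eq hq
      rw [hm]
      have := I.item_le_magnitude i
      omega
    · rw [hlay.sum_mult]; exact I.sum_m_le_magnitude
  have hzero : ∀ a, 8 ≤ a → ∀ v, s₃.arr a v = 0 := by
    intro a ha v
    rw [darr a (by omega) (by omega) (by omega), barr a (by omega) (by omega)]
    simp only [initState]
    split_ifs <;> omega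
  obtain ⟨t₄, s₄, e₄, ht₄, -, f0, f1⟩ := runs_scanProg (X := s₂.arr 3) hdata
    ⟨d0, d2.trans (b2.trans (a2.trans hU.symm)), darr 3 (by decide) (by decide) (by decide),
      rfl, rfl, rfl⟩ (hzero 8 le_rfl) (hzero 9 (by decide)) (hzero 10 (by decide)) hs₃
  refine ⟨_, _, _, hlay, hw0, hwU, _, s₄, .seq e₁ (.seq e₂ (.seq e₃ e₄)), by omega, f0,
    fun i l hl hil j hj => ?_⟩
  obtain ⟨g1, g2⟩ := f1 l hl j hj
  exact ⟨by rw [g1, hil, hX], g2⟩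

/-- `U.size` is at most `log U + 1`, so that the number of selected copies is nearly linear. -/
theorem offset_le_mul_sq {D : Scan} {U wmax k : ℕ} (h0 : 0 < wmax) (hU : U ≤ wmax)
    (h : D.offset k ≤ 4 * U + 4 + 136 * U * U.size * U.size) :
    D.offset k ≤ 144 * wmax * (Nat.log 2 wmax + 1) ^ 2 := by
  have hs : U.size ≤ Nat.log 2 wmax + 1 := by
    refine (Nat.size_le_size hU).trans (Nat.size_le.2 ?_)
    exact Nat.lt_pow_succ_log_self (by norm_num) wmax
  obtain ⟨S, hS⟩ : ∃ S, S = Nat.log 2 wmax + 1 := ⟨_, rfl⟩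
  rw [← hS] at hs ⊢
  have hS1 : 1 ≤ S := by omega
  have h1 : 136 * U * U.size * U.size ≤ 136 * wmax * S * S := by gcongr
  have h2 : wmax * 1 ≤ wmax * (S * S) := Nat.mul_le_mul_left _ (Nat.mul_pos hS1 hS1)
  calc D.offset k ≤ 8 * (wmax * (S * S)) + 136 * wmax * S * S := by omega
    _ = 144 * wmax * S ^ 2 := by ring

/-- The total of the times of the four parts of the program. The time of the scan exceeds
`O(n * log U)` by the number of the selected copies. -/
theorem time_le {D : Scan} {n U wmax time C : ℕ}
    (hC : C = 2 * mergeStep.time + 2 * (loadProg.time + lookupProg.time + storeProg.time) + 4932)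
    (h0 : 0 < wmax) (hU : U ≤ wmax) (hD : D.U = U)
    (h : D.offset (2 * n) ≤ 4 * U + 4 + 136 * U * U.size * U.size)
    (ht : time ≤ 20 * (n + 1) + ((mergeStep.time + 30) * (n + 1) * (Nat.clog 2 n + 1) +
      (60 * (n + 1) + (∑ k ∈ Finset.range (2 * n), scanStepTime D k + 12 * n + 12)))) :
    time ≤ C * (n + wmax) * (Nat.log 2 (n + wmax) + 1) ^ 2 := by
  have hout := offset_le_mul_sq (D := D) (wmax := n + wmax) (by omega)
    (show U ≤ n + wmax by omega) h
  have hsum : ∑ k ∈ Finset.range (2 * n), scanStepTime D k = 2 * n * (loadProg.time +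
      lookupProg.time + storeProg.time + 30 + 100 * (U.size + 1)) + 30 * D.offset (2 * n) := by
    simp only [scanStepTime, hD]
    rw [Finset.sum_add_distrib, Finset.sum_const, Finset.card_range, smul_eq_mul,
      ← Finset.mul_sum, Scan.offset]
  rw [hsum] at ht
  have hs : U.size ≤ Nat.log 2 (n + wmax) + 1 := by
    refine (Nat.size_le_size (show U ≤ n + wmax by omega)).trans (Nat.size_le.2 ?_)
    exact Nat.lt_pow_succ_log_self (by norm_num) _
  have hc : Nat.clog 2 n ≤ Nat.log 2 (n + wmax) + 1 := by
    refine (Nat.clog_le_iff_le_pow (by norm_num)).2 ?_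
    have := Nat.lt_pow_succ_log_self (b := 2) (by norm_num) (n + wmax)
    rw [Nat.succ_eq_add_one] at this
    omega
  obtain ⟨S, hS⟩ : ∃ S, S = Nat.log 2 (n + wmax) + 1 := ⟨_, rfl⟩
  obtain ⟨K, hK⟩ : ∃ K, K = n + wmax := ⟨_, rfl⟩
  rw [← hS] at hs hc hout ⊢
  rw [← hK] at hout ⊢
  clear hsum
  generalize mergeStep.time = a at ht hC
  generalize loadProg.time + lookupProg.time + storeProg.time = b at ht hC
  have hS1 : 1 ≤ S := by omega
  have hKS : K ≤ K * S ^ 2 := Nat.le_mul_of_pos_right _ (by positivity)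
  have hn : n + 1 ≤ K := by omega
  have h1 : (a + 30) * (n + 1) * (Nat.clog 2 n + 1) ≤ (a + 30) * K * (2 * S ^ 2) := by
    gcongr; nlinarith
  have h2 : 2 * n * (b + 30 + 100 * (U.size + 1)) ≤ 2 * K * ((b + 230) * S ^ 2) := by
    gcongr
    · omega
    · have hSS : S ≤ S ^ 2 := Nat.le_self_pow (by norm_num) S
      have := Nat.le_mul_of_pos_right (b + 130) (show 0 < S ^ 2 by positivity)
      rw [show (b + 230) * S ^ 2 = (b + 130) * S ^ 2 + 100 * S ^ 2 by ring]
      omega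
  calc time ≤ 92 * K + ((a + 30) * K * (2 * S ^ 2) + 2 * K * ((b + 230) * S ^ 2) +
        30 * (144 * K * S ^ 2)) := by omega
    _ ≤ 92 * (K * S ^ 2) + ((a + 30) * K * (2 * S ^ 2) + 2 * K * ((b + 230) * S ^ 2) +
        30 * (144 * K * S ^ 2)) := by gcongr
    _ = (2 * a + 2 * b + 4932) * (K * S ^ 2) := by ring
    _ = C * K * S ^ 2 := by rw [hC]; ring

end WordRAM

theorem mainTheorem3 :
    ∃ (P : WordRAM.Program) (κ C c : ℕ),
      ∀ (I : BoundedKnapsack) (wmax : ℕ), 0 < wmax → (∀ i, I.w i ≤ wmax) →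
        ∃ (time : ℕ) (final : WordRAM.State) (L : List I.Copy),
          WordRAM.Exec (I.magnitude ^ κ) P (WordRAM.initState I) time final ∧
          time ≤ C * (I.n + wmax) * (Nat.log 2 (I.n + wmax) + 1) ^ c ∧
          WordRAM.Outputs final L ∧
          L.Nodup ∧
          L.length ≤ C * wmax * (Nat.log 2 wmax + 1) ^ c ∧
          ∃ opt : Finset I.Copy, I.IsOptimal opt ∧
            symmDiff I.greedy opt ⊆ L.toFinset := by
  obtain ⟨C, hC⟩ : ∃ C, C = 2 * WordRAM.mergeStep.time + 2 * (WordRAM.loadProg.time +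
    WordRAM.lookupProg.time + WordRAM.storeProg.time) + 4932 := ⟨_, rfl⟩
  refine ⟨WordRAM.candidateProg, 7, C, 2, fun I wmax h0 hwmax => ?_⟩
  obtain ⟨U, hU⟩ : ∃ U, U = (Finset.range I.n).sup ((WordRAM.initState I).arr 0) := ⟨_, rfl⟩
  have hUw : U ≤ wmax := by
    rw [hU]
    refine Finset.sup_le fun j hj => ?_
    have := hwmax ⟨j, Finset.mem_range.1 hj⟩
    simpa [WordRAM.initState, Finset.mem_range.1 hj] using this
  have hwU : ∀ i, I.w i ≤ U := fun i => by
    have := Finset.le_sup (f := (WordRAM.initState I).arr 0) (Finset.mem_range.2 i.2)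
    rw [← hU] at this
    simpa [WordRAM.initState] using this
  obtain ⟨w, m, take, hlay, hw0, hwq, time, final, hexec, htime, hreg, harr⟩ :=
    WordRAM.runs_candidateProg hU
  have hoff := offset_twoSidedScan_le (m := m) (take := take) hw0 hwq
  obtain ⟨L, hlen, hnodup, hL, hmem⟩ := hlay.exists_list U
  obtain ⟨opt, hopt, hun⟩ := I.exists_isOptimal_unimprovable
  refine ⟨time, final, L, hexec, WordRAM.time_le hC h0 hUw rfl hoff htime,
    ⟨hreg.trans hlen.symm, ?_⟩, hnodup, ?_, opt, hopt, fun x hx => ?_⟩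
  · intro t ht
    obtain ⟨l, hl, j, hj, h1, h2, h3⟩ := hL t ht
    obtain ⟨g1, g2⟩ := harr L[t].1 l hl h2.symm j hj
    rw [← h1] at g1 g2
    exact ⟨g1, g2.trans h3.symm⟩
  · rw [hlen]
    refine (WordRAM.offset_le_mul_sq h0 hUw hoff).trans ?_
    have hC' : 144 ≤ C := (show 144 ≤ 4932 by norm_num).trans (hC ▸ Nat.le_add_left _ _)
    gcongr
  · obtain ⟨j, hj, hxj⟩ := hlay.exists_of_mem_symmDiff hun hopt hwU hx
    exact List.mem_toFinset.2 (hmem x j hj hxj)
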